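/- **Setting.** Let $\mathcal P_n=\{I,X,Y,Z\}^{\otimes n}$, $|P|$ the number of non-identity factors of $P\in\mathcal P_n$, $\|O\|_{\mathrm F}^2=2^{-n}\mathrm{Tr}[O^\dagger O]$, and $\langle\!\langle A|B\rangle\!\rangle=2^{-n}\mathrm{Tr}[A^\dagger B]$. For $n,L\ge 1$, an $L$-layered random noisy circuit on $n$ qubits is $$\mathcal C=\mathcal V\circ\mathcal N^{\otimes n}\circ\mathcal U_L\circ\cdots\circ\mathcal N^{\otimes n}\circ\mathcal U_1 ,$$ where $\mathcal N$ is a single-qubit quantum channel, $\mathcal U_j=U_j(\cdot)U_j^\dagger$ with $U_j$ a layer of non-overlapping gates, each acting on at most $c$ qubits ($c$ a constant), and $\mathcal V=V(\cdot)V^\dagger$ with $V$ a tensor product of single-qubit gates. The layers $U_1,\dots,U_L,V$ are drawn independently from distributions $\mathcal D_1,\dots,\mathcal D_{L+1}$, and there is a unitary 1-design $\mathcal D_{\mathrm{single}}$ over $\mathbb U(2)$ such that the layers are locally unbiased: for every $i$ there is a distribution $\mathcal D_i'$ over $\mathbb U(2^n)$ with $$\mathbb E_{U\sim\mathcal D_i}\big[U^{\otimes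 2}\otimes U^{*\otimes 2}\big]=\mathbb E_{U\sim\mathcal D_i'}\,\mathbb E_{W\sim\mathcal D_{\mathrm{single}}^{\otimes n}}\big[(UW)^{\otimes 2}\otimes (UW)^{*\otimes 2}\big].$$ Let $\mathcal D_{\mathrm{circ}}$ be the resulting distribution of $\mathcal C$. With $O_A$ the sum of the Pauli terms of $O$ whose support is exactly $A$, its effective depolarizing rate is $p=1-\chi$, where $$\chi^2=\max_{\emptyset\ne A\subseteq[n]}\ \max_{O:\,O_A\neq0}\Big(\mathbb E_{W\sim\mathcal D_{\mathrm{single}}^{\otimes n}}\frac{\|\mathcal N^{\dagger\otimes n}(W^\dagger O_AW)\|_{\mathrm F}^2}{\|O_A\|_{\mathrm F}^2}\Big)^{1/|A|},$$ the second maximum being over Hermitian $O$. We assume $p\ge p_0$ for a constant $p_0>0$. Put $\mathcal C_j=\mathcal N^{\otimes n}\circ\mathcal U_j$ for $j<L$ and $\mathcal C_L=\mathcal V\circ\mathcal N^{\otimes n}\circ\mathcal U_L$. Path-weight-truncated Pauli propagation with cutoff $k$ estimates $\mathrm{Tr}[O\,\mathcal C(\rho)]$ by $$\sum_{(P_0,\dots,P_L)\in\mathcal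 P_n^{L+1},\ |P_1|+\dots+|P_L|<k}\langle\!\langle O|P_L\rangle\!\rangle\ \prod_{j=1}^L\langle\!\langle P_j|\mathcal C_j(P_{j-1})\rangle\!\rangle\ \mathrm{Tr}[P_0\rho].$$ Running time is the number of elementary steps of a deterministic algorithm on pointer-linked data with exact real arithmetic and comparisons at unit cost. The algorithm is given $n,L,\epsilon,\delta$, the transition amplitudes of $\mathcal N$ and the sampled circuit gate by gate (last layer first), and may query $\mathrm{Tr}[P\rho]$ for $P\in\mathcal P_n$ at unit cost. **Theorem (Time complexity).** Fix $c$ and $p_0>0$. 1. There are an algorithm and a cutoff $k=k(\epsilon,\delta)$ such that, for all $n,L,M\ge1$, every $\mathcal D_{\mathrm{circ}}$ as above with $p\ge p_0$, every $n$-qubit state $\rho$, every real linear combination $O$ of $M$ Pauli strings (given as the list of its terms) and all $\epsilon,\delta>0$, the algorithm computes the above estimate with cutoff $k$ in time $M\cdot\mathrm{poly}(n,1/\epsilon,1/\delta)$, and, with probability at least $1-\delta$ over $\mathcal C\sim\mathcal D_{\mathrm{circ}}$, the estimate is within $\epsilon\|O\|_{\mathrm F}$ of $\mathrm{Tr}[O\,\mathcal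 C(\rho)]$. The polynomial depends only on $c$ and $p_0$. 2. There are an algorithm and a cutoff $k=k(\epsilon,\delta)$ such that the following holds for all constants $a,\kappa,b>0$. For all $n,L\ge1$ with $L\ge a\log n$, every $\mathcal D_{\mathrm{circ}}$ as above with $p\ge p_0$ and unital noise ($\mathcal N(I)=I$), every $n$-qubit state $\rho$, every Hermitian $O$ (whose Pauli coefficients $\langle\!\langle O|P\rangle\!\rangle$ can be queried at unit cost) and all $\epsilon,\delta\ge\kappa n^{-b}$, the algorithm computes the above estimate with cutoff $k$ in time $\mathrm{poly}(n)$, and, with probability at least $1-\delta$ over $\mathcal C\sim\mathcal D_{\mathrm{circ}}$, the estimate is within $\epsilon\|O\|_{\mathrm F}$ of $\mathrm{Tr}[O\,\mathcal C(\rho)]$. The polynomial depends only on $c,p_0,a,\kappa,b$. -/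

import Mathlib

open MeasureTheory
open scoped Kronecker ComplexOrder

noncomputable section

namespace NoisyPauli

/-! ## Qubits, Pauli strings, norms -/

abbrev Bits (n : ℕ) := Fin n → Fin 2

/-- Linear operators on `n` qubits, in the computational basis. -/
abbrev Op (n : ℕ) := Matrix (Bits n) (Bits n) ℂ

abbrev Mat2 := Matrix (Fin 2) (Fin 2) ℂ

/-- Labels of Pauli strings: `0, 1, 2, 3` stand for `I, X, Y, Z`. -/
abbrev PauliString (n : ℕ) := Fin n → Fin 4

def pauliMatrix : Fin 4 → Mat2 :=
  ![1, !![0, 1; 1, 0], !![0, -Complex.I; Complex.I, 0], !![1, 0; 0, -1]]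

/-- The tensor product `A₁ ⊗ ⋯ ⊗ Aₙ`. -/
def tensor {n : ℕ} (A : Fin n → Mat2) : Op n :=
  Matrix.of fun x y => ∏ i, A i (x i) (y i)

def pauliOp {n : ℕ} (P : PauliString n) : Op n := tensor fun i => pauliMatrix (P i)

def supp {n : ℕ} (P : PauliString n) : Finset (Fin n) := Finset.univ.filter fun i => P i ≠ 0

def weight {n : ℕ} (P : PauliString n) : ℕ := (supp P).card

/-- `⟨⟨O|P⟩⟩ = 2⁻ⁿ Tr[O P]` for Hermitian `O`: the (real) Pauli coefficient of `O`. -/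
def pauliCoeff {n : ℕ} (O : Op n) (P : PauliString n) : ℝ :=
  (O * pauliOp P).trace.re / 2 ^ n

/-- `Tr[O σ]` for Hermitian `O` and `σ`, where this number is real. -/
def expval {n : ℕ} (O σ : Op n) : ℝ := (O * σ).trace.re

/-- The squared normalized Frobenius norm `2⁻ⁿ Tr[O† O]`. -/
def frobSq {n : ℕ} (O : Op n) : ℝ := (O.conjTranspose * O).trace.re / 2 ^ n

def frob {n : ℕ} (O : Op n) : ℝ := √(frobSq O)

/-- `n`-qubit density matrices. -/
def IsState {n : ℕ} (ρ : Op n) : Prop := ρ.PosSemidef ∧ ρ.trace = 1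

/-! ## Noise and its contraction coefficient -/

/-- Single-qubit quantum channels, through Kraus operators. -/
def IsChannel (N : Mat2 →ₗ[ℂ] Mat2) : Prop :=
  ∃ (r : ℕ) (K : Fin r → Mat2), ∑ k, (K k).conjTranspose * K k = 1 ∧
    ∀ X, N X = ∑ k, K k * X * (K k).conjTranspose

def IsUnital (N : Mat2 →ₗ[ℂ] Mat2) : Prop := N 1 = 1

/-- The map `N^{⊗n}`: on matrix units it acts as
`N^{⊗n}(|x⟩⟨y|) = ⨂ᵢ N(|xᵢ⟩⟨yᵢ|)`. -/
def tensorPow (N : Mat2 →ₗ[ℂ] Mat2) (n : ℕ) (X : Op n) : Op n :=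
  Matrix.of fun a b => ∑ x, ∑ y, X x y * ∏ i, N (Matrix.single (x i) (y i) 1) (a i) (b i)

/-- The adjoint of a linear map `Φ` for the Hilbert-Schmidt inner product
`⟨A, B⟩ = Tr[A† B]`; its `(i, j)` entry is the conjugate of `Tr[X† Φ(|i⟩⟨j|)]`. -/
def hsAdjoint {n : ℕ} (Φ : Op n → Op n) (X : Op n) : Op n :=
  Matrix.of fun i j => star (X.conjTranspose * Φ (Matrix.single i j 1)).trace

/-- The part `O_A` of `O` made of its Pauli terms with support exactly `A`. -/
def restrictTo {n : ℕ} (A : Finset (Fin n)) (O : Op n) : Op n :=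
  ∑ P ∈ Finset.univ.filter (fun P : PauliString n => supp P = A),
    (pauliCoeff O P : ℂ) • pauliOp P

/-- The unitary group on the basis `ι`. -/
abbrev UMat (ι : Type) [Fintype ι] [DecidableEq ι] := Matrix.unitaryGroup ι ℂ

instance (ι : Type) [Fintype ι] [DecidableEq ι] : MeasurableSpace (UMat ι) := borel _

instance (ι : Type) [Fintype ι] [DecidableEq ι] : BorelSpace (UMat ι) := ⟨rfl⟩

/-- `W₁ ⊗ ⋯ ⊗ Wₙ` for single-qubit unitaries. -/
def tensorU {n : ℕ} (W : Fin n → UMat (Fin 2)) : Op n := tensor fun i => (W i : Mat2)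

/-- The mean squared contraction coefficient `χ²_D(N)` of the noise with respect to the
distribution `D` of single-qubit gates: the largest value of
`(𝔼_W ‖N^{†⊗n}(W† O_A W)‖² / ‖O_A‖²)^{1/|A|}`, with `W` distributed as `D^{⊗n}`. -/
def contractionSq (n : ℕ) (D : Measure (UMat (Fin 2))) (N : Mat2 →ₗ[ℂ] Mat2) : ℝ :=
  sSup {r : ℝ | ∃ (A : Finset (Fin n)) (O : Op n), A.Nonempty ∧ O.IsHermitian ∧
    restrictTo A O ≠ 0 ∧
    r = ((∫ W : Fin n → UMat (Fin 2),
        frobSq (hsAdjoint (tensorPow N n)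
          ((tensorU W).conjTranspose * restrictTo A O * tensorU W)) ∂Measure.pi fun _ => D)
      / frobSq (restrictTo A O)) ^ (1 / (A.card : ℝ))}

/-! ## Random noisy circuits -/

/-- A unitary `1`-design on one qubit: `𝔼[U A U†] = (Tr A / 2) I`. -/
def IsOneDesign (D : Measure (UMat (Fin 2))) : Prop :=
  ∀ (A : Mat2) (i j : Fin 2),
    ∫ U : UMat (Fin 2), ((U : Mat2) * A * (U : Mat2).conjTranspose) i j ∂D
      = ((A.trace / 2) • (1 : Mat2)) i j

/-- `U^{⊗2} ⊗ U^{*⊗2}`. -/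
def secondPower {ι : Type} (U : Matrix ι ι ℂ) : Matrix ((ι × ι) × (ι × ι)) ((ι × ι) × (ι × ι)) ℂ :=
  (U ⊗ₖ U) ⊗ₖ (U.map star ⊗ₖ U.map star)

/-- Up to second moments, `D` is the law of `U W` with `U` drawn from some distribution `D'` and
`W` an independent layer of single-qubit gates drawn from `S^{⊗n}`. -/
def RightInvariant {n : ℕ} (S : Measure (UMat (Fin 2))) (D : Measure (UMat (Bits n))) : Prop :=
  ∃ D' : Measure (UMat (Bits n)), IsProbabilityMeasure D' ∧
    ∀ i j, ∫ U : UMat (Bits n), secondPower (U : Op n) i j ∂D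
      = ∫ U : UMat (Bits n), ∫ W : Fin n → UMat (Fin 2),
          secondPower ((U : Op n) * tensorU W) i j ∂(Measure.pi fun _ => S) ∂D'

/-- A gate acting on between `1` and `c` of the `n` qubits. -/
structure Gate (n c : ℕ) where
  arity : ℕ
  arity_pos : 1 ≤ arity
  arity_le : arity ≤ c
  qubit : Fin arity ↪ Fin n
  mat : UMat (Bits arity)

/-- The `n`-qubit operator of a gate: the gate on its qubits, the identity elsewhere. -/
def Gate.op {n c : ℕ} (g : Gate n c) : Op n :=
  open Classical in
  Matrix.of fun x y =>
    if ∀ i, i ∉ Set.range g.qubit → x i = y i then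
      (g.mat : Op g.arity) (fun a => x (g.qubit a)) (fun a => y (g.qubit a))
    else 0

/-- A layer of non-overlapping gates. -/
structure Layer (n c : ℕ) where
  gates : List (Gate n c)
  disjoint : gates.Pairwise fun g h => Disjoint (Set.range g.qubit) (Set.range h.qubit)

def Layer.op {n c : ℕ} (ℓ : Layer n c) : Op n := (ℓ.gates.map Gate.op).prod

/-- The unitaries `(U₁, …, U_L, V)` of an `L`-layered circuit; index `L` is the final layer `V`
of single-qubit gates. -/
abbrev Unitaries (n L : ℕ) := Fin (L + 1) → UMat (Bits n)

/-- The data of a distribution over `L`-layered noisy circuits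
`𝒱 ∘ N^{⊗n} ∘ 𝒰_L ∘ ⋯ ∘ N^{⊗n} ∘ 𝒰₁` with independent, locally unbiased layers whose gates act on
at most `c` qubits each. -/
structure NoisyEnsemble (n L c : ℕ) where
  noise : Mat2 →ₗ[ℂ] Mat2
  single : Measure (UMat (Fin 2))
  layer : Fin (L + 1) → Measure (UMat (Bits n))
  noise_channel : IsChannel noise
  single_prob : IsProbabilityMeasure single
  single_design : IsOneDesign single
  layer_prob : ∀ i, IsProbabilityMeasure (layer i)
  layer_local : ∀ j : Fin L, ∀ᵐ U : UMat (Bits n) ∂layer j.castSucc, ∃ ℓ : Layer n c, ℓ.op = (U : Op n)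
  final_product : ∀ᵐ V : UMat (Bits n) ∂layer (Fin.last L),
    ∃ W : Fin n → UMat (Fin 2), tensorU W = (V : Op n)
  layer_unbiased : ∀ i, RightInvariant single (layer i)

/-- The distribution of the circuit: all layers are independent. -/
def NoisyEnsemble.law {n L c : ℕ} (E : NoisyEnsemble n L c) : Measure (Unitaries n L) :=
  Measure.pi E.layer

/-- The effective depolarizing rate `p = 1 - χ_D(N)`. -/
def NoisyEnsemble.rate {n L c : ℕ} (E : NoisyEnsemble n L c) : ℝ :=
  1 - √(contractionSq n E.single E.noise)

/-- `X ↦ U X U†`. -/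
def conj {n : ℕ} (U : UMat (Bits n)) (X : Op n) : Op n :=
  (U : Op n) * X * (U : Op n).conjTranspose

/-- The output state `C(ρ)` of the noisy circuit. -/
def evolve {n L : ℕ} (N : Mat2 →ₗ[ℂ] Mat2) (ω : Unitaries n L) (ρ : Op n) : Op n :=
  conj (ω (Fin.last L))
    (Fin.foldl L (fun σ j => tensorPow N n (conj (ω j.castSucc) σ)) ρ)

/-! ## Truncated Pauli propagation -/

/-- The layers `C₁, …, C_L` of the circuit, the final single-qubit layer being part of `C_L`. -/
def layerMap {n L : ℕ} (N : Mat2 →ₗ[ℂ] Mat2) (ω : Unitaries n L) (j : Fin L) (X : Op n) : Op n :=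
  if (j : ℕ) + 1 = L then conj (ω (Fin.last L)) (tensorPow N n (conj (ω j.castSucc) X))
  else tensorPow N n (conj (ω j.castSucc) X)

/-- The transition amplitude `⟨⟨P|Φ|Q⟩⟩ = 2⁻ⁿ Tr[P Φ(Q)]`. -/
def amplitude {n : ℕ} (Φ : Op n → Op n) (P Q : PauliString n) : ℝ :=
  (pauliOp P * Φ (pauliOp Q)).trace.re / 2 ^ n

/-- Pauli paths `(P₀, P₁, …, P_L)`. -/
abbrev PauliPath (n L : ℕ) := Fin (L + 1) → PauliString n

/-- The path weight `|P₁| + ⋯ + |P_L|`; `P₀` does not count. -/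
def pathWeight {n L : ℕ} (γ : PauliPath n L) : ℕ := ∑ j : Fin L, weight (γ j.succ)

/-- The Fourier coefficient of a path. -/
def fourier {n L : ℕ} (N : Mat2 →ₗ[ℂ] Mat2) (ω : Unitaries n L) (γ : PauliPath n L) : ℝ :=
  ∏ j : Fin L, amplitude (layerMap N ω j) (γ j.succ) (γ j.castSucc)

/-- The estimate `Tr[O_C^{(k)} ρ]`, which keeps the Pauli paths of weight less than `k`. -/
def truncatedEstimate {n L : ℕ} (k : ℕ) (N : Mat2 →ₗ[ℂ] Mat2) (ω : Unitaries n L) (O ρ : Op n) :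
    ℝ :=
  ∑ γ ∈ Finset.univ.filter (fun γ : PauliPath n L => pathWeight γ < k),
    pauliCoeff O (γ (Fin.last L)) * fourier N ω γ * expval (pauliOp (γ 0)) ρ

/-- The circuits on which the estimate with cutoff `k` misses `Tr[O C(ρ)]` by more than
`ε ‖O‖_F`. -/
def failure {n L : ℕ} (k : ℕ) (N : Mat2 →ₗ[ℂ] Mat2) (O ρ : Op n) (ε : ℝ) : Set (Unitaries n L) :=
  {ω | ε * frob O < |truncatedEstimate k N ω O ρ - expval O (evolve N ω ρ)|}

/-! ## Machine model: exact real arithmetic on binary trees, with unit costs -/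

/-- Data of the machine: binary trees (as in Lisp) with real numbers at the leaves. -/
inductive Val where
  | nil : Val
  | real : ℝ → Val
  | pair : Val → Val → Val

/-- Programs are finite terms; the only numerical constants are `0` and `1`. -/
inductive Prog where
  | id : Prog
  | nil : Prog
  | zero : Prog
  | one : Prog
  | comp : Prog → Prog → Prog
  | pair : Prog → Prog → Prog
  | fst : Prog
  | snd : Prog
  | isPair : Prog
  | add : Prog
  | sub : Prog
  | mul : Prog
  | inv : Prog
  | ite : Prog → Prog → Prog → Prog
  | loop : Prog → Prog → Prog
  | queryState : Prog
  | queryObs : Prog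

/-- `Runs S B f x y t`: on input `x` the program `f` halts with output `y` after `t` elementary
steps. `ite b f g` runs `f` if the value of the test `b` is a positive real and `g` otherwise, and
`loop b f` repeats `f` as long as the test `b` is positive. `S` and `B` are the graphs of the two
oracles that `queryState` and `queryObs` may consult, at cost one per query. -/
inductive Runs (S B : Val → ℝ → Prop) : Prog → Val → Val → ℕ → Prop where
  | id (x : Val) : Runs S B .id x x 1
  | nil (x : Val) : Runs S B .nil x .nil 1
  | zero (x : Val) : Runs S B .zero x (.real 0) 1
  | one (x : Val) : Runs S B .one x (.real 1) 1
  | comp {g f : Prog} {x y z : Val} {s t : ℕ} :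
      Runs S B f x y s → Runs S B g y z t → Runs S B (.comp g f) x z (s + t + 1)
  | pair {f g : Prog} {x y z : Val} {s t : ℕ} :
      Runs S B f x y s → Runs S B g x z t → Runs S B (.pair f g) x (.pair y z) (s + t + 1)
  | fst (a b : Val) : Runs S B .fst (.pair a b) a 1
  | snd (a b : Val) : Runs S B .snd (.pair a b) b 1
  | isPair_pair (a b : Val) : Runs S B .isPair (.pair a b) (.real 1) 1
  | isPair_nil : Runs S B .isPair .nil (.real 0) 1
  | isPair_real (r : ℝ) : Runs S B .isPair (.real r) (.real 0) 1
  | add (r s : ℝ) : Runs S B .add (.pair (.real r) (.real s)) (.real (r + s)) 1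
  | sub (r s : ℝ) : Runs S B .sub (.pair (.real r) (.real s)) (.real (r - s)) 1
  | mul (r s : ℝ) : Runs S B .mul (.pair (.real r) (.real s)) (.real (r * s)) 1
  | inv (r : ℝ) : Runs S B .inv (.real r) (.real r⁻¹) 1
  | ite_pos {b f g : Prog} {x y : Val} {r : ℝ} {s t : ℕ} :
      Runs S B b x (.real r) s → 0 < r → Runs S B f x y t → Runs S B (.ite b f g) x y (s + t + 1)
  | ite_neg {b f g : Prog} {x y : Val} {r : ℝ} {s t : ℕ} :
      Runs S B b x (.real r) s → r ≤ 0 → Runs S B g x y t → Runs S B (.ite b f g) x y (s + t + 1)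
  | loop_stop {b f : Prog} {x : Val} {r : ℝ} {s : ℕ} :
      Runs S B b x (.real r) s → r ≤ 0 → Runs S B (.loop b f) x x (s + 1)
  | loop_step {b f : Prog} {x y z : Val} {r : ℝ} {s t u : ℕ} :
      Runs S B b x (.real r) s → 0 < r → Runs S B f x y t → Runs S B (.loop b f) y z u →
      Runs S B (.loop b f) x z (s + t + u + 1)
  | queryState {x : Val} {r : ℝ} : S x r → Runs S B .queryState x (.real r) 1
  | queryObs {x : Val} {r : ℝ} : B x r → Runs S B .queryObs x (.real r) 1

/-! ## Classical description of the input -/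

/-- A gate-by-gate description of a circuit. -/
structure CircuitDesc (n L c : ℕ) where
  layer : Fin L → Layer n c
  final : Fin n → UMat (Fin 2)

def CircuitDesc.Describes {n L c : ℕ} (d : CircuitDesc n L c) (ω : Unitaries n L) : Prop :=
  (∀ j : Fin L, (d.layer j).op = (ω j.castSucc : Op n)) ∧
    tensorU d.final = (ω (Fin.last L) : Op n)

def encNat (m : ℕ) : Val := .real m

def encComplex (z : ℂ) : Val := .pair (.real z.re) (.real z.im)

def encList : List Val → Val
  | [] => .nil
  | v :: vs => .pair v (encList vs)

/-- A Pauli string is the list of its `n` labels. -/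
def encPauli {n : ℕ} (P : PauliString n) : Val := encList (List.ofFn fun i => encNat (P i))

/-- A table indexed by bit strings, as a complete binary tree that branches on the first bit at
the root. -/
def encTable : (m : ℕ) → (Bits m → Val) → Val
  | 0, f => f Fin.elim0
  | m + 1, f => .pair (encTable m fun x => f (Fin.cons 0 x)) (encTable m fun x => f (Fin.cons 1 x))

def encMatrix {m : ℕ} (A : Op m) : Val := encTable m fun x => encTable m fun y => encComplex (A x y)

def encMat2 (A : Mat2) : Val :=
  encList (List.ofFn fun i => encList (List.ofFn fun j => encComplex (A i j)))

/-- A gate is given by the list of its qubits and its matrix. -/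
def encGate {n c : ℕ} (g : Gate n c) : Val :=
  .pair (encList (List.ofFn fun a => encNat (g.qubit a))) (encMatrix (g.mat : Op g.arity))

def encLayer {n c : ℕ} (ℓ : Layer n c) : Val := encList (ℓ.gates.map encGate)

/-- The noise channel is given by its sixteen transition amplitudes `½ Tr[P N(Q)]`. -/
def encNoise (N : Mat2 →ₗ[ℂ] Mat2) : Val :=
  encList (List.ofFn fun a => encList (List.ofFn fun b =>
    .real ((pauliMatrix a * N (pauliMatrix b)).trace.re / 2)))

/-- The circuit in the order of the Heisenberg evolution: final single-qubit gates first, then the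
layers from the last to the first. -/
def encCircuit {n L c : ℕ} (d : CircuitDesc n L c) : Val :=
  .pair (encList (List.ofFn fun i => encMat2 (d.final i : Mat2)))
    (encList (List.ofFn fun j => encLayer (d.layer j)).reverse)

/-- `∑ₘ aₘ Pₘ` -/
def sumOfTerms {n M : ℕ} (T : Fin M → PauliString n × ℝ) : Op n :=
  ∑ m, ((T m).2 : ℂ) • pauliOp (T m).1

def encTerms {n M : ℕ} (T : Fin M → PauliString n × ℝ) : Val :=
  encList (List.ofFn fun m => .pair (encPauli (T m).1) (.real (T m).2))

/-- The part of the input that does not concern the observable. -/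
def encInput {n L c : ℕ} (N : Mat2 →ₗ[ℂ] Mat2) (d : CircuitDesc n L c) (ε δ : ℝ) : Val :=
  encList [encNat n, encNat L, .real ε, .real δ, encNoise N, encCircuit d]

/-- The oracle for the numbers `Tr[P ρ]`. -/
def stateOracle {n : ℕ} (ρ : Op n) (x : Val) (r : ℝ) : Prop :=
  ∃ P : PauliString n, x = encPauli P ∧ r = expval (pauliOp P) ρ

/-- The oracle for the Pauli coefficients of `O`. -/
def obsOracle {n : ℕ} (O : Op n) (x : Val) (r : ℝ) : Prop :=
  ∃ P : PauliString n, x = encPauli P ∧ r = pauliCoeff O P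

/-- The oracle that never answers. -/
def noOracle (_ : Val) (_ : ℝ) : Prop := False

end NoisyPauli

end

/-! Two facts are combined: the discarded part of the path sum is small in mean square, and the kept
part can be generated with few nonzero terms.

Accuracy. In the Heisenberg picture the observable is a real row vector of Pauli coefficients, which
each layer multiplies by its matrix of transition amplitudes; the truncation error is the sum `tail`
over the paths of weight at least `k`. The layers are independent, so the squared error is averaged
from the observable side inwards. Only second moments of a layer matter, hence the layer may be
replaced by `U W` with `W` a random layer of single-qubit gates. The factor `U` preserves the
Frobenius norm, and the 1-design makes components with different supports uncorrelated
(`integral_decouple`). On the component with support `A` the noise contracts the mean square by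
`χ^(2|A|)` (`integral_noise_sq_le`) while the weight budget drops by `|A|`, so every unit of weight
is paid for by a factor `χ²`. What finally meets the state is bounded by its Frobenius norm, because
a locally randomized state is maximally mixed on average (`integral_expval_sq_le`). This gives the
mean square bound `χ^(2k) ‖O‖²` (`tail_secondMoment_le`), and Chebyshev's inequality
(`law_failure_le`) shows that a cutoff logarithmic in `1/(ε²δ)` suffices.

Cost of one Pauli term. Noise and gates fix the identity and the gates of a layer are disjoint, so
one layer turns a string of weight `w` into at most `growth c ^ w` strings. A term with budget `b`
is given the potential `growth c ^ b`; the weight it pays offsets its splitting, so the total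
potential never increases (`potential_backTerms`). All lists thus have length at most a fixed power
of `2^k`, which is polynomial in `1/ε` and `1/δ`. A non-identity string pays in every layer, so only
the `k` layers next to the observable matter (`back_take`) and the depth does not enter the running
time.

Arbitrary observables. Their terms cannot be listed. But a path of weight below `k` through `m = min
k L` layers has, by pigeonhole, a string of weight at most `θ = (k-1)/m`. With `k = O(log n)` and `L
≥ a log n` this `θ` is bounded, so the at most `(4n)^θ` candidates can be enumerated. Paths are
sorted by their light string nearest to the observable (`sum_back_eq_splitSum`). From it one
propagates towards the state as before and also towards the observable; there unitality makes the
noise fix the identity in the opposite direction, and a similar potential works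
(`potential_fwTerms`).

Machine. `PT` speaks of a family of inputs and one program for all of them. It is closed under
composition, branching, loops and list operations, so programs are assembled like functions and
their running time reduces to bounds on the lengths of intermediate lists. -/

noncomputable section

namespace NoisyPauli

/-! ## Uniform computability with step counts -/

/-- The oracles of a run and the size in which its length is measured. -/
structure World where
  S : Val → ℝ → Prop
  B : Val → ℝ → Prop
  size : ℕ

/-- One program computes `y k` from `x k` within `T k` steps, for every index `k`. -/
def Computes {κ : Type} (w : κ → World) (x y : κ → Val) (T : κ → ℕ) : Prop :=
  ∃ f : Prog, ∀ k, ∃ t ≤ T k, Runs (w k).S (w k).B f (x k) (y k) t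

/-- The shift by 2 keeps the base at least 2, so powers of it absorb constants and sums; no leading
coefficient is needed. -/
def Poly {κ : Type} (w : κ → World) (T : κ → ℕ) : Prop :=
  ∃ r : ℕ, ∀ k, T k ≤ ((w k).size + 2) ^ r

/-- `y` is computable from `x` in polynomial time, uniformly in the index. -/
def PT {κ : Type} (w : κ → World) (x y : κ → Val) : Prop :=
  ∃ T, Poly w T ∧ Computes w x y T

section Poly

variable {κ κ' : Type} {w : κ → World}

theorem Poly.mono {S T : κ → ℕ} (h : Poly w T) (hle : ∀ k, S k ≤ T k) : Poly w S := by
  obtain ⟨r, hr⟩ := h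
  exact ⟨r, fun k => (hle k).trans (hr k)⟩

theorem Poly.const (c : ℕ) : Poly w fun _ => c :=
  ⟨c, fun k => (Nat.lt_two_pow_self).le.trans (Nat.pow_le_pow_left (by omega) c)⟩

theorem Poly.size : Poly w fun k => (w k).size := ⟨1, fun k => by simp⟩

theorem Poly.mul {S T : κ → ℕ} (hS : Poly w S) (hT : Poly w T) : Poly w fun k => S k * T k := by
  obtain ⟨r, hr⟩ := hS
  obtain ⟨s, hs⟩ := hT
  exact ⟨r + s, fun k => by rw [pow_add]; exact Nat.mul_le_mul (hr k) (hs k)⟩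

theorem Poly.add {S T : κ → ℕ} (hS : Poly w S) (hT : Poly w T) : Poly w fun k => S k + T k := by
  obtain ⟨r, hr⟩ := hS
  obtain ⟨s, hs⟩ := hT
  refine ⟨1 + (r + s), fun k => ?_⟩
  have h1 : (((w k).size + 2) ^ r : ℕ) ≤ ((w k).size + 2) ^ (r + s) :=
    Nat.pow_le_pow_right (by omega) (by omega)
  have h2 : (((w k).size + 2) ^ s : ℕ) ≤ ((w k).size + 2) ^ (r + s) :=
    Nat.pow_le_pow_right (by omega) (by omega)
  calc S k + T k ≤ 2 * ((w k).size + 2) ^ (r + s) := by have := hr k; have := hs k; omega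
    _ ≤ _ := by rw [pow_add _ 1, pow_one]; exact Nat.mul_le_mul (by omega) le_rfl

theorem Poly.pow {S : κ → ℕ} (hS : Poly w S) (c : ℕ) : Poly w fun k => S k ^ c := by
  obtain ⟨r, hr⟩ := hS
  exact ⟨r * c, fun k => by rw [pow_mul]; exact Nat.pow_le_pow_left (hr k) c⟩

theorem Poly.reindex {T : κ → ℕ} (h : Poly w T) (σ : κ' → κ) :
    Poly (fun k => w (σ k)) fun k => T (σ k) := by
  obtain ⟨r, hr⟩ := h
  exact ⟨r, fun k => hr (σ k)⟩

end Poly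

section Basic

variable {κ κ' : Type} {w : κ → World} {x y z : κ → Val}

theorem Computes.mono {S T : κ → ℕ} (h : Computes w x y S) (hle : ∀ k, S k ≤ T k) :
    Computes w x y T := by
  obtain ⟨f, hf⟩ := h
  refine ⟨f, fun k => ?_⟩
  obtain ⟨t, ht, h⟩ := hf k
  exact ⟨t, ht.trans (hle k), h⟩

theorem Computes.comp {S T : κ → ℕ} (h : Computes w x y S) (h' : Computes w y z T) :
    Computes w x z fun k => S k + T k + 1 := by
  obtain ⟨f, hf⟩ := h
  obtain ⟨g, hg⟩ := h'
  refine ⟨.comp g f, fun k => ?_⟩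
  obtain ⟨s, hs, h1⟩ := hf k
  obtain ⟨t, ht, h2⟩ := hg k
  exact ⟨s + t + 1, by dsimp only; omega, .comp h1 h2⟩

theorem Computes.pair {S T : κ → ℕ} (h : Computes w x y S) (h' : Computes w x z T) :
    Computes w x (fun k => .pair (y k) (z k)) fun k => S k + T k + 1 := by
  obtain ⟨f, hf⟩ := h
  obtain ⟨g, hg⟩ := h'
  refine ⟨.pair f g, fun k => ?_⟩
  obtain ⟨s, hs, h1⟩ := hf k
  obtain ⟨t, ht, h2⟩ := hg k
  exact ⟨s + t + 1, by dsimp only; omega, .pair h1 h2⟩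

theorem PT.comp (h : PT w x y) (h' : PT w y z) : PT w x z := by
  obtain ⟨S, pS, hS⟩ := h
  obtain ⟨T, pT, hT⟩ := h'
  exact ⟨_, (pS.add pT).add (.const 1), hS.comp hT⟩

theorem PT.pair (h : PT w x y) (h' : PT w x z) : PT w x fun k => .pair (y k) (z k) := by
  obtain ⟨S, pS, hS⟩ := h
  obtain ⟨T, pT, hT⟩ := h'
  exact ⟨_, (pS.add pT).add (.const 1), hS.pair hT⟩

theorem PT.of_prog (f : Prog) (h : ∀ k, Runs (w k).S (w k).B f (x k) (y k) 1) : PT w x y :=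
  ⟨fun _ => 1, .const 1, f, fun k => ⟨1, le_rfl, h k⟩⟩

theorem PT.id : PT w x x := .of_prog .id fun _ => .id _

theorem PT.nil : PT w x fun _ => .nil := .of_prog .nil fun _ => .nil _

theorem PT.zero : PT w x fun _ => .real 0 := .of_prog .zero fun _ => .zero _

theorem PT.one : PT w x fun _ => .real 1 := .of_prog .one fun _ => .one _

theorem PT.fst (h : PT w x fun k => .pair (y k) (z k)) : PT w x y :=
  h.comp (.of_prog .fst fun _ => .fst _ _)

theorem PT.snd (h : PT w x fun k => .pair (y k) (z k)) : PT w x z :=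
  h.comp (.of_prog .snd fun _ => .snd _ _)

variable {r s : κ → ℝ}

theorem PT.add (h : PT w x fun k => .real (r k)) (h' : PT w x fun k => .real (s k)) :
    PT w x fun k => .real (r k + s k) :=
  (h.pair h').comp (.of_prog .add fun _ => .add _ _)

theorem PT.sub (h : PT w x fun k => .real (r k)) (h' : PT w x fun k => .real (s k)) :
    PT w x fun k => .real (r k - s k) :=
  (h.pair h').comp (.of_prog .sub fun _ => .sub _ _)

theorem PT.mul (h : PT w x fun k => .real (r k)) (h' : PT w x fun k => .real (s k)) :
    PT w x fun k => .real (r k * s k) :=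
  (h.pair h').comp (.of_prog .mul fun _ => .mul _ _)

theorem PT.inv (h : PT w x fun k => .real (r k)) : PT w x fun k => .real (r k)⁻¹ :=
  h.comp (.of_prog .inv fun _ => .inv _)

theorem PT.natCast (m : ℕ) : PT w x fun _ => .real (m : ℝ) := by
  induction m with
  | zero => simpa using PT.zero
  | succ m ih => simpa using ih.add .one

theorem PT.queryState (h : PT w x y) (hS : ∀ k, (w k).S (y k) (r k)) :
    PT w x fun k => .real (r k) :=
  h.comp (.of_prog .queryState fun k => .queryState (hS k))

theorem PT.queryObs (h : PT w x y) (hB : ∀ k, (w k).B (y k) (r k)) :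
    PT w x fun k => .real (r k) :=
  h.comp (.of_prog .queryObs fun k => .queryObs (hB k))

/-- The program does not depend on the index. A statement proved for one family therefore passes to
subfamilies and to families with more data: the indices of one branch, the passes of a loop, the
elements of a list. -/
theorem PT.reindex (h : PT w x y) (σ : κ' → κ) :
    PT (fun k => w (σ k)) (fun k => x (σ k)) fun k => y (σ k) := by
  obtain ⟨T, pT, f, hf⟩ := h
  exact ⟨_, pT.reindex σ, f, fun k => hf (σ k)⟩

/-- A value computable from `x` is computable from everything that determines `x`. -/
theorem PT.lift (h : PT w x y) (σ : κ' → κ) {x' : κ' → Val}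
    (hx : PT (fun k => w (σ k)) x' fun k => x (σ k)) :
    PT (fun k => w (σ k)) x' fun k => y (σ k) :=
  hx.comp (h.reindex σ)

theorem PT.congr {y' : κ → Val} (h : PT w x y) (hy : ∀ k, y k = y' k) : PT w x y' := by
  rwa [← funext hy]

/-- A branch has to be correct and fast only on the indices that reach it, hence the families over
subtypes. Case-dependent size bounds enter the running time in this way. -/
theorem PT.ite (p : κ → Prop) (hb : PT w x fun k => .real (r k)) (hr : ∀ k, 0 < r k ↔ p k)
    (h1 : PT (fun k : {k // p k} => w k) (fun k => x k) fun k => y k)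
    (h2 : PT (fun k : {k // ¬ p k} => w k) (fun k => x k) fun k => y k) : PT w x y := by
  obtain ⟨T, ⟨a, pT⟩, f, hf⟩ := hb
  obtain ⟨T1, ⟨a1, pT1⟩, f1, hf1⟩ := h1
  obtain ⟨T2, ⟨a2, pT2⟩, f2, hf2⟩ := h2
  -- The bounds `T1` and `T2` exist only on the subtypes, so the global bound is written with the
  -- explicit powers that dominate them.
  refine ⟨fun k => ((w k).size + 2) ^ a + ((w k).size + 2) ^ a1 + ((w k).size + 2) ^ a2 + 1, ?_,
    .ite f f1 f2, fun k => ?_⟩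
  · exact ((Poly.add ⟨a, fun _ => le_rfl⟩ ⟨a1, fun _ => le_rfl⟩).add ⟨a2, fun _ => le_rfl⟩).add
      (.const 1)
  · obtain ⟨s, hs, h⟩ := hf k
    by_cases hp : p k
    · obtain ⟨t, ht, h'⟩ := hf1 ⟨k, hp⟩
      have := pT k
      have := pT1 ⟨k, hp⟩
      exact ⟨s + t + 1, by dsimp only at *; omega, .ite_pos h ((hr k).2 hp) h'⟩
    · obtain ⟨t, ht, h'⟩ := hf2 ⟨k, hp⟩
      have := pT k
      have := pT2 ⟨k, hp⟩
      exact ⟨s + t + 1, by dsimp only at *; omega,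
        .ite_neg h (not_lt.1 fun h0 => hp ((hr k).1 h0)) h'⟩

theorem PT.ite_of_pt (p : κ → Prop) [∀ k, Decidable (p k)] (hb : PT w x fun k => .real (r k))
    (hr : ∀ k, 0 < r k ↔ p k) (h1 : PT w x y) (h2 : PT w x z) :
    PT w x fun k => if p k then y k else z k := by
  refine .ite p hb hr ?_ ?_
  · exact (h1.reindex Subtype.val).congr fun k => (if_pos k.2).symm
  · exact (h2.reindex Subtype.val).congr fun k => (if_neg k.2).symm

/-- Case distinction on a computable number below a constant. -/
theorem PT.cases_nat (v : κ → ℕ) (m : ℕ) (hv : PT w x fun k => encNat (v k)) (hm : ∀ k, v k ≤ m)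
    (h : ∀ j ≤ m, PT (fun k : {k // v k = j} => w k) (fun k => x k) fun k => y k) :
    PT w x y := by
  induction m generalizing κ with
  | zero =>
    obtain ⟨T, ⟨a, pT⟩, f, hf⟩ := h 0 le_rfl
    exact ⟨_, ⟨a, fun k => le_rfl⟩, f, fun k =>
      have hk : v k = 0 := by have := hm k; omega
      have ⟨t, ht, h⟩ := hf ⟨k, hk⟩
      ⟨t, ht.trans (pT ⟨k, hk⟩), h⟩⟩
  | succ m ih =>
    refine .ite (fun k => v k = m + 1) (PT.sub hv (.natCast m)) (fun k => ?_)
      (h _ le_rfl) ?_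
    · rw [sub_pos, Nat.cast_lt]
      have := hm k
      omega
    · refine ih (fun k => v k) (hv.reindex Subtype.val) (fun k => ?_) fun j hj => ?_
      · have := hm k; have := k.2; omega
      · exact (h j (by omega)).reindex
          (fun k : {k : {k // ¬ v k = m + 1} // v k = j} => (⟨k.1.1, k.2⟩ : {k // v k = j}))

end Basic

/-! ## Loops -/

/-- The indices of the passes of a loop with `len k` passes. -/
abbrev Below {κ : Type} (len : κ → ℕ) := {p : κ × ℕ // p.2 < len p.1}

section Loops

variable {κ : Type} {w : κ → World} {x : κ → Val}

theorem Computes.while {len : κ → ℕ} {st : κ → ℕ → Val} {r : κ → ℕ → ℝ} {Tb Tf : κ → ℕ}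
    (hb : Computes (fun p : Below (fun k => len k + 1) => w p.1.1) (fun p => st p.1.1 p.1.2)
      (fun p => .real (r p.1.1 p.1.2)) fun p => Tb p.1.1)
    (hr : ∀ k i, i ≤ len k → (0 < r k i ↔ i < len k))
    (hf : Computes (fun p : Below len => w p.1.1) (fun p => st p.1.1 p.1.2)
      (fun p => st p.1.1 (p.1.2 + 1)) fun p => Tf p.1.1) :
    Computes w (fun k => st k 0) (fun k => st k (len k))
      fun k => (len k + 1) * (Tb k + Tf k + 1) := by
  obtain ⟨b, hb⟩ := hb
  obtain ⟨f, hf⟩ := hf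
  refine ⟨.loop b f, fun k => ?_⟩
  -- Induction on the number `j` of passes that are still to come, since a run of the loop is built
  -- from its end.
  have key : ∀ j ≤ len k, ∃ t ≤ (j + 1) * (Tb k + Tf k + 1),
      Runs (w k).S (w k).B (.loop b f) (st k (len k - j)) (st k (len k)) t := by
    intro j
    induction j with
    | zero =>
      intro _
      obtain ⟨s, hs, h⟩ := hb ⟨(k, len k), by simp⟩
      refine ⟨s + 1, by dsimp only at *; omega, ?_⟩
      constructor
      · exact h
      · exact not_lt.1 fun h0 => lt_irrefl _ ((hr k _ le_rfl).1 h0)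
    | succ j ih =>
      intro hj
      obtain ⟨u, hu, h⟩ := ih (by omega)
      obtain ⟨s, hs, h1⟩ := hb ⟨(k, len k - (j + 1)), by dsimp only; omega⟩
      obtain ⟨t, ht, h2⟩ := hf ⟨(k, len k - (j + 1)), by dsimp only; omega⟩
      dsimp only at *
      rw [show len k - (j + 1) + 1 = len k - j by omega] at h2
      refine ⟨s + t + u + 1, ?_, .loop_step h1 ((hr k _ (by omega)).2 (by omega)) h2 h⟩
      rw [add_mul _ 1, one_mul]
      omega
  obtain ⟨t, ht, h⟩ := key (len k) le_rfl
  exact ⟨t, ht, by simpa using h⟩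

theorem PT.computes_pow {y : κ → Val} (h : PT w x y) :
    ∃ a : ℕ, Computes w x y fun k => ((w k).size + 2) ^ a := by
  obtain ⟨T, ⟨a, pT⟩, h⟩ := h
  exact ⟨a, h.mono pT⟩

theorem PT.while {len : κ → ℕ} {st : κ → ℕ → Val} {r : κ → ℕ → ℝ} (hlen : Poly w len)
    (hb : PT (fun p : Below (fun k => len k + 1) => w p.1.1) (fun p => st p.1.1 p.1.2)
      fun p => .real (r p.1.1 p.1.2))
    (hr : ∀ k i, i ≤ len k → (0 < r k i ↔ i < len k))
    (hf : PT (fun p : Below len => w p.1.1) (fun p => st p.1.1 p.1.2)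
      fun p => st p.1.1 (p.1.2 + 1)) :
    PT w (fun k => st k 0) fun k => st k (len k) := by
  obtain ⟨a, hb⟩ := hb.computes_pow
  obtain ⟨a', hf⟩ := hf.computes_pow
  exact ⟨_, (hlen.add (.const 1)).mul
    ((Poly.add ⟨a, fun _ => le_rfl⟩ ⟨a', fun _ => le_rfl⟩).add (.const 1)),
    Computes.while (Tb := fun k => ((w k).size + 2) ^ a) (Tf := fun k => ((w k).size + 2) ^ a')
      hb hr hf⟩

theorem encList_drop {l : List Val} {i : ℕ} (h : i < l.length) :
    encList (l.drop i) = .pair l[i] (encList (l.drop (i + 1))) := by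
  rw [List.drop_eq_getElem_cons h, encList]

/-- The loop over a list; the state after `i` passes is `st k i`. -/
theorem PT.fold_computes {l : κ → List Val} {st : κ → ℕ → Val}
    (hf : PT (fun p : Below (fun k => (l k).length) => w p.1.1)
      (fun p => .pair (x p.1.1)
        (.pair (encNat p.1.2) (.pair ((l p.1.1)[p.1.2]'p.2) (st p.1.1 p.1.2))))
      fun p => st p.1.1 (p.1.2 + 1)) :
    ∃ a : ℕ, Computes w (fun k => .pair (x k) (.pair (encList (l k)) (st k 0)))
      (fun k => st k (l k).length) fun k => (l k).length.succ * ((w k).size + 2) ^ a := by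
  -- The loop state holds the input, the pass counter, the unread part of the list and the
  -- accumulator; the loop stops when the unread part is no longer a pair.
  set S : κ → ℕ → Val := fun k i =>
    .pair (x k) (.pair (encNat i) (.pair (encList ((l k).drop i)) (st k i))) with hS
  have hb : PT (fun p : Below (fun k => (l k).length + 1) => w p.1.1) (fun p => S p.1.1 p.1.2)
      fun p => .real (if p.1.2 < (l p.1.1).length then 1 else 0) := by
    refine (PT.id.snd.snd.fst).comp (.of_prog .isPair fun p => ?_)
    dsimp only
    split_ifs with h
    · rw [encList_drop h]; exact .isPair_pair _ _
    · rw [List.drop_eq_nil_of_le (by omega)]; exact .isPair_nil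
  have hstep : PT (fun p : Below (fun k => (l k).length) => w p.1.1) (fun p => S p.1.1 p.1.2)
      fun p => S p.1.1 (p.1.2 + 1) := by
    have h0 : PT (fun p : Below (fun k => (l k).length) => w p.1.1) (fun p => S p.1.1 p.1.2)
        fun p => .pair (x p.1.1) (.pair (encNat p.1.2) (.pair (.pair ((l p.1.1)[p.1.2]'p.2)
          (encList ((l p.1.1).drop (p.1.2 + 1)))) (st p.1.1 p.1.2))) :=
      PT.id.congr fun p => by rw [hS, ← encList_drop p.2]
    have h1 := (h0.fst.pair (h0.snd.fst.pair (h0.snd.snd.fst.fst.pair h0.snd.snd.snd))).comp hf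
    refine h0.fst.pair (PT.pair ?_ (h0.snd.snd.fst.snd.pair h1))
    exact (h0.snd.fst.add .one).congr fun p => by simp [encNat]
  obtain ⟨a, hb⟩ := hb.computes_pow
  obtain ⟨a', hstep⟩ := hstep.computes_pow
  have hr : ∀ (k : κ) (i : ℕ), i ≤ (l k).length →
      (0 < (if i < (l k).length then (1 : ℝ) else 0) ↔ i < (l k).length) := by
    intro k i _
    split_ifs with h <;> simp [h]
  have hw := Computes.while (Tb := fun k => ((w k).size + 2) ^ a)
    (Tf := fun k => ((w k).size + 2) ^ a') (len := fun k => (l k).length) hb hr hstep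
  have hin : PT w (fun k => .pair (x k) (.pair (encList (l k)) (st k 0))) fun k => S k 0 :=
    (PT.id.fst.pair (PT.zero.pair (PT.id.snd.fst.pair PT.id.snd.snd))).congr fun k => by
      simp [hS, encNat]
  obtain ⟨a₁, hin⟩ := hin.computes_pow
  have hout : PT w (fun k => S k (l k).length) fun k => st k (l k).length := PT.id.snd.snd.snd
  obtain ⟨a₂, hout⟩ := hout.computes_pow
  obtain ⟨e, he⟩ : Poly w fun k => ((w k).size + 2) ^ a₁ + (((w k).size + 2) ^ a +
      ((w k).size + 2) ^ a' + 1) + 1 + ((w k).size + 2) ^ a₂ + 1 :=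
    ((((Poly.add ⟨a₁, fun _ => le_rfl⟩ ((Poly.add ⟨a, fun _ => le_rfl⟩
      ⟨a', fun _ => le_rfl⟩).add (.const 1))).add (.const 1)).add ⟨a₂, fun _ => le_rfl⟩).add
      (.const 1))
  -- The length of the list stays an explicit factor and is not assumed polynomial in the size: this
  -- factor becomes `M` in the first algorithm.
  refine ⟨e, ((hin.comp hw).comp hout).mono fun k => ?_⟩
  refine le_trans ?_ (Nat.mul_le_mul_left _ (he k))
  dsimp only
  rw [Nat.succ_eq_add_one]
  nlinarith [Nat.zero_le ((l k).length * (((w k).size + 2) ^ a₁ + 2 + ((w k).size + 2) ^ a₂))]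

theorem PT.fold {l : κ → List Val} {st : κ → ℕ → Val} (hlen : Poly w fun k => (l k).length)
    (hl : PT w x fun k => encList (l k)) (h0 : PT w x fun k => st k 0)
    (hf : PT (fun p : Below (fun k => (l k).length) => w p.1.1)
      (fun p => .pair (x p.1.1)
        (.pair (encNat p.1.2) (.pair ((l p.1.1)[p.1.2]'p.2) (st p.1.1 p.1.2))))
      fun p => st p.1.1 (p.1.2 + 1)) :
    PT w x fun k => st k (l k).length := by
  obtain ⟨a, h⟩ := PT.fold_computes hf
  exact (PT.id.pair (hl.pair h0)).comp
    ⟨_, (hlen.add (.const 1)).mul ⟨a, fun _ => le_rfl⟩, h⟩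

end Loops

/-! ## Lists -/

section Lists

variable {κ : Type} {w : κ → World} {x : κ → Val}

theorem PT.cons {v : κ → Val} {l : κ → List Val} (hv : PT w x v)
    (hl : PT w x fun k => encList (l k)) : PT w x fun k => encList (v k :: l k) :=
  hv.pair hl

theorem PT.reverseAppend {l l' : κ → List Val} (hlen : Poly w fun k => (l k).length)
    (hl : PT w x fun k => encList (l k)) (hl' : PT w x fun k => encList (l' k)) :
    PT w x fun k => encList ((l k).reverse ++ l' k) := by
  refine (PT.fold (st := fun k i => encList (((l k).take i).reverse ++ l' k)) hlen hl
    (hl'.congr fun k => by simp) ?_).congr fun k => by simp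
  refine (PT.id.snd.snd.fst.cons (PT.id.snd.snd.snd)).congr fun p => ?_
  rw [List.take_succ_eq_append_getElem p.2]
  simp [-List.take_append_getElem]

theorem PT.reverse {l : κ → List Val} (hlen : Poly w fun k => (l k).length)
    (hl : PT w x fun k => encList (l k)) : PT w x fun k => encList (l k).reverse :=
  (hl.reverseAppend hlen .nil (l' := fun _ => [])).congr fun k => by simp

/-- The members of a family of lists. -/
abbrev Elem {κ : Type} {α : κ → Type} (l : ∀ k, List (α k)) := Σ k, {a : α k // a ∈ l k}

/-- Lists grow only at the head, so the result is accumulated in reverse and turned around at the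
end. The bound on the whole output also bounds each piece that is prepended. -/
theorem PT.flatMap {α β : κ → Type} {l : ∀ k, List (α k)} {e : ∀ k, α k → Val}
    {e' : ∀ k, β k → Val} {g : ∀ k, α k → List (β k)}
    (hlen : Poly w fun k => (l k).length) (hlen' : Poly w fun k => ((l k).flatMap (g k)).length)
    (hl : PT w x fun k => encList ((l k).map (e k)))
    (hg : PT (fun p : Elem l => w p.1) (fun p => .pair (x p.1) (e p.1 p.2))
      fun p => encList ((g p.1 p.2).map (e' p.1))) :
    PT w x fun k => encList (((l k).flatMap (g k)).map (e' k)) := by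
  have key : PT w x fun k => encList (((l k).flatMap (g k)).map (e' k)).reverse := by
    refine (PT.fold (l := fun k => (l k).map (e k)) (st := fun k i =>
      encList ((((l k).take i).flatMap (g k)).map (e' k)).reverse) (by simpa using hlen) hl
      (PT.nil.congr fun k => by simp [encList]) ?_).congr fun k => by simp
    have hg' := hg.reindex (fun p : Below (fun k => ((l k).map (e k)).length) =>
      (⟨p.1.1, (l p.1.1)[p.1.2]'(by simpa using p.2), List.getElem_mem _⟩ : Elem l))
    have hin : PT (fun p : Below (fun k => ((l k).map (e k)).length) => w p.1.1)
      (fun p => .pair (x p.1.1) (.pair (encNat p.1.2) (.pair (((l p.1.1).map (e p.1.1))[p.1.2]'p.2)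
        (encList ((((l p.1.1).take p.1.2).flatMap (g p.1.1)).map (e' p.1.1)).reverse))))
      fun p => .pair (x p.1.1) (e p.1.1 ((l p.1.1)[p.1.2]'(by simpa using p.2))) :=
      (PT.id.fst.pair PT.id.snd.snd.fst).congr fun p => by simp
    refine (PT.reverseAppend ?_ (hin.comp hg') PT.id.snd.snd.snd).congr fun p => ?_
    · refine (hlen'.reindex (fun p : Below (fun k => ((l k).map (e k)).length) => p.1.1)).mono
        fun p => ?_
      simp only [List.length_map, List.length_flatMap]
      exact List.single_le_sum (by simp) _ (List.mem_map.2 ⟨_, List.getElem_mem _, rfl⟩)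
    · have hp : p.1.2 < (l p.1.1).length := by simpa using p.2
      rw [List.take_succ_eq_append_getElem hp]
      simp [-List.take_append_getElem]
  exact (key.reverse (by simpa using hlen')).congr fun k => by simp

theorem PT.map {α β : κ → Type} {l : ∀ k, List (α k)} {e : ∀ k, α k → Val}
    {e' : ∀ k, β k → Val} {g : ∀ k, α k → β k} (hlen : Poly w fun k => (l k).length)
    (hl : PT w x fun k => encList ((l k).map (e k)))
    (hg : PT (fun p : Elem l => w p.1) (fun p => .pair (x p.1) (e p.1 p.2))
      fun p => e' p.1 (g p.1 p.2)) :
    PT w x fun k => encList (((l k).map (g k)).map (e' k)) := by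
  have := PT.flatMap (g := fun k a => [g k a]) (e' := e') hlen (by simpa using hlen) hl
    ((hg.cons (l := fun _ => []) PT.nil).congr fun p => by simp)
  exact this.congr fun k => by rw [List.map_eq_flatMap (f := g k)]

theorem PT.sum {α : κ → Type} {l : ∀ k, List (α k)} {e : ∀ k, α k → Val} {g : ∀ k, α k → ℝ}
    (hlen : Poly w fun k => (l k).length) (hl : PT w x fun k => encList ((l k).map (e k)))
    (hg : PT (fun p : Elem l => w p.1) (fun p => .pair (x p.1) (e p.1 p.2))
      fun p => .real (g p.1 p.2)) :
    PT w x fun k => .real ((l k).map (g k)).sum := by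
  refine (PT.fold (l := fun k => (l k).map (e k)) (st := fun k i =>
      .real (((l k).take i).map (g k)).sum) (by simpa using hlen) hl
      (PT.zero.congr fun k => by simp) ?_).congr fun k => by simp
  have hg' := hg.reindex (fun p : Below (fun k => ((l k).map (e k)).length) =>
    (⟨p.1.1, (l p.1.1)[p.1.2]'(by simpa using p.2), List.getElem_mem _⟩ : Elem l))
  have hin : PT (fun p : Below (fun k => ((l k).map (e k)).length) => w p.1.1)
    (fun p => .pair (x p.1.1) (.pair (encNat p.1.2) (.pair (((l p.1.1).map (e p.1.1))[p.1.2]'p.2)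
      (.real (((l p.1.1).take p.1.2).map (g p.1.1)).sum))))
    fun p => .pair (x p.1.1) (e p.1.1 ((l p.1.1)[p.1.2]'(by simpa using p.2))) :=
    (PT.id.fst.pair PT.id.snd.snd.fst).congr fun p => by simp
  refine (PT.add PT.id.snd.snd.snd (hin.comp hg')).congr fun p => ?_
  have hp : p.1.2 < (l p.1.1).length := by simpa using p.2
  rw [List.take_succ_eq_append_getElem hp]
  simp [-List.take_append_getElem]

/-- Access to a list at a constant position. -/
theorem PT.getElem_const {l : κ → List Val} (i : ℕ) (hi : ∀ k, i < (l k).length)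
    (hl : PT w x fun k => encList (l k)) : PT w x fun k => (l k)[i]'(hi k) := by
  have key : PT w x fun k => encList ((l k).drop i) := by
    have : ∀ j ≤ i, PT w x fun k => encList ((l k).drop j) := by
      intro j
      induction j with
      | zero => exact fun _ => by simpa using hl
      | succ j ih =>
        intro hj
        have h := (ih (by omega)).congr fun k =>
          encList_drop (lt_of_lt_of_le (by omega : j < i) (hi k).le)
        exact h.snd
    exact this i le_rfl
  exact (key.congr fun k => encList_drop (hi k)).fst

/-- The position varies with the index, so the list is scanned. Positivity is the only numerical
test of the machine, hence the counter is compared with the position through the square of their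
difference. -/
theorem PT.get {n : κ → ℕ} {f : ∀ k, Fin (n k) → Val} {q : ∀ k, Fin (n k)} (hn : Poly w n)
    (hf : PT w x fun k => encList (List.ofFn (f k))) (hq : PT w x fun k => encNat (q k)) :
    PT w x fun k => f k (q k) := by
  classical
  refine (PT.fold (l := fun k => List.ofFn (f k))
    (st := fun k i => if (q k : ℕ) < i then f k (q k) else .nil) (by simpa using hn) hf
    (PT.nil.congr fun k => by simp) ?_).congr fun k => by simp
  have hq' := hq.lift (fun p : Below (fun k => (List.ofFn (f k)).length) => p.1.1)
    (PT.id.fst (y := fun p : Below (fun k => (List.ofFn (f k)).length) => x p.1.1)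
      (z := fun p => .pair (encNat p.1.2) (.pair ((List.ofFn (f p.1.1))[p.1.2]'p.2)
        (if (q p.1.1 : ℕ) < p.1.2 then f p.1.1 (q p.1.1) else .nil))))
  have hd := hq'.sub PT.id.snd.fst
  refine (PT.ite_of_pt (fun p => (q p.1.1 : ℕ) ≠ p.1.2) (hd.mul hd) (fun p => ?_)
    PT.id.snd.snd.snd PT.id.snd.snd.fst).congr fun p => ?_
  · rw [← pow_two, sq_pos_iff, sub_ne_zero, Ne, Nat.cast_inj]
  · by_cases h : (q p.1.1 : ℕ) = p.1.2
    · simp [← h]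
    · have : (q p.1.1 : ℕ) < p.1.2 + 1 ↔ (q p.1.1 : ℕ) < p.1.2 := by omega
      simp [h, this]

theorem PT.update {n : κ → ℕ} {f : ∀ k, Fin (n k) → Val} {q : ∀ k, Fin (n k)} {v : κ → Val}
    (hn : Poly w n) (hf : PT w x fun k => encList (List.ofFn (f k)))
    (hq : PT w x fun k => encNat (q k)) (hv : PT w x v) :
    PT w x fun k => encList (List.ofFn (Function.update (f k) (q k) (v k))) := by
  classical
  have key : PT w x fun k => encList (List.ofFn (Function.update (f k) (q k) (v k))).reverse := by
    refine (PT.fold (l := fun k => List.ofFn (f k))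
      (st := fun k i => encList ((List.ofFn (Function.update (f k) (q k) (v k))).take i).reverse)
      (by simpa using hn) hf (PT.nil.congr fun k => by simp [encList]) ?_).congr fun k => by
        simp [List.take_of_length_le]
    have hc := PT.id.fst (w := fun p : Below (fun k => (List.ofFn (f k)).length) => w p.1.1)
      (y := fun p : Below (fun k => (List.ofFn (f k)).length) => x p.1.1)
      (z := fun p => .pair (encNat p.1.2) (.pair ((List.ofFn (f p.1.1))[p.1.2]'p.2) (encList
        ((List.ofFn (Function.update (f p.1.1) (q p.1.1) (v p.1.1))).take p.1.2).reverse)))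
    have hd := (hq.lift (fun p : Below (fun k => (List.ofFn (f k)).length) => p.1.1) hc).sub PT.id.snd.fst
    have hi := PT.ite_of_pt
      (fun p : Below (fun k => (List.ofFn (f k)).length) => (q p.1.1 : ℕ) ≠ p.1.2) (hd.mul hd) (fun p => by
      rw [← pow_two, sq_pos_iff, sub_ne_zero, Ne, Nat.cast_inj])
      PT.id.snd.snd.fst (hv.lift (fun p : Below (fun k => (List.ofFn (f k)).length) => p.1.1) hc)
    refine (hi.cons PT.id.snd.snd.snd).congr fun p => ?_
    have hp : p.1.2 < n p.1.1 := by simpa using p.2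
    rw [List.take_succ_eq_append_getElem (by simpa using hp)]
    by_cases h : (q p.1.1 : ℕ) = p.1.2
    · have h' : (⟨p.1.2, hp⟩ : Fin (n p.1.1)) = q p.1.1 := Fin.ext h.symm
      simp [h, h', -List.take_append_getElem]
    · have h' : (⟨p.1.2, hp⟩ : Fin (n p.1.1)) ≠ q p.1.1 := fun e => h (by rw [← e])
      simp [h, h', -List.take_append_getElem]
  exact (key.reverse (by simpa using hn)).congr fun k => by simp

end Lists

/-! ## Tensor products and the Pauli basis -/

section Tensor

variable {n : ℕ}

theorem prod_sum_pi {ι α R : Type} [Fintype ι] [DecidableEq ι] [Fintype α] [CommSemiring R]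
    (f : ι → α → R) : ∏ i, ∑ a, f i a = ∑ p : ι → α, ∏ i, f i (p i) := by
  rw [Finset.prod_univ_sum, Fintype.piFinset_univ]

theorem tensor_mul (A B : Fin n → Mat2) : tensor A * tensor B = tensor fun i => A i * B i := by
  ext x y
  simp only [tensor, Matrix.mul_apply, Matrix.of_apply, prod_sum_pi, Finset.prod_mul_distrib]

theorem trace_tensor (A : Fin n → Mat2) : (tensor A).trace = ∏ i, (A i).trace := by
  simp only [tensor, Matrix.trace, Matrix.diag, Matrix.of_apply, prod_sum_pi]

theorem conjTranspose_tensor (A : Fin n → Mat2) :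
    (tensor A).conjTranspose = tensor fun i => (A i).conjTranspose := by
  ext x y
  simp [tensor]

theorem tensor_one : tensor (fun _ : Fin n => (1 : Mat2)) = 1 := by
  ext x y
  simp only [tensor, Matrix.of_apply, Matrix.one_apply, Finset.prod_ite_zero, Finset.prod_const_one,
    Finset.mem_univ, true_imp_iff, funext_iff]

theorem conjTranspose_pauliMatrix (a : Fin 4) : (pauliMatrix a).conjTranspose = pauliMatrix a := by
  fin_cases a <;> ext i j <;> fin_cases i <;> fin_cases j <;> simp [pauliMatrix]

theorem trace_pauliMatrix_mul (a b : Fin 4) :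
    (pauliMatrix a * pauliMatrix b).trace = if a = b then 2 else 0 := by
  fin_cases a <;> fin_cases b <;>
    simp [pauliMatrix, Matrix.trace, Fin.sum_univ_two] <;>
    norm_num

/-- Completeness of the Pauli basis: `½ ∑ σₐ ⊗ σₐ` is the swap operator. Its tensor power yields the
expansion of every operator in Pauli strings. -/
theorem sum_pauliMatrix (u v x y : Fin 2) :
    ∑ a, pauliMatrix a u v * pauliMatrix a x y = if u = y ∧ v = x then 2 else 0 := by
  fin_cases u <;> fin_cases v <;> fin_cases x <;> fin_cases y <;>
    simp [pauliMatrix, Fin.sum_univ_four] <;> norm_num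

theorem pauliMatrix_zero : pauliMatrix 0 = 1 := rfl

theorem conjTranspose_pauliOp (P : PauliString n) : (pauliOp P).conjTranspose = pauliOp P := by
  simp only [pauliOp, conjTranspose_tensor, conjTranspose_pauliMatrix]

theorem pauliOp_zero : pauliOp (0 : PauliString n) = 1 := tensor_one

theorem trace_pauliOp_mul (P Q : PauliString n) :
    (pauliOp P * pauliOp Q).trace = if P = Q then 2 ^ n else 0 := by
  simp only [pauliOp, tensor_mul, trace_tensor, trace_pauliMatrix_mul, Finset.prod_ite_zero,
    Finset.mem_univ, true_imp_iff, funext_iff, Finset.prod_const, Finset.card_univ,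
    Fintype.card_fin]

theorem sum_pauliOp (u v x y : Bits n) :
    ∑ P, pauliOp P u v * pauliOp P x y = if u = y ∧ v = x then 2 ^ n else 0 := by
  simp only [pauliOp, tensor, Matrix.of_apply, ← Finset.prod_mul_distrib]
  rw [← prod_sum_pi fun i a => pauliMatrix a (u i) (v i) * pauliMatrix a (x i) (y i)]
  simp only [sum_pauliMatrix, Finset.prod_ite_zero, Finset.mem_univ, true_imp_iff, funext_iff,
    Finset.prod_const, Finset.card_univ, Fintype.card_fin, forall_and]

theorem pauli_decomposition (X : Op n) :
    X = ∑ P, ((X * pauliOp P).trace / 2 ^ n) • pauliOp P := by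
  ext x y
  have h : ∀ P : PauliString n, ((X * pauliOp P).trace / 2 ^ n) * pauliOp P x y
      = ∑ u, ∑ v, (X u v / 2 ^ n) * (pauliOp P v u * pauliOp P x y) := by
    intro P
    simp only [Matrix.trace, Matrix.diag, Matrix.mul_apply, Finset.sum_div, Finset.sum_mul]
    exact Finset.sum_congr rfl fun u _ => Finset.sum_congr rfl fun v _ => by ring
  simp only [Matrix.sum_apply, Matrix.smul_apply, smul_eq_mul, h]
  rw [Finset.sum_comm]
  simp_rw [Finset.sum_comm (s := (Finset.univ : Finset (PauliString n)))]
  simp_rw [← Finset.mul_sum, sum_pauliOp, ite_and, mul_ite, mul_zero]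
  simp

/-- Pauli strings are product operators and span, so a linear identity needs to be checked on
product operators only. -/
theorem op_induction {p : Op n → Prop} (htensor : ∀ A, p (tensor A))
    (hadd : ∀ X Y, p X → p Y → p (X + Y)) (hsmul : ∀ (c : ℂ) X, p X → p (c • X)) (X : Op n) :
    p X := by
  rw [pauli_decomposition X]
  refine Finset.sum_induction _ p hadd ?_ fun P _ => hsmul _ _ (htensor _)
  have := hsmul 0 _ (htensor fun _ => 0)
  rwa [zero_smul] at this

end Tensor

/-! ### Real Pauli coefficients of Hermitian operators and Hermiticity-preserving maps. -/

section Coefficients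

variable {n : ℕ}

theorem star_trace_mul {ι : Type} [Fintype ι] {A B : Matrix ι ι ℂ} (hA : A.conjTranspose = A)
    (hB : B.conjTranspose = B) : star (A * B).trace = (A * B).trace := by
  rw [← Matrix.trace_conjTranspose, Matrix.conjTranspose_mul, hA, hB, Matrix.trace_mul_comm]

theorem ofReal_re_of_star {z : ℂ} (h : star z = z) : (z.re : ℂ) = z :=
  Complex.conj_eq_iff_re.1 h

theorem re_div_two_pow (z : ℂ) (n : ℕ) : (z / 2 ^ n).re = z.re / 2 ^ n := by
  have : (2 : ℂ) ^ n = ((2 ^ n : ℝ) : ℂ) := by push_cast; rfl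
  rw [this, Complex.div_ofReal_re]

theorem ofReal_pauliCoeff {X : Op n} (hX : X.IsHermitian) (P : PauliString n) :
    (pauliCoeff X P : ℂ) = (X * pauliOp P).trace / 2 ^ n := by
  rw [pauliCoeff]
  push_cast
  rw [ofReal_re_of_star (star_trace_mul hX (conjTranspose_pauliOp P))]

/-- The operator with given real Pauli coefficients. -/
def ofCoeff (x : PauliString n → ℝ) : Op n := ∑ P, (x P : ℂ) • pauliOp P

theorem ofCoeff_pauliCoeff {X : Op n} (hX : X.IsHermitian) : ofCoeff (pauliCoeff X) = X := by
  conv_rhs => rw [pauli_decomposition X]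
  simp only [ofCoeff, ofReal_pauliCoeff hX]

theorem isHermitian_ofCoeff (x : PauliString n → ℝ) : (ofCoeff x).IsHermitian := by
  simp [Matrix.IsHermitian, ofCoeff, Matrix.conjTranspose_sum, conjTranspose_pauliOp]

theorem trace_ofCoeff_mul (x : PauliString n → ℝ) (Y : Op n) :
    (ofCoeff x * Y).trace = ∑ P, (x P : ℂ) * (pauliOp P * Y).trace := by
  simp [ofCoeff, Finset.sum_mul, Matrix.trace_sum]

theorem pauliCoeff_ofCoeff (x : PauliString n → ℝ) (P : PauliString n) :
    pauliCoeff (ofCoeff x) P = x P := by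
  rw [pauliCoeff, trace_ofCoeff_mul]
  simp only [trace_pauliOp_mul, mul_ite, mul_zero, Finset.sum_ite_eq', Finset.mem_univ, if_true]
  have : (2 : ℂ) ^ n = ((2 ^ n : ℝ) : ℂ) := by push_cast; rfl
  rw [this, ← Complex.ofReal_mul, Complex.ofReal_re]
  field_simp

theorem expval_eq_sum {O : Op n} (hO : O.IsHermitian) (σ : Op n) :
    expval O σ = ∑ P, pauliCoeff O P * expval (pauliOp P) σ := by
  conv_lhs => rw [← ofCoeff_pauliCoeff hO]
  simp only [expval, trace_ofCoeff_mul, Complex.re_sum, Complex.re_ofReal_mul]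

theorem frobSq_eq_sum {X : Op n} (hX : X.IsHermitian) : frobSq X = ∑ P, pauliCoeff X P ^ 2 := by
  rw [frobSq, hX]
  conv_lhs => rw [← ofCoeff_pauliCoeff hX]
  rw [trace_ofCoeff_mul, Complex.re_sum, Finset.sum_div]
  refine Finset.sum_congr rfl fun P _ => ?_
  rw [Complex.re_ofReal_mul, ofCoeff_pauliCoeff hX, Matrix.trace_mul_comm, mul_div_assoc, sq]
  rfl

/-- Complex linear maps that preserve adjoints. -/
structure IsHermMap (Φ : Op n → Op n) : Prop where
  add : ∀ X Y, Φ (X + Y) = Φ X + Φ Y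
  smul : ∀ (c : ℂ) X, Φ (c • X) = c • Φ X
  conjTranspose : ∀ X, Φ X.conjTranspose = (Φ X).conjTranspose

namespace IsHermMap

variable {Φ Ψ : Op n → Op n}

theorem isHermitian (h : IsHermMap Φ) {X : Op n} (hX : X.IsHermitian) : (Φ X).IsHermitian := by
  rw [Matrix.IsHermitian, ← h.conjTranspose, hX]

theorem map_zero (h : IsHermMap Φ) : Φ 0 = 0 := by simpa using h.smul 0 0

theorem map_sum (h : IsHermMap Φ) {ι : Type} (s : Finset ι) (f : ι → Op n) :
    Φ (∑ i ∈ s, f i) = ∑ i ∈ s, Φ (f i) := by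
  classical
  induction s using Finset.induction_on with
  | empty => simpa using h.map_zero
  | insert a s ha ih => rw [Finset.sum_insert ha, Finset.sum_insert ha, h.add, ih]

theorem comp (h : IsHermMap Φ) (h' : IsHermMap Ψ) : IsHermMap fun X => Φ (Ψ X) :=
  ⟨fun X Y => by rw [h'.add, h.add], fun c X => by rw [h'.smul, h.smul],
    fun X => by rw [h'.conjTranspose, h.conjTranspose]⟩

theorem pauliCoeff_map (h : IsHermMap Φ) {X : Op n} (hX : X.IsHermitian) (P : PauliString n) :
    pauliCoeff (Φ X) P = ∑ Q, amplitude Φ P Q * pauliCoeff X Q := by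
  conv_lhs => rw [← ofCoeff_pauliCoeff hX]
  simp only [pauliCoeff, ofCoeff, h.map_sum, h.smul, Finset.sum_mul, Matrix.trace_sum,
    Matrix.smul_mul, Matrix.trace_smul, smul_eq_mul, Complex.re_sum, Complex.re_ofReal_mul,
    Finset.sum_div, amplitude]
  refine Finset.sum_congr rfl fun Q _ => ?_
  rw [Matrix.trace_mul_comm (pauliOp P)]
  ring

theorem expval_map (h : IsHermMap Φ) {X : Op n} (hX : X.IsHermitian) (P : PauliString n) :
    expval (pauliOp P) (Φ X) = ∑ Q, amplitude Φ P Q * expval (pauliOp Q) X := by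
  have key : ∀ (Y : Op n) (Q : PauliString n), expval (pauliOp Q) Y = 2 ^ n * pauliCoeff Y Q := by
    intro Y Q
    rw [expval, pauliCoeff, Matrix.trace_mul_comm]
    field_simp
  simp only [key, h.pauliCoeff_map hX, Finset.mul_sum]
  exact Finset.sum_congr rfl fun Q _ => by ring

theorem amplitude_comp (h : IsHermMap Φ) (h' : IsHermMap Ψ) (P Q : PauliString n) :
    amplitude (fun X => Φ (Ψ X)) P Q = ∑ R, amplitude Φ P R * amplitude Ψ R Q := by
  have key : ∀ (Y : Op n) (Q : PauliString n),
      (pauliOp Q * Y).trace.re / 2 ^ n = pauliCoeff Y Q := by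
    intro Y Q
    rw [pauliCoeff, Matrix.trace_mul_comm]
  have := h.pauliCoeff_map (h'.isHermitian (conjTranspose_pauliOp Q)) P
  simp only [amplitude, key] at this ⊢
  exact this

end IsHermMap

/-- `X ↦ G X G†` for an arbitrary operator `G`. -/
def sandwich (G : Op n) (X : Op n) : Op n := G * X * G.conjTranspose

theorem isHermMap_sandwich (G : Op n) : IsHermMap (sandwich G) :=
  ⟨fun X Y => by simp [sandwich, mul_add, add_mul], fun c X => by simp [sandwich],
    fun X => by simp [sandwich, mul_assoc]⟩

theorem conj_eq_sandwich (U : UMat (Bits n)) : conj U = sandwich (U : Op n) := rfl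

theorem sandwich_mul (G H : Op n) : sandwich (G * H) = fun X => sandwich G (sandwich H X) := by
  funext X
  simp [sandwich, mul_assoc]

theorem sandwich_one : sandwich (1 : Op n) = id := by
  funext X
  simp [sandwich]

theorem amplitude_id (P Q : PauliString n) : amplitude id P Q = if P = Q then 1 else 0 := by
  rw [amplitude, id, trace_pauliOp_mul]
  have : (2 : ℂ) ^ n = ((2 ^ n : ℝ) : ℂ) := by push_cast; rfl
  split_ifs
  · rw [this, Complex.ofReal_re, div_self (by positivity)]
  · simp

/-- Cyclicity of the trace: in the Heisenberg picture the coefficients form a row vector multiplied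
from the right by the matrix of amplitudes. -/
theorem pauliCoeff_heisenberg {X : Op n} (hX : X.IsHermitian) (U : Op n) (Q : PauliString n) :
    pauliCoeff (U.conjTranspose * X * U) Q = ∑ P, pauliCoeff X P * amplitude (sandwich U) P Q := by
  conv_lhs => rw [← ofCoeff_pauliCoeff hX]
  rw [pauliCoeff, mul_assoc, mul_assoc, Matrix.trace_mul_comm, mul_assoc, trace_ofCoeff_mul,
    Complex.re_sum, Finset.sum_div]
  refine Finset.sum_congr rfl fun P _ => ?_
  rw [Complex.re_ofReal_mul, amplitude, sandwich, mul_div_assoc]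

theorem isHermitian_heisenberg {X : Op n} (hX : X.IsHermitian) (U : Op n) :
    (U.conjTranspose * X * U).IsHermitian := by
  simp [Matrix.IsHermitian, hX.eq, mul_assoc]

/-- Unitary conjugation preserves the norm of coefficient vectors. -/
theorem sum_sq_mul_amplitude (U : UMat (Bits n)) (x : PauliString n → ℝ) :
    ∑ Q, (∑ P, x P * amplitude (conj U) P Q) ^ 2 = ∑ P, x P ^ 2 := by
  have hX := isHermitian_ofCoeff x
  have hY := isHermitian_heisenberg hX (U : Op n)
  have h1 : ∀ Q, ∑ P, x P * amplitude (conj U) P Q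
      = pauliCoeff ((U : Op n).conjTranspose * ofCoeff x * (U : Op n)) Q := by
    intro Q
    rw [pauliCoeff_heisenberg hX]
    simp only [pauliCoeff_ofCoeff]
    rfl
  have h2 : ∑ P, x P ^ 2 = ∑ P, pauliCoeff (ofCoeff x) P ^ 2 := by simp only [pauliCoeff_ofCoeff]
  rw [h2, ← frobSq_eq_sum hX]
  simp only [h1]
  rw [← frobSq_eq_sum hY, frobSq, frobSq, hX, hY]
  congr 2
  have hU : (U : Op n) * (U : Op n).conjTranspose = 1 := Unitary.coe_mul_star_self U
  generalize (U : Op n) = V at hU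
  calc (V.conjTranspose * ofCoeff x * V * (V.conjTranspose * ofCoeff x * V)).trace
      = (V.conjTranspose * (ofCoeff x * (V * V.conjTranspose) * ofCoeff x * V)).trace := by
        simp only [mul_assoc]
    _ = _ := by rw [hU, Matrix.trace_mul_comm, mul_one, mul_assoc, hU, mul_one]

end Coefficients

/-! ## Transition amplitudes of product maps -/

section Product

variable {n : ℕ}

/-- The transition amplitude of a single-qubit map. -/
def amp1 (φ : Mat2 → Mat2) (a b : Fin 4) : ℝ := (pauliMatrix a * φ (pauliMatrix b)).trace.re / 2

/-- Maps between one-qubit operators that preserve Hermiticity. -/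
def PreservesHerm (φ : Mat2 → Mat2) : Prop := ∀ X, φ X.conjTranspose = (φ X).conjTranspose

theorem PreservesHerm.ofReal_amp1 {φ : Mat2 → Mat2} (h : PreservesHerm φ) (a b : Fin 4) :
    (amp1 φ a b : ℂ) = (pauliMatrix a * φ (pauliMatrix b)).trace / 2 := by
  have hb : (φ (pauliMatrix b)).conjTranspose = φ (pauliMatrix b) := by
    rw [← h, conjTranspose_pauliMatrix]
  rw [amp1]
  push_cast
  rw [ofReal_re_of_star (star_trace_mul (conjTranspose_pauliMatrix a) hb)]

/-- The trace of a tensor product factorizes. Preservation of Hermiticity makes every factor real,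
so taking real parts commutes with the product. -/
theorem amplitude_eq_prod {Φ : Op n → Op n} {φ : Fin n → Mat2 → Mat2}
    (hφ : ∀ i, PreservesHerm (φ i))
    (hΦ : ∀ Q : PauliString n, Φ (pauliOp Q) = tensor fun i => φ i (pauliMatrix (Q i)))
    (P Q : PauliString n) : amplitude Φ P Q = ∏ i, amp1 (φ i) (P i) (Q i) := by
  have h : ((∏ i, amp1 (φ i) (P i) (Q i) : ℝ) : ℂ) = (pauliOp P * Φ (pauliOp Q)).trace / 2 ^ n := by
    push_cast
    simp only [(hφ _).ofReal_amp1]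
    rw [Finset.prod_div_distrib, hΦ, pauliOp, tensor_mul, trace_tensor]
    simp
  rw [amplitude, ← re_div_two_pow, ← h, Complex.ofReal_re]

theorem tensorPow_tensor (N : Mat2 →ₗ[ℂ] Mat2) (A : Fin n → Mat2) :
    tensorPow N n (tensor A) = tensor fun i => N (A i) := by
  ext a b
  have hN : ∀ (B : Mat2) (s t : Fin 2), N B s t
      = ∑ p : Fin 2 × Fin 2, B p.1 p.2 * N (Matrix.single p.1 p.2 1) s t := by
    intro B s t
    conv_lhs => rw [Matrix.matrix_eq_sum_single B]
    rw [Fintype.sum_prod_type]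
    simp only [map_sum, Matrix.sum_apply]
    refine Finset.sum_congr rfl fun i _ => Finset.sum_congr rfl fun j _ => ?_
    have : Matrix.single i j (B i j) = B i j • Matrix.single i j (1 : ℂ) := by simp
    rw [this, map_smul, Matrix.smul_apply, smul_eq_mul]
  simp only [tensorPow, tensor, Matrix.of_apply, ← Finset.prod_mul_distrib]
  rw [Finset.prod_congr rfl fun i _ => hN (A i) (a i) (b i), prod_sum_pi]
  rw [← Fintype.sum_prod_type']
  exact (Fintype.sum_equiv (Equiv.arrowProdEquivProdArrow _ _ _) _ _ fun p => rfl).symm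

theorem tensorPow_add (N : Mat2 →ₗ[ℂ] Mat2) (X Y : Op n) :
    tensorPow N n (X + Y) = tensorPow N n X + tensorPow N n Y := by
  ext a b
  simp [tensorPow, add_mul, Finset.sum_add_distrib]

theorem tensorPow_smul (N : Mat2 →ₗ[ℂ] Mat2) (c : ℂ) (X : Op n) :
    tensorPow N n (c • X) = c • tensorPow N n X := by
  ext a b
  simp [tensorPow, mul_assoc, Finset.mul_sum]

theorem IsChannel.preservesHerm {N : Mat2 →ₗ[ℂ] Mat2} (h : IsChannel N) : PreservesHerm N := by
  obtain ⟨r, K, -, hN⟩ := h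
  intro X
  simp [hN, Matrix.conjTranspose_sum, mul_assoc]

theorem IsChannel.trace_apply {N : Mat2 →ₗ[ℂ] Mat2} (h : IsChannel N) (X : Mat2) :
    (N X).trace = X.trace := by
  obtain ⟨r, K, hK, hN⟩ := h
  rw [hN, Matrix.trace_sum]
  simp only [fun k => Matrix.trace_mul_comm (K k * X) (K k).conjTranspose, ← mul_assoc]
  rw [← Matrix.trace_sum, ← Finset.sum_mul, hK, one_mul]

theorem isHermMap_tensorPow {N : Mat2 →ₗ[ℂ] Mat2} (h : IsChannel N) : IsHermMap (tensorPow N n) := by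
  refine ⟨tensorPow_add N, tensorPow_smul N, fun X => ?_⟩
  refine op_induction (p := fun X => tensorPow N n X.conjTranspose
    = (tensorPow N n X).conjTranspose) (fun A => ?_) (fun X Y hX hY => ?_) (fun c X hX => ?_) X
  · simp only [conjTranspose_tensor, tensorPow_tensor, h.preservesHerm _]
  · simp only [Matrix.conjTranspose_add, tensorPow_add, hX, hY]
  · simp only [Matrix.conjTranspose_smul, tensorPow_smul, hX]

theorem amplitude_tensorPow {N : Mat2 →ₗ[ℂ] Mat2} (h : IsChannel N) (P Q : PauliString n) :
    amplitude (tensorPow N n) P Q = ∏ i, amp1 N (P i) (Q i) :=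
  amplitude_eq_prod (φ := fun _ => N) (fun _ => h.preservesHerm)
    (fun Q => by rw [pauliOp, tensorPow_tensor]) P Q

theorem trace_pauliMatrix (a : Fin 4) : (pauliMatrix a).trace = if a = 0 then 2 else 0 := by
  simpa [pauliMatrix_zero, eq_comm] using trace_pauliMatrix_mul 0 a

/-- Trace preservation says that the adjoint map fixes the identity. In the Heisenberg direction
identity factors therefore do not branch, which underlies both the counting of terms and the cut
after `k` layers. -/
theorem amp1_zero_left {φ : Mat2 → Mat2} (h : ∀ X, (φ X).trace = X.trace) (b : Fin 4) :
    amp1 φ 0 b = if b = 0 then 1 else 0 := by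
  rw [amp1, pauliMatrix_zero, one_mul, h, trace_pauliMatrix]
  split_ifs <;> simp

theorem amp1_zero_right {φ : Mat2 → Mat2} (h : φ 1 = 1) (a : Fin 4) :
    amp1 φ a 0 = if a = 0 then 1 else 0 := by
  rw [amp1, pauliMatrix_zero, h, mul_one, trace_pauliMatrix]
  split_ifs <;> simp

/-- `X ↦ W X W†` for a single-qubit gate `W`. -/
def conj1 (W : UMat (Fin 2)) (X : Mat2) : Mat2 := (W : Mat2) * X * (W : Mat2).conjTranspose

theorem conj1_preservesHerm (W : UMat (Fin 2)) : PreservesHerm (conj1 W) :=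
  fun X => by simp [conj1, mul_assoc]

theorem trace_conj1 (W : UMat (Fin 2)) (X : Mat2) : (conj1 W X).trace = X.trace := by
  have hW : (W : Mat2).conjTranspose * W = 1 := Unitary.coe_star_mul_self W
  rw [conj1, Matrix.trace_mul_comm, ← mul_assoc, hW, one_mul]

theorem conj1_one (W : UMat (Fin 2)) : conj1 W 1 = 1 := by
  rw [conj1, mul_one]
  exact Unitary.coe_mul_star_self W

theorem amplitude_tensorU (W : Fin n → UMat (Fin 2)) (P Q : PauliString n) :
    amplitude (sandwich (tensorU W)) P Q = ∏ i, amp1 (conj1 (W i)) (P i) (Q i) :=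
  amplitude_eq_prod (φ := fun i => conj1 (W i)) (fun i => conj1_preservesHerm (W i))
    (fun Q => by
      rw [sandwich, tensorU, pauliOp, conjTranspose_tensor, tensor_mul, tensor_mul]; rfl) P Q

/-- Single-qubit gates preserve supports. -/
theorem amplitude_tensorU_eq_zero (W : Fin n → UMat (Fin 2)) {P Q : PauliString n}
    (h : supp P ≠ supp Q) : amplitude (sandwich (tensorU W)) P Q = 0 := by
  rw [amplitude_tensorU]
  have : ∃ i, ¬ (P i = 0 ↔ Q i = 0) := by
    by_contra! hc
    exact h (by ext i; simp [supp, hc i])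
  obtain ⟨i, hi⟩ := this
  refine Finset.prod_eq_zero (Finset.mem_univ i) ?_
  by_cases hP : P i = 0
  · rw [hP, amp1_zero_left (trace_conj1 _), if_neg (by tauto)]
  · have hQ : Q i = 0 := by tauto
    rw [hQ, amp1_zero_right (conj1_one _), if_neg hP]

end Product

/-! ## Gates -/

section Gates

variable {n m : ℕ}

theorem prod_split {R : Type} [CommMonoid R] (q : Fin m ↪ Fin n) (f : Fin n → R) :
    ∏ i, f i = (∏ a, f (q a)) * ∏ i ∈ (Finset.univ.map q)ᶜ, f i := by
  rw [← Finset.prod_mul_prod_compl (Finset.univ.map q), Finset.prod_map]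

theorem forall_notMem_range_iff (q : Fin m ↪ Fin n) (p : Fin n → Prop) :
    (∀ i, i ∉ Set.range q → p i) ↔ ∀ i ∈ (Finset.univ.map q)ᶜ, p i := by
  simp

/-- The operator `G` on the qubits `q` and the identity elsewhere. -/
def embed (q : Fin m ↪ Fin n) (G : Op m) : Op n :=
  open Classical in
  Matrix.of fun x y =>
    if ∀ i, i ∉ Set.range q → x i = y i then G (fun a => x (q a)) (fun a => y (q a)) else 0

theorem Gate.op_eq_embed {c : ℕ} (g : Gate n c) : g.op = embed g.qubit (g.mat : Op g.arity) := rfl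

theorem embed_tensor (q : Fin m ↪ Fin n) (A : Fin m → Mat2) :
    embed q (tensor A) = tensor (Function.extend q A fun _ => 1) := by
  classical
  ext x y
  simp only [embed, tensor, Matrix.of_apply]
  rw [prod_split q]
  simp only [q.injective.extend_apply]
  have h : ∏ i ∈ (Finset.univ.map q)ᶜ, Function.extend q A (fun _ => 1) i (x i) (y i)
      = if ∀ i, i ∉ Set.range q → x i = y i then 1 else 0 := by
    rw [Finset.prod_congr rfl (g := fun i => if x i = y i then (1 : ℂ) else 0), Finset.prod_ite_zero,
      Finset.prod_const_one]
    · simp only [forall_notMem_range_iff q fun i => x i = y i]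
      congr
    · intro i hi
      rw [Function.extend_apply' _ _ _ (by simpa using hi), Matrix.one_apply]
  rw [h]
  split_ifs <;> simp

theorem embed_add (q : Fin m ↪ Fin n) (G H : Op m) : embed q (G + H) = embed q G + embed q H := by
  ext x y
  simp only [embed, Matrix.of_apply, Matrix.add_apply]
  split_ifs <;> simp

theorem embed_smul (q : Fin m ↪ Fin n) (c : ℂ) (G : Op m) : embed q (c • G) = c • embed q G := by
  ext x y
  simp only [embed, Matrix.of_apply, Matrix.smul_apply]
  split_ifs <;> simp

theorem conjTranspose_embed (q : Fin m ↪ Fin n) (G : Op m) :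
    (embed q G).conjTranspose = embed q G.conjTranspose := by
  ext x y
  simp only [embed, Matrix.of_apply, Matrix.conjTranspose_apply, eq_comm]
  split_ifs <;> simp

/-- Both sides are bilinear in `G` and `H`, so product operators suffice, and for these the trace
factorizes over qubits. Outside the range of `q` only the overlap of two Pauli matrices is left. -/
theorem trace_embed (q : Fin m ↪ Fin n) (P Q : PauliString n) (G H : Op m) :
    (pauliOp P * embed q G * pauliOp Q * embed q H).trace
      = (∏ i ∈ (Finset.univ.map q)ᶜ, if P i = Q i then 2 else 0) *
        (pauliOp (fun a => P (q a)) * G * pauliOp (fun a => Q (q a)) * H).trace := by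
  revert H
  refine op_induction (p := fun G => ∀ H : Op m,
    (pauliOp P * embed q G * pauliOp Q * embed q H).trace
      = (∏ i ∈ (Finset.univ.map q)ᶜ, if P i = Q i then 2 else 0) *
        (pauliOp (fun a => P (q a)) * G * pauliOp (fun a => Q (q a)) * H).trace) (fun A H => ?_) (fun X Y hX hY H => ?_) (fun c X hX H => ?_) G
  · refine op_induction (p := fun H => (pauliOp P * embed q (tensor A) * pauliOp Q * embed q H).trace
      = (∏ i ∈ (Finset.univ.map q)ᶜ, if P i = Q i then 2 else 0) *
        (pauliOp (fun a => P (q a)) * tensor A * pauliOp (fun a => Q (q a)) * H).trace)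
      (fun B => ?_) (fun X Y hX hY => ?_) (fun c X hX => ?_) H
    · simp only [embed_tensor, pauliOp, tensor_mul, trace_tensor]
      rw [prod_split q, mul_comm]
      simp only [q.injective.extend_apply]
      congr 1
      refine Finset.prod_congr rfl fun i hi => ?_
      have hi : ¬ ∃ a, q a = i := by simpa using hi
      rw [Function.extend_apply' _ _ _ hi, Function.extend_apply' _ _ _ hi, mul_one, mul_one,
        trace_pauliMatrix_mul]
    · simp only [embed_add, mul_add, Matrix.trace_add, hX, hY]
    · simp only [embed_smul, Matrix.mul_smul, Matrix.trace_smul, hX, smul_eq_mul]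
      ring
  · simp only [embed_add, mul_add, add_mul, Matrix.trace_add, hX, hY]
  · simp only [embed_smul, Matrix.mul_smul, Matrix.smul_mul, Matrix.trace_smul, hX, smul_eq_mul]
    ring

theorem amplitude_embed (q : Fin m ↪ Fin n) (G : Op m) (P Q : PauliString n) :
    amplitude (sandwich (embed q G)) P Q
      = open Classical in if ∀ i, i ∉ Set.range q → P i = Q i then
          amplitude (sandwich G) (fun a => P (q a)) (fun a => Q (q a)) else 0 := by
  classical
  have h2 : (2 : ℝ) ^ n = 2 ^ m * ∏ _i ∈ (Finset.univ.map q)ᶜ, 2 := by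
    have := prod_split q fun _ => (2 : ℝ)
    simpa only [Finset.prod_const, Finset.card_univ, Fintype.card_fin] using this
  rw [amplitude, sandwich, conjTranspose_embed, ← mul_assoc, ← mul_assoc, trace_embed,
    Finset.prod_ite_zero]
  simp only [forall_notMem_range_iff q fun i => P i = Q i]
  split_ifs with h
  · have : (∏ _i ∈ (Finset.univ.map q)ᶜ, (2 : ℂ)) = ((∏ _i ∈ (Finset.univ.map q)ᶜ, 2 : ℝ) : ℂ) := by
      push_cast; rfl
    rw [this, Complex.re_ofReal_mul, h2, amplitude, sandwich, mul_comm,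
      mul_div_mul_right _ _ (by positivity)]
    simp only [mul_assoc]
  · simp

/-- Sums over the Pauli strings that agree with `P` outside the qubits `q`. -/
theorem sum_ite_agree (q : Fin m ↪ Fin n) (P : PauliString n) (f : PauliString n → ℝ) :
    (∑ Q, open Classical in if ∀ i, i ∉ Set.range q → P i = Q i then f Q else 0)
      = ∑ v : PauliString m, f (Function.extend q v P) := by
  classical
  rw [← Finset.sum_filter]
  refine Finset.sum_bij' (fun Q _ => fun a => Q (q a)) (fun v _ => Function.extend q v P)
    (by simp) (fun v _ => ?_) (fun Q hQ => ?_) (fun v _ => ?_) (fun Q hQ => ?_)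
  · simp only [Finset.mem_filter, Finset.mem_univ, true_and]
    intro i hi
    rw [Function.extend_apply' _ _ _ hi]
  · simp only [Finset.mem_filter, Finset.mem_univ, true_and] at hQ
    funext i
    by_cases hi : i ∈ Set.range q
    · obtain ⟨a, rfl⟩ := hi
      rw [q.injective.extend_apply]
    · rw [Function.extend_apply' _ _ _ hi, hQ i hi]
  · funext a
    rw [q.injective.extend_apply]
  · simp only [Finset.mem_filter, Finset.mem_univ, true_and] at hQ
    congr 1
    funext i
    by_cases hi : i ∈ Set.range q
    · obtain ⟨a, rfl⟩ := hi
      rw [q.injective.extend_apply]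
    · rw [Function.extend_apply' _ _ _ hi, hQ i hi]

end Gates

/-! ## Sums over Pauli paths -/

section Paths

variable {n : ℕ}

/-- Kernels on Pauli strings, such as the transition amplitudes of a layer. -/
abbrev Kernel (n : ℕ) := PauliString n → PauliString n → ℝ

/-- The sum over the paths that start at `P` and whose weight is below the budget. -/
def back (r : PauliString n → ℝ) : List (Kernel n) → ℕ → PauliString n → ℝ
  | [], b, P => if b = 0 then 0 else r P
  | A :: As, b, P => ∑ Q, A P Q * back r As (b - weight P) Q

/-- The sum over the paths that start at `P` and whose weight is at least the budget. -/
def tail (r : PauliString n → ℝ) : List (Kernel n) → ℕ → PauliString n → ℝ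
  | [], b, P => if b = 0 then r P else 0
  | A :: As, b, P => ∑ Q, A P Q * tail r As (b - weight P) Q

/-- The sum over all paths that start at `P`. -/
def full (r : PauliString n → ℝ) : List (Kernel n) → PauliString n → ℝ
  | [], P => r P
  | A :: As, P => ∑ Q, A P Q * full r As Q

variable {r : PauliString n → ℝ}

/-- With truncated subtraction the budget left at the end is zero exactly when the path weight is at
least the initial budget, so the two sums divide the paths between them. -/
theorem back_add_tail (As : List (Kernel n)) (b : ℕ) (P : PauliString n) :
    back r As b P + tail r As b P = full r As P := by
  induction As generalizing b P with
  | nil => simp only [back, tail, full]; split_ifs <;> simp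
  | cons A As ih => simp only [back, tail, full, ← Finset.sum_add_distrib, ← mul_add, ih]

theorem back_zero (As : List (Kernel n)) (P : PauliString n) : back r As 0 P = 0 := by
  induction As generalizing P with
  | nil => simp [back]
  | cons A As ih => simp [back, ih]

theorem weight_eq_zero {P : PauliString n} : weight P = 0 ↔ P = 0 := by
  simp [weight, supp, Finset.filter_eq_empty_iff, funext_iff]

/-- The identity string costs nothing and leads only to itself, so its path survives whenever the
budget is positive and ends at the value `r 0`, which is `Tr ρ` in the application. -/
theorem back_identity {As : List (Kernel n)} (hA : ∀ A ∈ As, ∀ Q, A 0 Q = if Q = 0 then 1 else 0)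
    (hr : r 0 = 1) {b : ℕ} (hb : b ≠ 0) : back r As b 0 = 1 := by
  have h0 : weight (0 : PauliString n) = 0 := weight_eq_zero.2 rfl
  induction As with
  | nil => simp [back, hb, hr]
  | cons A As ih =>
    simp only [back, hA A (by simp), h0, Nat.sub_zero, ite_mul, one_mul, zero_mul,
      Finset.sum_ite_eq', Finset.mem_univ, if_true]
    exact ih fun A hA' => hA A (by simp [hA'])

/-- Only as many layers as the cutoff matter. -/
theorem back_take {As : List (Kernel n)} (hA : ∀ A ∈ As, ∀ Q, A 0 Q = if Q = 0 then 1 else 0)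
    (hr : r 0 = 1) {b m : ℕ} (hb : b ≤ m) (P : PauliString n) :
    back r (As.take m) b P = back r As b P := by
  induction As generalizing b m P with
  | nil => simp
  | cons A As ih =>
    have hA' : ∀ A ∈ As, ∀ Q, A 0 Q = if Q = 0 then 1 else 0 := fun A h => hA A (by simp [h])
    rcases Nat.eq_zero_or_pos b with rfl | hb0
    · simp only [back_zero]
    by_cases hP : P = 0
    · subst hP
      rw [back_identity hA hr hb0.ne', back_identity (fun A h => hA A (List.mem_of_mem_take h)) hr
        hb0.ne']
    -- A non-identity string pays at least one unit, so after one layer the budget is again at most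
    -- the number of layers that are kept.
    · obtain ⟨m, rfl⟩ : ∃ m', m = m' + 1 := ⟨m - 1, by omega⟩
      have hw : weight P ≠ 0 := fun h => hP (weight_eq_zero.1 h)
      simp only [List.take_succ_cons, back]
      exact Finset.sum_congr rfl fun Q _ => by rw [ih hA' (by omega)]

theorem layers_succ {L : ℕ} {α : Type} (A : Fin (L + 1) → α) :
    (List.ofFn A).reverse
      = A (Fin.last L) :: (List.ofFn fun j : Fin L => A j.castSucc).reverse := by
  rw [List.ofFn_succ']
  simp

/-- The string next to the observable is split off: for a fixed value `P` the amplitudes out of `P`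
take over the role of the coefficient vector `o`, and the cutoff drops by the weight of `P`. -/
theorem sum_paths {L : ℕ} (A : Fin L → Kernel n) (o r : PauliString n → ℝ) (k : ℕ) :
    ∑ γ ∈ Finset.univ.filter (fun γ : PauliPath n L => pathWeight γ < k),
        o (γ (Fin.last L)) * (∏ j : Fin L, A j (γ j.succ) (γ j.castSucc)) * r (γ 0)
      = ∑ P, o P * back r (List.ofFn A).reverse k P := by
  rw [Finset.sum_filter]
  induction L generalizing k o with
  | zero =>
    rw [← (Equiv.funUnique (Fin 1) (PauliString n)).symm.sum_comp]
    refine Finset.sum_congr rfl fun P _ => ?_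
    simp [pathWeight, back, Nat.pos_iff_ne_zero]
  | succ L ih =>
    rw [← (Fin.snocEquiv fun _ => PauliString n).sum_comp, Fintype.sum_prod_type, layers_succ]
    refine Finset.sum_congr rfl fun P _ => ?_
    have := ih (fun j => A j.castSucc) (fun Q => A (Fin.last L) P Q) (k - weight P)
    rw [back, ← this, Finset.mul_sum]
    refine Finset.sum_congr rfl fun γ _ => ?_
    have hw : pathWeight (L := L + 1) (Fin.snoc (α := fun _ => PauliString n) γ P)
        = pathWeight γ + weight P := by
      simp only [pathWeight, Fin.sum_univ_castSucc, Fin.succ_castSucc, Fin.snoc_castSucc,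
        Fin.succ_last, Fin.snoc_last]
    have hp : ∏ j : Fin (L + 1), A j (Fin.snoc (α := fun _ => PauliString n) γ P j.succ)
          (Fin.snoc (α := fun _ => PauliString n) γ P j.castSucc)
        = (∏ j : Fin L, A j.castSucc (γ j.succ) (γ j.castSucc))
          * A (Fin.last L) P (γ (Fin.last L)) := by
      simp only [Fin.prod_univ_castSucc, Fin.succ_castSucc, Fin.snoc_castSucc,
        Fin.succ_last, Fin.snoc_last]
    have h0 : (Fin.snoc (α := fun _ => PauliString n) γ P : PauliPath n (L + 1)) 0 = γ 0 := by
      rw [← Fin.castSucc_zero, Fin.snoc_castSucc]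
    have hs : (Fin.snocEquiv fun _ : Fin (L + 2) => PauliString n) (P, γ)
        = Fin.snoc (α := fun _ => PauliString n) γ P := rfl
    rw [hs, hw, hp, h0, Fin.snoc_last]
    have hc : pathWeight γ + weight P < k ↔ pathWeight γ < k - weight P := by omega
    simp only [hc]
    split_ifs <;> ring

end Paths

/-! ## The estimate and the exact value as path sums -/

section Estimate

variable {n L : ℕ}

/-- The transition amplitudes of `N^{⊗n} ∘ U`. -/
def layerAmp (N : Mat2 →ₗ[ℂ] Mat2) (U : UMat (Bits n)) : Kernel n :=
  amplitude fun X => tensorPow N n (conj U X)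

/-- The layers of a circuit without the final one, from the last to the first. -/
def circuitLayers (N : Mat2 →ₗ[ℂ] Mat2) (ω : Unitaries n L) : List (Kernel n) :=
  (List.ofFn fun j : Fin L => layerAmp N (ω j.castSucc)).reverse

/-- The Pauli coefficients of `V† O V` for the final layer `V`. -/
def finalCoeff (ω : Unitaries n L) (O : Op n) (P : PauliString n) : ℝ :=
  ∑ Q, pauliCoeff O Q * amplitude (conj (ω (Fin.last L))) Q P

theorem isHermMap_layer {N : Mat2 →ₗ[ℂ] Mat2} (hN : IsChannel N) (U : UMat (Bits n)) :
    IsHermMap fun X => tensorPow N n (conj U X) :=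
  (isHermMap_tensorPow hN).comp (isHermMap_sandwich _)

/-- The path weight counts `P_L` after the final layer `V`. Since `V` is a product of single-qubit
gates it preserves supports, so `V` can be moved into the observable without changing which paths
are kept. -/
theorem truncatedEstimate_eq {N : Mat2 →ₗ[ℂ] Mat2} (hN : IsChannel N) (hL : 1 ≤ L)
    {ω : Unitaries n L} {W : Fin n → UMat (Fin 2)} (hW : tensorU W = (ω (Fin.last L) : Op n))
    (k : ℕ) (O ρ : Op n) :
    truncatedEstimate k N ω O ρ = ∑ P, finalCoeff ω O P *
      back (fun P => expval (pauliOp P) ρ) (circuitLayers N ω) k P := by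
  obtain ⟨L, rfl⟩ : ∃ L', L = L' + 1 := ⟨L - 1, by omega⟩
  rw [truncatedEstimate]
  simp only [fourier]
  rw [sum_paths (fun j => amplitude (layerMap N ω j)) (pauliCoeff O)
    (fun P => expval (pauliOp P) ρ), layers_succ, circuitLayers, layers_succ]
  have hlast : amplitude (layerMap N ω (Fin.last L)) = fun P Q =>
      ∑ R, amplitude (conj (ω (Fin.last (L + 1)))) P R *
        layerAmp N (ω (Fin.last L).castSucc) R Q := by
    funext P Q
    refine Eq.trans ?_ (IsHermMap.amplitude_comp (isHermMap_sandwich _) (isHermMap_layer hN _) P Q)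
    congr 1
    funext X
    simp [layerMap, conj_eq_sandwich]
  have hrest : (fun j : Fin L => amplitude (layerMap N ω j.castSucc))
      = fun j : Fin L => layerAmp N (ω j.castSucc.castSucc) := by
    funext j
    congr 1
    funext X
    simp [layerMap, j.2.ne]
  rw [hlast, hrest]
  generalize (List.ofFn fun j : Fin L => layerAmp N (ω j.castSucc.castSucc)).reverse = As
  simp only [back, finalCoeff, Finset.sum_mul]
  rw [Finset.sum_comm]
  refine Finset.sum_congr rfl fun P _ => ?_
  rw [Finset.sum_comm, Finset.mul_sum]
  refine Finset.sum_congr rfl fun R _ => ?_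
  rw [Finset.mul_sum, Finset.mul_sum]
  refine Finset.sum_congr rfl fun Q _ => ?_
  -- Equal supports mean that `P` and `R` charge the same weight; otherwise the amplitude of the
  -- final layer vanishes.
  by_cases h : supp P = supp R
  · rw [weight, weight, h]
    ring
  · have h0 : amplitude (conj (ω (Fin.last (L + 1)))) P R = 0 := by
      rw [conj_eq_sandwich, ← hW]
      exact amplitude_tensorU_eq_zero W h
    rw [h0]
    ring

theorem expval_evolve {N : Mat2 →ₗ[ℂ] Mat2} (hN : IsChannel N) (ω : Unitaries n L) {O ρ : Op n}
    (hO : O.IsHermitian) (hρ : ρ.IsHermitian) :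
    expval O (evolve N ω ρ) = ∑ P, finalCoeff ω O P *
      full (fun P => expval (pauliOp P) ρ) (circuitLayers N ω) P := by
  have key : ∀ (L : ℕ) (U : Fin L → UMat (Bits n)),
      (Fin.foldl L (fun σ j => tensorPow N n (conj (U j) σ)) ρ).IsHermitian ∧
      ∀ P, expval (pauliOp P) (Fin.foldl L (fun σ j => tensorPow N n (conj (U j) σ)) ρ)
        = full (fun P => expval (pauliOp P) ρ) (List.ofFn fun j => layerAmp N (U j)).reverse P := by
    intro L
    induction L with
    | zero => exact fun U => ⟨by simpa using hρ, fun P => by simp [full]⟩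
    | succ L ih =>
      intro U
      obtain ⟨h1, h2⟩ := ih fun j => U j.castSucc
      rw [Fin.foldl_succ_last, layers_succ]
      refine ⟨(isHermMap_layer hN _).isHermitian h1, fun P => ?_⟩
      rw [(isHermMap_layer hN (U (Fin.last L))).expval_map h1, full]
      exact Finset.sum_congr rfl fun Q _ => by rw [h2, layerAmp]
  obtain ⟨h1, h2⟩ := key L fun j => ω j.castSucc
  rw [expval_eq_sum hO, evolve]
  simp only [finalCoeff, Finset.sum_mul]
  rw [Finset.sum_comm]
  refine Finset.sum_congr rfl fun P _ => ?_
  rw [conj_eq_sandwich, (isHermMap_sandwich _).expval_map h1, Finset.mul_sum]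
  refine Finset.sum_congr rfl fun Q _ => ?_
  rw [circuitLayers, h2, mul_assoc]

theorem estimate_sub_exact {N : Mat2 →ₗ[ℂ] Mat2} (hN : IsChannel N) (hL : 1 ≤ L)
    {ω : Unitaries n L} {W : Fin n → UMat (Fin 2)} (hW : tensorU W = (ω (Fin.last L) : Op n))
    (k : ℕ) {O ρ : Op n} (hO : O.IsHermitian) (hρ : ρ.IsHermitian) :
    truncatedEstimate k N ω O ρ - expval O (evolve N ω ρ)
      = -∑ P, finalCoeff ω O P *
        tail (fun P => expval (pauliOp P) ρ) (circuitLayers N ω) k P := by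
  rw [truncatedEstimate_eq hN hL hW, expval_evolve hN ω hO hρ, ← Finset.sum_sub_distrib,
    ← Finset.sum_neg_distrib]
  refine Finset.sum_congr rfl fun P _ => ?_
  rw [← back_add_tail _ k]
  ring

end Estimate

/-! ## Integration over unitary groups -/

section Topology

variable {ι : Type} [Fintype ι] [DecidableEq ι]

instance : SecondCountableTopology (UMat ι) :=
  haveI : SecondCountableTopology (Matrix ι ι ℂ) :=
    inferInstanceAs (SecondCountableTopology (ι → ι → ℂ))
  TopologicalSpace.Subtype.secondCountableTopology _

instance : CompactSpace (UMat ι) := by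
  have hK : IsCompact (Set.univ.pi fun _ : ι => Set.univ.pi fun _ : ι =>
      Metric.closedBall (0 : ℂ) 1) :=
    isCompact_univ_pi fun _ => isCompact_univ_pi fun _ => isCompact_closedBall _ _
  have hcl : IsClosed (Matrix.unitaryGroup ι ℂ : Set (Matrix ι ι ℂ)) := isClosed_unitary
  refine isCompact_iff_compactSpace.1 (IsCompact.of_isClosed_subset (X := Matrix ι ι ℂ)
    hK hcl fun U hU => ?_)
  exact Set.mem_univ_pi.2 fun i => Set.mem_univ_pi.2 fun j =>
    mem_closedBall_zero_iff.2 (entry_norm_bound_of_unitary hU i j)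

/-- All random quantities here are continuous functions of unitaries, and the unitary groups are
compact; this settles integrability throughout. -/
theorem integrable_of_continuous {X E : Type} [TopologicalSpace X] [CompactSpace X]
    [MeasurableSpace X] [OpensMeasurableSpace X] [NormedAddCommGroup E]
    [SecondCountableTopologyEither X E] {μ : Measure X} [IsFiniteMeasure μ] {f : X → E}
    (hf : Continuous f) : Integrable f μ :=
  hf.integrable_of_hasCompactSupport (HasCompactSupport.of_compactSpace f)

end Topology

/-! ### Moments of transition amplitudes under locally unbiased layers and 1-designs. -/

section Moments

variable {n : ℕ}

theorem continuous_sandwich_amplitude (P Q : PauliString n) :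
    Continuous fun G : Op n => amplitude (sandwich G) P Q := by
  unfold amplitude sandwich
  fun_prop

theorem continuous_conj_amplitude (P Q : PauliString n) :
    Continuous fun U : UMat (Bits n) => amplitude (conj U) P Q :=
  (continuous_sandwich_amplitude P Q).comp continuous_subtype_val

theorem continuous_tensorU : Continuous fun W : Fin n → UMat (Fin 2) => tensorU W := by
  refine continuous_pi fun x => continuous_pi fun y => ?_
  simp only [tensorU, tensor, Matrix.of_apply]
  refine continuous_finsetProd _ fun i _ => ?_
  have : Continuous fun W : Fin n → UMat (Fin 2) => ((W i : UMat (Fin 2)) : Mat2) :=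
    continuous_subtype_val.comp (continuous_apply i)
  exact this.matrix_elem _ _

/-- A product of single-qubit gates as a unitary. -/
def tensorUnitary (W : Fin n → UMat (Fin 2)) : UMat (Bits n) :=
  ⟨tensorU W, by
    have h : ∀ i, (W i : Mat2) * (W i : Mat2).conjTranspose = 1 :=
      fun i => Unitary.coe_mul_star_self (W i)
    rw [Matrix.mem_unitaryGroup_iff, Matrix.star_eq_conjTranspose, tensorU, conjTranspose_tensor,
      tensor_mul]
    simp only [h, tensor_one]⟩

theorem continuous_tensorUnitary :
    Continuous (tensorUnitary : (Fin n → UMat (Fin 2)) → UMat (Bits n)) :=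
  continuous_tensorU.subtype_mk _

theorem trace_sandwich_eq_sum (P Q : PauliString n) (G : Op n) :
    (pauliOp P * sandwich G (pauliOp Q)).trace
      = ∑ x, ∑ a, ∑ b, ∑ d, (pauliOp P x a * pauliOp Q b d) * (G a b * star (G x d)) := by
  simp only [sandwich, Matrix.trace, Matrix.diag, Matrix.mul_apply, Finset.mul_sum, Finset.sum_mul,
    Matrix.conjTranspose_apply]
  refine Finset.sum_congr rfl fun x _ => Finset.sum_congr rfl fun a _ => ?_
  rw [Finset.sum_comm]
  exact Finset.sum_congr rfl fun b _ => Finset.sum_congr rfl fun d _ => by ring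

theorem ofReal_amplitude_sandwich (G : Op n) (P Q : PauliString n) :
    (amplitude (sandwich G) P Q : ℂ) = (pauliOp P * sandwich G (pauliOp Q)).trace / 2 ^ n := by
  rw [amplitude]
  push_cast
  rw [ofReal_re_of_star (star_trace_mul (conjTranspose_pauliOp P)
    ((isHermMap_sandwich G).isHermitian (conjTranspose_pauliOp Q)))]

variable {S : Measure (UMat (Fin 2))} {D D' : Measure (UMat (Bits n))}

/-- Local unbiasedness at the level of second moments of transition amplitudes. -/
theorem RightInvariant.secondMoment [IsProbabilityMeasure S] [IsProbabilityMeasure D]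
    (h : RightInvariant S D) :
    ∃ D' : Measure (UMat (Bits n)), IsProbabilityMeasure D' ∧ ∀ P Q P' Q',
      ∫ U, amplitude (conj U) P Q * amplitude (conj U) P' Q' ∂D
        = ∫ z : UMat (Bits n) × (Fin n → UMat (Fin 2)),
            amplitude (conj (z.1 * tensorUnitary z.2)) P Q *
            amplitude (conj (z.1 * tensorUnitary z.2)) P' Q' ∂D'.prod (Measure.pi fun _ => S) := by
  obtain ⟨D', hD', h⟩ := h
  refine ⟨D', hD', fun P Q P' Q' => ?_⟩
  set ν := D'.prod (Measure.pi fun _ : Fin n => S)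
  have hcont : Continuous fun z : UMat (Bits n) × (Fin n → UMat (Fin 2)) =>
      z.1 * tensorUnitary z.2 := continuous_fst.mul (continuous_tensorUnitary.comp continuous_snd)
  -- The functions with equal averages under both laws form a linear space that contains the entries
  -- of `secondPower`. Continuity is carried along for integrability.
  let Good : (Op n → ℂ) → Prop := fun f => Continuous f ∧
    ∫ U, f (U : Op n) ∂D = ∫ z, f ((z.1 * tensorUnitary z.2 : UMat (Bits n)) : Op n) ∂ν
  have intD : ∀ f : Op n → ℂ, Continuous f → Integrable (fun U : UMat (Bits n) => f (U : Op n)) D :=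
    fun f hf => integrable_of_continuous (hf.comp continuous_subtype_val)
  have intν : ∀ f : Op n → ℂ, Continuous f →
      Integrable (fun z => f ((z.1 * tensorUnitary z.2 : UMat (Bits n)) : Op n)) ν :=
    fun f hf => integrable_of_continuous
      (hf.comp (continuous_subtype_val.comp hcont))
  have good_sum : ∀ (α : Type) [Fintype α] (f : α → Op n → ℂ), (∀ a, Good (f a)) →
      Good fun G => ∑ a, f a G := by
    intro α _ f hf
    refine ⟨continuous_finsetSum _ fun a _ => (hf a).1, ?_⟩
    rw [integral_finsetSum _ fun a _ => intD _ (hf a).1,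
      integral_finsetSum _ fun a _ => intν _ (hf a).1]
    exact Finset.sum_congr rfl fun a _ => (hf a).2
  have good_mul : ∀ (c : ℂ) (f : Op n → ℂ), Good f → Good fun G => c * f G := by
    intro c f hf
    exact ⟨continuous_const.mul hf.1, by rw [integral_const_mul, integral_const_mul, hf.2]⟩
  have good_entry : ∀ i j : (Bits n × Bits n) × (Bits n × Bits n),
      Good fun G => secondPower G i j := by
    intro i j
    have hc : Continuous fun G : Op n => secondPower G i j := by
      simp only [secondPower, Matrix.kroneckerMap_apply, Matrix.map_apply]
      fun_prop
    refine ⟨hc, ?_⟩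
    rw [h, integral_prod _ (intν _ hc)]
    rfl
  -- A product of two amplitudes has degree two in the entries of `U` and degree two in their
  -- conjugates, so it is a linear combination of entries of `secondPower`.
  have hprod : Good fun G => (amplitude (sandwich G) P Q : ℂ) * amplitude (sandwich G) P' Q' := by
    have : (fun G : Op n => (amplitude (sandwich G) P Q : ℂ) * amplitude (sandwich G) P' Q')
        = fun G => ∑ x, ∑ a, ∑ b, ∑ d, ∑ x', ∑ a', ∑ b', ∑ d',
          ((2 ^ n)⁻¹ * (2 ^ n)⁻¹ * (pauliOp P x a * pauliOp Q b d) *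
            (pauliOp P' x' a' * pauliOp Q' b' d')) *
          secondPower G ((a, a'), (x, x')) ((b, b'), (d, d')) := by
      funext G
      simp only [ofReal_amplitude_sandwich, trace_sandwich_eq_sum, div_eq_mul_inv, Finset.sum_mul]
      refine Finset.sum_congr rfl fun x _ => Finset.sum_congr rfl fun a _ =>
        Finset.sum_congr rfl fun b _ => Finset.sum_congr rfl fun d _ => ?_
      rw [Finset.mul_sum]
      refine Finset.sum_congr rfl fun x' _ => ?_
      rw [Finset.mul_sum]
      refine Finset.sum_congr rfl fun a' _ => ?_
      rw [Finset.mul_sum]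
      refine Finset.sum_congr rfl fun b' _ => ?_
      rw [Finset.mul_sum]
      refine Finset.sum_congr rfl fun d' _ => ?_
      simp only [secondPower, Matrix.kroneckerMap_apply, Matrix.map_apply]
      ring
    rw [this]
    exact good_sum _ _ fun x => good_sum _ _ fun a => good_sum _ _ fun b => good_sum _ _ fun d =>
      good_sum _ _ fun x' => good_sum _ _ fun a' => good_sum _ _ fun b' => good_sum _ _ fun d' =>
      good_mul _ _ (good_entry _ _)
  have := hprod.2
  simp only [← Complex.ofReal_mul] at this
  rw [integral_complex_ofReal, integral_complex_ofReal] at this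
  exact_mod_cast this

/-! ### One-designs -/

/-- Averaging replaces the rotated Pauli matrix by its trace part, and the overlap with another
Pauli matrix is then proportional to the product of the two traces. -/
theorem integral_amp1 [IsProbabilityMeasure S] (hS : IsOneDesign S) {a b : Fin 4}
    (hab : a ≠ 0 ∨ b ≠ 0) : ∫ W, amp1 (conj1 W) a b ∂S = 0 := by
  have hc : ∀ i j : Fin 2, Continuous fun W : UMat (Fin 2) =>
      ((W : Mat2) * pauliMatrix b * (W : Mat2).conjTranspose) i j := by
    intro i j
    have : Continuous fun W : UMat (Fin 2) => (W : Mat2) := continuous_subtype_val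
    fun_prop
  have hi : ∀ i j : Fin 2, Integrable (fun W : UMat (Fin 2) => pauliMatrix a i j / 2 *
      ((W : Mat2) * pauliMatrix b * (W : Mat2).conjTranspose) j i) S :=
    fun i j => integrable_of_continuous (continuous_const.mul (hc j i))
  have h : ∫ W : UMat (Fin 2), (amp1 (conj1 W) a b : ℂ) ∂S
      = ∑ i, ∑ j, pauliMatrix a i j / 2 * (((pauliMatrix b).trace / 2) • (1 : Mat2)) j i := by
    have h1 : ∀ W : UMat (Fin 2), (amp1 (conj1 W) a b : ℂ) = ∑ i, ∑ j, pauliMatrix a i j / 2 *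
        ((W : Mat2) * pauliMatrix b * (W : Mat2).conjTranspose) j i := by
      intro W
      rw [(conj1_preservesHerm W).ofReal_amp1, Matrix.trace, Finset.sum_div]
      refine Finset.sum_congr rfl fun i _ => ?_
      rw [Matrix.diag, Matrix.mul_apply, Finset.sum_div]
      exact Finset.sum_congr rfl fun j _ => by rw [conj1]; ring
    simp only [h1]
    rw [integral_finsetSum _ fun i _ => integrable_finsetSum _ fun j _ => hi i j]
    refine Finset.sum_congr rfl fun i _ => ?_
    rw [integral_finsetSum _ fun j _ => hi i j]
    refine Finset.sum_congr rfl fun j _ => ?_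
    rw [integral_const_mul, hS]
  have h0 : ∑ i, ∑ j, pauliMatrix a i j / 2 * (((pauliMatrix b).trace / 2) • (1 : Mat2)) j i
      = (pauliMatrix a).trace * (pauliMatrix b).trace / 4 := by
    simp only [Matrix.smul_apply, Matrix.one_apply, smul_eq_mul, mul_ite, mul_one, mul_zero,
      Finset.sum_ite_eq', Finset.mem_univ, if_true]
    rw [← Finset.sum_mul, ← Finset.sum_div]
    simp only [Matrix.trace, Matrix.diag]
    ring
  rw [integral_complex_ofReal, h0, trace_pauliMatrix, trace_pauliMatrix] at h
  rcases hab with ha | hb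
  · rw [if_neg ha, zero_mul, zero_div] at h
    exact_mod_cast h
  · rw [if_neg hb, mul_zero, zero_div] at h
    exact_mod_cast h

theorem conj_tensorUnitary (W : Fin n → UMat (Fin 2)) :
    conj (tensorUnitary W) = sandwich (tensorU W) := rfl

theorem integral_amplitude_tensorUnitary [IsProbabilityMeasure S] (hS : IsOneDesign S)
    {P : PauliString n} (hP : P ≠ 0) (Q : PauliString n) :
    ∫ W, amplitude (conj (tensorUnitary W)) P Q ∂(Measure.pi fun _ : Fin n => S) = 0 := by
  simp only [conj_tensorUnitary, amplitude_tensorU]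
  rw [integral_fintype_prod_eq_prod fun i (W : UMat (Fin 2)) => amp1 (conj1 W) (P i) (Q i)]
  obtain ⟨i, hi⟩ := Function.ne_iff.1 hP
  exact Finset.prod_eq_zero (Finset.mem_univ i) (integral_amp1 hS (Or.inl hi))

/-- Distinct supports are uncorrelated. -/
theorem integral_amplitude_mul_eq_zero [IsProbabilityMeasure S] (hS : IsOneDesign S)
    {P Q P' Q' : PauliString n} (h : supp Q ≠ supp Q') :
    ∫ W, amplitude (conj (tensorUnitary W)) P Q * amplitude (conj (tensorUnitary W)) P' Q'
      ∂(Measure.pi fun _ : Fin n => S) = 0 := by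
  simp only [conj_tensorUnitary, amplitude_tensorU, ← Finset.prod_mul_distrib]
  rw [integral_fintype_prod_eq_prod fun i (W : UMat (Fin 2)) =>
    amp1 (conj1 W) (P i) (Q i) * amp1 (conj1 W) (P' i) (Q' i)]
  have : ∃ i, ¬ (Q i = 0 ↔ Q' i = 0) := by
    by_contra! hc
    exact h (by ext i; simp [supp, hc i])
  obtain ⟨i, hi⟩ := this
  -- At this site exactly one of `Q`, `Q'` is the identity. Its amplitude is the constant 0 or 1, so
  -- only a first moment of the other one remains, and that vanishes.
  refine Finset.prod_eq_zero (Finset.mem_univ i) ?_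
  by_cases hQ : Q i = 0
  · have hQ' : Q' i ≠ 0 := by tauto
    simp only [hQ, amp1_zero_right (conj1_one _)]
    split_ifs
    · simpa using integral_amp1 hS (Or.inr hQ')
    · simp
  · have hQ' : Q' i = 0 := by tauto
    simp only [hQ', amp1_zero_right (conj1_one _)]
    split_ifs
    · simpa using integral_amp1 hS (Or.inr hQ)
    · simp

end Moments

/-! ## Contraction under noise -/

section Contraction

variable {n : ℕ}

/-- The row vector `x K`. -/
def rowMul (x : PauliString n → ℝ) (K : Kernel n) (Q : PauliString n) : ℝ := ∑ P, x P * K P Q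

/-- The part of a coefficient vector with support exactly `A`. -/
def part (A : Finset (Fin n)) (x : PauliString n → ℝ) (P : PauliString n) : ℝ :=
  if supp P = A then x P else 0

theorem sum_part_sq (x : PauliString n → ℝ) :
    ∑ A, ∑ P, part A x P ^ 2 = ∑ P, x P ^ 2 := by
  rw [Finset.sum_comm]
  refine Finset.sum_congr rfl fun P _ => ?_
  simp [part, ite_pow]

theorem restrictTo_ofCoeff (A : Finset (Fin n)) (x : PauliString n → ℝ) :
    restrictTo A (ofCoeff x) = ofCoeff (part A x) := by
  rw [restrictTo, Finset.sum_filter]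
  simp only [pauliCoeff_ofCoeff]
  refine Finset.sum_congr rfl fun P _ => ?_
  rw [part]
  split_ifs <;> simp

theorem frobSq_ofCoeff (x : PauliString n → ℝ) : frobSq (ofCoeff x) = ∑ P, x P ^ 2 := by
  rw [frobSq_eq_sum (isHermitian_ofCoeff x)]
  simp only [pauliCoeff_ofCoeff]

theorem heisenberg_ofCoeff (x : PauliString n → ℝ) (U : Op n) :
    U.conjTranspose * ofCoeff x * U = ofCoeff (rowMul x (amplitude (sandwich U))) := by
  rw [← ofCoeff_pauliCoeff (isHermitian_heisenberg (isHermitian_ofCoeff x) U)]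
  congr 1
  funext Q
  rw [pauliCoeff_heisenberg (isHermitian_ofCoeff x)]
  simp only [pauliCoeff_ofCoeff, rowMul]

/-- Links the operator form of the contraction coefficient to row vectors: taking the adjoint of a
map is multiplication from the right by its amplitudes. -/
theorem hsAdjoint_ofCoeff {Φ : Op n → Op n} (hΦ : IsHermMap Φ) (x : PauliString n → ℝ) :
    hsAdjoint Φ (ofCoeff x) = ofCoeff (rowMul x (amplitude Φ)) := by
  set H := hsAdjoint Φ (ofCoeff x) with hH
  -- The defining property of the adjoint, extended from matrix units by linearity; pairing with
  -- Pauli strings then reads off the coefficients.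
  have htr : ∀ Z : Op n, (H.conjTranspose * Z).trace = (ofCoeff x * Φ Z).trace := by
    intro Z
    conv_rhs => rw [Matrix.matrix_eq_sum_single Z]
    simp only [hΦ.map_sum, Finset.mul_sum, Matrix.trace_sum]
    rw [Matrix.trace, Finset.sum_comm]
    refine Finset.sum_congr rfl fun j _ => ?_
    rw [Matrix.diag, Matrix.mul_apply]
    refine Finset.sum_congr rfl fun i _ => ?_
    have : Matrix.single i j (Z i j) = Z i j • Matrix.single i j (1 : ℂ) := by simp
    rw [this, hΦ.smul, Matrix.mul_smul, Matrix.trace_smul, Matrix.conjTranspose_apply, hH,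
      hsAdjoint, Matrix.of_apply, star_star, (isHermitian_ofCoeff x).eq, smul_eq_mul, mul_comm]
  have hc : H.conjTranspose = ofCoeff (rowMul x (amplitude Φ)) := by
    rw [pauli_decomposition H.conjTranspose, ofCoeff]
    refine Finset.sum_congr rfl fun P _ => ?_
    congr 1
    rw [htr, trace_ofCoeff_mul, Finset.sum_div, rowMul]
    push_cast
    refine Finset.sum_congr rfl fun Q _ => ?_
    rw [mul_div_assoc, amplitude]
    push_cast
    rw [ofReal_re_of_star (star_trace_mul (conjTranspose_pauliOp Q)
      (hΦ.isHermitian (conjTranspose_pauliOp P)))]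
  rw [← Matrix.conjTranspose_conjTranspose H, hc, isHermitian_ofCoeff]

theorem sum_sq_rowMul_conj (U : UMat (Bits n)) (x : PauliString n → ℝ) :
    ∑ Q, rowMul x (amplitude (conj U)) Q ^ 2 = ∑ P, x P ^ 2 :=
  sum_sq_mul_amplitude U x

/-- A crude Cauchy–Schwarz bound. It serves to show that the supremum defining `contractionSq` is
over a bounded set. -/
theorem sum_sq_rowMul_le (x : PauliString n → ℝ) (K : Kernel n) :
    ∑ Q, rowMul x K Q ^ 2 ≤ (∑ Q, ∑ P, K P Q ^ 2) * ∑ P, x P ^ 2 := by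
  rw [Finset.sum_mul]
  refine Finset.sum_le_sum fun Q _ => ?_
  rw [mul_comm]
  exact Finset.sum_mul_sq_le_sq_mul_sq _ _ _

theorem continuous_rowMul_tensorUnitary (x : PauliString n → ℝ) (P : PauliString n) :
    Continuous fun W : Fin n → UMat (Fin 2) =>
      rowMul x (amplitude (conj (tensorUnitary W))) P :=
  continuous_finsetSum _ fun Q _ => continuous_const.mul
    ((continuous_conj_amplitude Q P).comp continuous_tensorUnitary)

theorem continuous_rowMul_rowMul (x : PauliString n → ℝ) (K : Kernel n) (P : PauliString n) :
    Continuous fun W : Fin n → UMat (Fin 2) =>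
      rowMul (rowMul x (amplitude (conj (tensorUnitary W)))) K P :=
  continuous_finsetSum _ fun Q _ => (continuous_rowMul_tensorUnitary x Q).mul continuous_const

variable {S : Measure (UMat (Fin 2))} {N : Mat2 →ₗ[ℂ] Mat2}

theorem contractionSq_nonneg : 0 ≤ contractionSq n S N := by
  refine Real.sSup_nonneg fun r hr => ?_
  obtain ⟨A, O, -, -, -, rfl⟩ := hr
  have hf : ∀ X : Op n, 0 ≤ frobSq X := by
    intro X
    rw [frobSq]
    have := (Matrix.posSemidef_conjTranspose_mul_self X).trace_nonneg
    have := (Complex.le_def.1 this).1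
    exact div_nonneg this (by positivity)
  exact Real.rpow_nonneg (div_nonneg (integral_nonneg fun W => hf _) (hf _)) _

/-- The contraction coefficient was normalized per qubit by the exponent `1/|A|`; raising to the
power `|A|` returns the contraction of the whole component. To use the supremum one must prove
boundedness, because `sSup` of an unbounded set of reals is 0. -/
theorem integral_noise_sq_le [IsProbabilityMeasure S] (hN : IsChannel N) (A : Finset (Fin n))
    (z : PauliString n → ℝ) :
    ∫ W, ∑ P, rowMul (rowMul (part A z) (amplitude (conj (tensorUnitary W))))
        (amplitude (tensorPow N n)) P ^ 2 ∂(Measure.pi fun _ : Fin n => S)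
      ≤ contractionSq n S N ^ A.card * ∑ P, part A z P ^ 2 := by
  set ν := Measure.pi fun _ : Fin n => S
  set y := part A z with hy
  -- The empty support is excluded from the supremum. There only the identity component is left,
  -- which gates and noise fix, and the claimed factor is `s ^ 0 = 1`.
  rcases A.eq_empty_or_nonempty with rfl | hA
  · have h0 : ∀ P : PauliString n, y P = if P = 0 then z 0 else 0 := by
      intro P
      have : supp P = ∅ ↔ P = 0 := by rw [← weight_eq_zero, weight, Finset.card_eq_zero]
      simp only [hy, part, this]
      split_ifs with h
      · rw [h]
      · rfl
    have hR : ∀ W : Fin n → UMat (Fin 2), rowMul y (amplitude (conj (tensorUnitary W))) = y := by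
      intro W
      funext Q
      simp only [rowMul, h0, ite_mul, zero_mul, Finset.sum_ite_eq', Finset.mem_univ, if_true,
        conj_tensorUnitary, amplitude_tensorU, Pi.zero_apply, amp1_zero_left (trace_conj1 _)]
      rw [Finset.prod_ite_zero]
      simp [funext_iff]
    have hNn : rowMul y (amplitude (tensorPow N n)) = y := by
      funext Q
      simp only [rowMul, h0, ite_mul, zero_mul, Finset.sum_ite_eq', Finset.mem_univ, if_true,
        amplitude_tensorPow hN, Pi.zero_apply, amp1_zero_left hN.trace_apply]
      rw [Finset.prod_ite_zero]
      simp [funext_iff]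
    simp [hR, hNn]
  set E := ∫ W, ∑ P, rowMul (rowMul y (amplitude (conj (tensorUnitary W))))
        (amplitude (tensorPow N n)) P ^ 2 ∂ν with hE
  have hE0 : 0 ≤ E := integral_nonneg fun W => Finset.sum_nonneg fun P _ => sq_nonneg _
  set C := ∑ Q, ∑ P, amplitude (tensorPow N n) P Q ^ 2 with hC
  have bound : ∀ v : PauliString n → ℝ,
      ∫ W, ∑ P, rowMul (rowMul v (amplitude (conj (tensorUnitary W))))
        (amplitude (tensorPow N n)) P ^ 2 ∂ν ≤ C * ∑ P, v P ^ 2 := by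
    intro v
    calc _ ≤ ∫ _W, C * ∑ P, v P ^ 2 ∂ν := by
          refine integral_mono (integrable_of_continuous (continuous_finsetSum _ fun P _ =>
            (continuous_rowMul_rowMul v _ P).pow 2)) (integrable_const _) fun W => ?_
          refine (sum_sq_rowMul_le _ _).trans ?_
          rw [sum_sq_rowMul_conj]
      _ = _ := by simp
  have hset : ∀ (B : Finset (Fin n)) (x : PauliString n → ℝ),
      ∫ W : Fin n → UMat (Fin 2), frobSq (hsAdjoint (tensorPow N n)
          ((tensorU W).conjTranspose * restrictTo B (ofCoeff x) * tensorU W)) ∂ν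
        = ∫ W, ∑ P, rowMul (rowMul (part B x) (amplitude (conj (tensorUnitary W))))
        (amplitude (tensorPow N n)) P ^ 2 ∂ν := by
    intro B x
    simp only [restrictTo_ofCoeff, heisenberg_ofCoeff, hsAdjoint_ofCoeff (isHermMap_tensorPow hN),
      frobSq_ofCoeff]
    rfl
  by_cases hy0 : ∑ P, y P ^ 2 = 0
  · rw [hy0, mul_zero]
    refine (bound y).trans ?_
    rw [hy0, mul_zero]
  have hyp : 0 < ∑ P, y P ^ 2 :=
    lt_of_le_of_ne (Finset.sum_nonneg fun P _ => sq_nonneg _) (Ne.symm hy0)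
  have hmem : (E / ∑ P, y P ^ 2) ^ (1 / (A.card : ℝ)) ≤ contractionSq n S N := by
    -- The quotient is at most `max 1 C`. The exponent `1/|B|` is at most 1, and a power with such
    -- an exponent of a number at least 1 does not exceed that number.
    refine le_csSup ⟨max 1 C, ?_⟩ ⟨A, ofCoeff z, hA, isHermitian_ofCoeff z, ?_, ?_⟩
    · rintro r ⟨B, O, hB, hO, hBO, rfl⟩
      rw [← ofCoeff_pauliCoeff hO, hset, restrictTo_ofCoeff, frobSq_ofCoeff]
      have hB1 : 1 ≤ (B.card : ℝ) := by exact_mod_cast hB.card_pos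
      set t := ∑ P, part B (pauliCoeff O) P ^ 2
      have ht : 0 ≤ t := Finset.sum_nonneg fun P _ => sq_nonneg _
      have hle := bound (part B (pauliCoeff O))
      have h0 : 0 ≤ ∫ W, ∑ P, rowMul (rowMul (part B (pauliCoeff O))
          (amplitude (conj (tensorUnitary W)))) (amplitude (tensorPow N n)) P ^ 2 ∂ν :=
        integral_nonneg fun W => Finset.sum_nonneg fun P _ => sq_nonneg _
      have hdiv : (∫ W, ∑ P, rowMul (rowMul (part B (pauliCoeff O))
          (amplitude (conj (tensorUnitary W)))) (amplitude (tensorPow N n)) P ^ 2 ∂ν) / t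
          ≤ max 1 C := by
        rcases ht.eq_or_lt with h | h
        · rw [← h, div_zero]
          exact zero_le_one.trans (le_max_left _ _)
        · rw [div_le_iff₀ h]
          exact hle.trans (mul_le_mul_of_nonneg_right (le_max_right _ _) ht)
      refine (Real.rpow_le_rpow (div_nonneg h0 ht) hdiv (by positivity)).trans ?_
      conv_rhs => rw [← Real.rpow_one (max 1 C)]
      exact Real.rpow_le_rpow_of_exponent_le (le_max_left _ _) (by
        rw [div_le_one (by linarith)]; exact hB1)
    · rw [restrictTo_ofCoeff]
      intro h
      apply hy0
      have : frobSq (ofCoeff y) = 0 := by rw [h]; simp [frobSq]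
      rwa [frobSq_ofCoeff] at this
    · rw [hset, restrictTo_ofCoeff, frobSq_ofCoeff]
  have hq : 0 ≤ E / ∑ P, y P ^ 2 := div_nonneg hE0 hyp.le
  have hpow : E / ∑ P, y P ^ 2 ≤ contractionSq n S N ^ A.card := by
    have hA0 : (A.card : ℝ) ≠ 0 := by exact_mod_cast hA.card_pos.ne'
    calc E / ∑ P, y P ^ 2 = ((E / ∑ P, y P ^ 2) ^ (1 / (A.card : ℝ))) ^ A.card := by
          rw [← Real.rpow_natCast, ← Real.rpow_mul hq, one_div, inv_mul_cancel₀ hA0, Real.rpow_one]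
      _ ≤ _ := pow_le_pow_left₀ (Real.rpow_nonneg hq _) hmem _
  rwa [div_le_iff₀ hyp] at hpow

/-- Averaged over a 1-design, a state sees an operator through its Frobenius norm. -/
theorem integral_expval_sq_le [IsProbabilityMeasure S] (hS : IsOneDesign S) {ρ : Op n}
    (hρ : IsState ρ) (y : PauliString n → ℝ) :
    ∫ W, (∑ P, rowMul y (amplitude (conj (tensorUnitary W))) P * expval (pauliOp P) ρ) ^ 2
        ∂(Measure.pi fun _ : Fin n => S) ≤ ∑ P, y P ^ 2 := by
  set ν := Measure.pi fun _ : Fin n => S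
  set Y := ofCoeff y
  have hY : Y.IsHermitian := isHermitian_ofCoeff y
  have hYY : (Y * Y).IsHermitian := by
    rw [Matrix.IsHermitian, Matrix.conjTranspose_mul, hY]
  have hρH : ρ.IsHermitian := hρ.1.1
  have hexp : ∀ (X : Op n), X.IsHermitian → ∀ W : Fin n → UMat (Fin 2),
      expval X (conj (tensorUnitary W) ρ) = ∑ P, (∑ Q, pauliCoeff X Q *
        amplitude (conj (tensorUnitary W)) Q P) * expval (pauliOp P) ρ := by
    intro X hX W
    rw [expval_eq_sum hX]
    simp only [Finset.sum_mul]
    rw [Finset.sum_comm]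
    refine Finset.sum_congr rfl fun Q _ => ?_
    rw [conj_eq_sandwich, (isHermMap_sandwich _).expval_map hρH, Finset.mul_sum]
    exact Finset.sum_congr rfl fun P _ => by ring
  -- The variance of `Y` in the rotated state `σ` is nonnegative: expand `Tr[(Y - μ) σ (Y - μ)] ≥ 0`
  -- with `μ = Tr[Y σ]` and `Tr σ = 1`.
  have hJensen : ∀ W : Fin n → UMat (Fin 2), expval Y (conj (tensorUnitary W) ρ) ^ 2
      ≤ expval (Y * Y) (conj (tensorUnitary W) ρ) := by
    intro W
    set σ := conj (tensorUnitary W) ρ with hσ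
    have hσp : σ.PosSemidef := hρ.1.mul_mul_conjTranspose_same _
    have hσt : σ.trace = 1 := by
      have hW : ((tensorUnitary W : UMat (Bits n)) : Op n).conjTranspose * (tensorUnitary W : Op n)
        = 1 := Unitary.coe_star_mul_self _
      rw [hσ, conj, Matrix.trace_mul_comm, ← mul_assoc, hW, one_mul, hρ.2]
    set μ := expval Y σ with hμ
    have hZ : (Y - (μ : ℂ) • (1 : Op n)).conjTranspose = Y - (μ : ℂ) • (1 : Op n) := by
      simp [hY.eq]
    have hpos := (hσp.mul_mul_conjTranspose_same (Y - (μ : ℂ) • (1 : Op n))).trace_nonneg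
    have hpos := (Complex.le_def.1 hpos).1
    rw [hZ, Matrix.trace_mul_comm, ← mul_assoc] at hpos
    have hYσ : (Y * σ).trace = (μ : ℂ) :=
      (ofReal_re_of_star (star_trace_mul hY hσp.1)).symm
    have hexpand : ((Y - (μ : ℂ) • (1 : Op n)) * (Y - (μ : ℂ) • (1 : Op n)) * σ).trace
        = (Y * Y * σ).trace - (μ : ℂ) * μ := by
      simp only [sub_mul, mul_sub, Matrix.smul_mul, Matrix.mul_smul, one_mul, mul_one,
        Matrix.trace_sub, Matrix.trace_smul, hYσ, hσt, smul_eq_mul]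
      ring
    rw [hexpand, Complex.sub_re, Complex.zero_re, ← Complex.ofReal_mul, Complex.ofReal_re] at hpos
    rw [sq]
    exact sub_nonneg.1 hpos
  have hamp : ∀ P Q, Integrable (fun W => amplitude (conj (tensorUnitary W)) P Q) ν := fun P Q =>
    integrable_of_continuous ((continuous_conj_amplitude P Q).comp continuous_tensorUnitary)
  -- The rotated state is maximally mixed on average: every non-identity coefficient of `Y²`
  -- averages to zero, and the identity coefficient of `Y²` is the squared Frobenius norm of `Y`.
  have hmean : ∫ W, expval (Y * Y) (conj (tensorUnitary W) ρ) ∂ν = ∑ P, y P ^ 2 := by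
    simp only [hexp _ hYY]
    rw [integral_finsetSum _ fun P _ => (integrable_finsetSum _ fun Q _ =>
      (hamp Q P).const_mul _).mul_const _]
    simp only [integral_mul_const]
    have h1 : ∀ P, ∫ W, ∑ Q, pauliCoeff (Y * Y) Q * amplitude (conj (tensorUnitary W)) Q P ∂ν
        = if P = 0 then pauliCoeff (Y * Y) 0 else 0 := by
      intro P
      rw [integral_finsetSum _ fun Q _ => (hamp Q P).const_mul _]
      simp only [integral_const_mul]
      rw [Finset.sum_eq_single 0]
      · have : ∀ W : Fin n → UMat (Fin 2), amplitude (conj (tensorUnitary W)) 0 P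
            = if P = 0 then 1 else 0 := by
          intro W
          simp only [conj_tensorUnitary, amplitude_tensorU, Pi.zero_apply,
            amp1_zero_left (trace_conj1 _)]
          rw [Finset.prod_ite_zero]
          simp [funext_iff]
        simp only [this]
        split_ifs <;> simp
      · intro Q _ hQ
        rw [integral_amplitude_tensorUnitary hS hQ, mul_zero]
      · simp
    simp only [h1, ite_mul, zero_mul, Finset.sum_ite_eq', Finset.mem_univ, if_true, pauliOp_zero]
    have h2 : expval 1 ρ = 1 := by simp [expval, hρ.2]
    have h3 : pauliCoeff (Y * Y) 0 = frobSq Y := by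
      rw [pauliCoeff, frobSq, hY, pauliOp_zero, mul_one]
    rw [h2, mul_one, h3, frobSq_ofCoeff]
  have hleft : ∀ W : Fin n → UMat (Fin 2),
      ∑ P, rowMul y (amplitude (conj (tensorUnitary W))) P * expval (pauliOp P) ρ
        = expval Y (conj (tensorUnitary W) ρ) := by
    intro W
    rw [hexp _ hY]
    simp only [Y, pauliCoeff_ofCoeff]
    rfl
  simp only [hleft]
  rw [← hmean]
  have hint : ∀ X : Op n, X.IsHermitian →
      Continuous fun W : Fin n → UMat (Fin 2) => expval X (conj (tensorUnitary W) ρ) := by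
    intro X hX
    simp only [hexp _ hX]
    exact continuous_finsetSum _ fun P _ => (continuous_finsetSum _ fun Q _ =>
      continuous_const.mul ((continuous_conj_amplitude Q P).comp
        continuous_tensorUnitary)).mul continuous_const
  exact integral_mono (integrable_of_continuous ((hint Y hY).pow 2))
    (integrable_of_continuous (hint _ hYY)) hJensen

end Contraction

/-! ## The second moment of the truncation error -/

section SecondMoment

variable {n : ℕ} {S : Measure (UMat (Fin 2))} {N : Mat2 →ₗ[ℂ] Mat2}

theorem sq_sum_eq (v g : PauliString n → ℝ) :
    (∑ P, v P * g P) ^ 2 = ∑ P, ∑ P', v P * v P' * (g P * g P') := by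
  rw [sq, Finset.sum_mul_sum]
  exact Finset.sum_congr rfl fun P _ => Finset.sum_congr rfl fun P' _ => by ring

theorem sum_mul_integral_mul {X : Type} [TopologicalSpace X] [CompactSpace X]
    [MeasurableSpace X] [OpensMeasurableSpace X] {μ : Measure X} [IsFiniteMeasure μ]
    {G : X → PauliString n → ℝ} (hG : ∀ P, Continuous fun a => G a P) (v : PauliString n → ℝ) :
    ∑ P, ∑ P', v P * v P' * ∫ a, G a P * G a P' ∂μ = ∫ a, (∑ P, v P * G a P) ^ 2 ∂μ := by
  have hi : ∀ P P', Integrable (fun a => v P * v P' * (G a P * G a P')) μ := fun P P' =>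
    integrable_of_continuous (continuous_const.mul ((hG P).mul (hG P')))
  simp only [sq_sum_eq]
  rw [integral_finsetSum _ fun P _ => integrable_finsetSum _ fun P' _ => hi P P']
  refine Finset.sum_congr rfl fun P _ => ?_
  rw [integral_finsetSum _ fun P' _ => hi P P']
  exact Finset.sum_congr rfl fun P' _ => by rw [integral_const_mul]

theorem continuous_rowMul_conj {X : Type} [TopologicalSpace X] {U : X → UMat (Bits n)}
    (hU : Continuous U) (x : PauliString n → ℝ) (P : PauliString n) :
    Continuous fun a => rowMul x (amplitude (conj (U a))) P :=
  continuous_finsetSum _ fun Q _ => continuous_const.mul ((continuous_conj_amplitude Q P).comp hU)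

theorem rowMul_conj_mul (x : PauliString n → ℝ) (U V : UMat (Bits n)) :
    rowMul x (amplitude (conj (U * V)))
      = rowMul (rowMul x (amplitude (conj U))) (amplitude (conj V)) := by
  funext Q
  have h : ∀ P, amplitude (conj (U * V)) P Q
      = ∑ R, amplitude (conj U) P R * amplitude (conj V) R Q := by
    intro P
    refine Eq.trans ?_ (IsHermMap.amplitude_comp (isHermMap_sandwich (U : Op n))
      (isHermMap_sandwich (V : Op n)) P Q)
    rw [← sandwich_mul]
    rfl
  simp only [rowMul, h, Finset.mul_sum, Finset.sum_mul]
  rw [Finset.sum_comm]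
  exact Finset.sum_congr rfl fun R _ => Finset.sum_congr rfl fun P _ => by ring

/-- The last layer can be averaged first, and only its local randomization matters. -/
theorem integral_last_layer_le [IsProbabilityMeasure S] {j : ℕ}
    (μ : Fin (j + 1) → Measure (UMat (Bits n))) [∀ i, IsProbabilityMeasure (μ i)]
    (hμ : RightInvariant S (μ (Fin.last j)))
    {G : (Fin j → UMat (Bits n)) → PauliString n → ℝ} (hG : ∀ P, Continuous fun ω => G ω P)
    {B : ℝ}
    (hB : ∀ y : PauliString n → ℝ, ∫ W, ∑ P, ∑ P',
        rowMul y (amplitude (conj (tensorUnitary W))) P *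
        rowMul y (amplitude (conj (tensorUnitary W))) P' *
        (∫ ω, G ω P * G ω P' ∂Measure.pi fun i => μ i.castSucc) ∂(Measure.pi fun _ : Fin n => S)
      ≤ B * ∑ P, y P ^ 2) (x : PauliString n → ℝ) :
    ∫ ω, (∑ P, rowMul x (amplitude (conj (ω (Fin.last j)))) P *
        G (fun i => ω i.castSucc) P) ^ 2 ∂Measure.pi μ ≤ B * ∑ P, x P ^ 2 := by
  -- The square is quadratic in `G`, so the inner layers enter only through their second moments
  -- `K`.
  set K : Kernel n := fun P P' => ∫ ω, G ω P * G ω P' ∂Measure.pi fun i => μ i.castSucc with hK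
  obtain ⟨D', hD', hmom⟩ := hμ.secondMoment
  set ν := Measure.pi fun _ : Fin n => S with hν
  have hz : Continuous fun z : UMat (Bits n) × (Fin n → UMat (Fin 2)) =>
      z.1 * tensorUnitary z.2 := continuous_fst.mul (continuous_tensorUnitary.comp continuous_snd)
  have hlast : Continuous fun ω : Fin (j + 1) → UMat (Bits n) => ω (Fin.last j) :=
    continuous_apply _
  have hinit : Continuous fun (ω : Fin (j + 1) → UMat (Bits n)) (i : Fin j) => ω i.castSucc :=
    continuous_pi fun i => continuous_apply _
  have hmom' : ∀ P P', ∫ U, rowMul x (amplitude (conj U)) P * rowMul x (amplitude (conj U)) P'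
        ∂μ (Fin.last j)
      = ∫ z, rowMul x (amplitude (conj (z.1 * tensorUnitary z.2))) P *
          rowMul x (amplitude (conj (z.1 * tensorUnitary z.2))) P' ∂D'.prod ν := by
    intro P P'
    have e : ∀ U : UMat (Bits n), rowMul x (amplitude (conj U)) P *
        rowMul x (amplitude (conj U)) P' = ∑ T, ∑ T', x T * x T' *
          (amplitude (conj U) T P * amplitude (conj U) T' P') := by
      intro U
      rw [rowMul, rowMul, Finset.sum_mul_sum]
      exact Finset.sum_congr rfl fun T _ => Finset.sum_congr rfl fun T' _ => by ring
    have c : ∀ T T', Continuous fun U : UMat (Bits n) => x T * x T' *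
        (amplitude (conj U) T P * amplitude (conj U) T' P') := fun T T' =>
      continuous_const.mul ((continuous_conj_amplitude T P).mul (continuous_conj_amplitude T' P'))
    have i1 : ∀ T T', Integrable _ (μ (Fin.last j)) := fun T T' => integrable_of_continuous (c T T')
    have i2 : ∀ T T', Integrable (fun z : UMat (Bits n) × (Fin n → UMat (Fin 2)) => x T * x T' *
        (amplitude (conj (z.1 * tensorUnitary z.2)) T P *
        amplitude (conj (z.1 * tensorUnitary z.2)) T' P')) (D'.prod ν) := fun T T' =>
      integrable_of_continuous ((c T T').comp hz)
    simp only [e]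
    rw [integral_finsetSum _ fun T _ => integrable_finsetSum _ fun T' _ => i1 T T',
      integral_finsetSum _ fun T _ => integrable_finsetSum _ fun T' _ => i2 T T']
    refine Finset.sum_congr rfl fun T _ => ?_
    rw [integral_finsetSum _ fun T' _ => i1 T T', integral_finsetSum _ fun T' _ => i2 T T']
    refine Finset.sum_congr rfl fun T' _ => ?_
    rw [integral_const_mul, integral_const_mul, hmom]
  have hsplit : ∀ P P', ∫ ω, rowMul x (amplitude (conj (ω (Fin.last j)))) P *
        rowMul x (amplitude (conj (ω (Fin.last j)))) P' *
        (G (fun i => ω i.castSucc) P * G (fun i => ω i.castSucc) P') ∂Measure.pi μ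
      = (∫ U, rowMul x (amplitude (conj U)) P * rowMul x (amplitude (conj U)) P'
        ∂μ (Fin.last j)) * K P P' := by
    intro P P'
    -- Independence: the product measure splits into the last coordinate and the others.
    have hmp := measurePreserving_piFinSuccAbove μ (Fin.last j)
    rw [hK, ← integral_prod_mul]
    simp only [Fin.succAbove_last] at hmp
    rw [← hmp.integral_comp']
    refine integral_congr_ae (Filter.Eventually.of_forall fun ω => ?_)
    have hinit : (fun i : Fin j => ω i.castSucc) = Fin.init ω := rfl
    simp [MeasurableEquiv.piFinSuccAbove, hinit]
  have hc : ∀ P P', Continuous fun z : UMat (Bits n) × (Fin n → UMat (Fin 2)) =>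
      rowMul x (amplitude (conj (z.1 * tensorUnitary z.2))) P *
      rowMul x (amplitude (conj (z.1 * tensorUnitary z.2))) P' * K P P' := fun P P' =>
    ((continuous_rowMul_conj hz x P).mul (continuous_rowMul_conj hz x P')).mul continuous_const
  have hic : ∀ P P', Integrable (fun z : UMat (Bits n) × (Fin n → UMat (Fin 2)) =>
      rowMul x (amplitude (conj (z.1 * tensorUnitary z.2))) P *
      rowMul x (amplitude (conj (z.1 * tensorUnitary z.2))) P' * K P P') (D'.prod ν) :=
    fun P P' => integrable_of_continuous (hc P P')
  have hω : ∀ P P', Integrable (fun ω : Fin (j + 1) → UMat (Bits n) =>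
      rowMul x (amplitude (conj (ω (Fin.last j)))) P *
        rowMul x (amplitude (conj (ω (Fin.last j)))) P' *
        (G (fun i => ω i.castSucc) P * G (fun i => ω i.castSucc) P')) (Measure.pi μ) := fun P P' =>
    integrable_of_continuous (((continuous_rowMul_conj hlast x P).mul
      (continuous_rowMul_conj hlast x P')).mul (((hG P).comp hinit).mul ((hG P').comp hinit)))
  calc ∫ ω, (∑ P, rowMul x (amplitude (conj (ω (Fin.last j)))) P *
        G (fun i => ω i.castSucc) P) ^ 2 ∂Measure.pi μ
      = ∑ P, ∑ P', (∫ U, rowMul x (amplitude (conj U)) P * rowMul x (amplitude (conj U)) P'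
          ∂μ (Fin.last j)) * K P P' := by
        simp only [sq_sum_eq]
        rw [integral_finsetSum _ fun P _ => integrable_finsetSum _ fun P' _ => hω P P']
        refine Finset.sum_congr rfl fun P _ => ?_
        rw [integral_finsetSum _ fun P' _ => hω P P']
        exact Finset.sum_congr rfl fun P' _ => hsplit P P'
    _ = ∫ z, ∑ P, ∑ P', rowMul x (amplitude (conj (z.1 * tensorUnitary z.2))) P *
          rowMul x (amplitude (conj (z.1 * tensorUnitary z.2))) P' * K P P' ∂D'.prod ν := by
        rw [integral_finsetSum _ fun P _ => integrable_finsetSum _ fun P' _ => hic P P']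
        refine Finset.sum_congr rfl fun P _ => ?_
        rw [integral_finsetSum _ fun P' _ => hic P P']
        exact Finset.sum_congr rfl fun P' _ => by rw [hmom', integral_mul_const]
    _ = ∫ U, ∫ W, ∑ P, ∑ P', rowMul x (amplitude (conj (U * tensorUnitary W))) P *
          rowMul x (amplitude (conj (U * tensorUnitary W))) P' * K P P' ∂ν ∂D' :=
        integral_prod _ (integrable_finsetSum _ fun P _ => integrable_finsetSum _ fun P' _ =>
          hic P P')
    _ ≤ ∫ _U, B * ∑ P, x P ^ 2 ∂D' := by
        refine integral_mono (Integrable.integral_prod_left (integrable_finsetSum _ fun P _ =>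
          integrable_finsetSum _ fun P' _ => hic P P')) (integrable_const _) fun U => ?_
        -- In the Heisenberg picture `U` acts on `x` before `W`. The hypothesis `hB` is applied to
        -- the vector rotated by `U`, whose norm is that of `x`.
        simp only [rowMul_conj_mul]
        refine (hB _).trans ?_
        rw [sum_sq_rowMul_conj]
    _ = _ := by simp

/-- Single-qubit gates preserve supports, so their action commutes with the projection to a support.
-/
theorem rowMul_part (A : Finset (Fin n)) (y : PauliString n → ℝ) (W : Fin n → UMat (Fin 2)) :
    rowMul (part A y) (amplitude (conj (tensorUnitary W)))
      = part A (rowMul y (amplitude (conj (tensorUnitary W)))) := by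
  funext Q
  rw [part, rowMul, rowMul]
  split_ifs with h
  · refine Finset.sum_congr rfl fun P _ => ?_
    by_cases hP : supp P = supp Q
    · rw [part, if_pos (hP.trans h)]
    · rw [conj_tensorUnitary, amplitude_tensorU_eq_zero W hP, mul_zero, mul_zero]
  · refine Finset.sum_eq_zero fun P _ => ?_
    by_cases hP : supp P = supp Q
    · rw [part, if_neg (fun e => h (hP.symm.trans e)), zero_mul]
    · rw [conj_tensorUnitary, amplitude_tensorU_eq_zero W hP, mul_zero]

theorem sum_part_mul (v : PauliString n → ℝ) (K : Kernel n) :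
    ∑ A, ∑ P, ∑ P', part A v P * part A v P' * K P P'
      = ∑ P, ∑ P', if supp P = supp P' then v P * v P' * K P P' else 0 := by
  rw [Finset.sum_comm]
  refine Finset.sum_congr rfl fun P _ => ?_
  rw [Finset.sum_comm]
  refine Finset.sum_congr rfl fun P' _ => ?_
  rw [Finset.sum_eq_single (supp P)]
  · simp only [part, if_true, eq_comm]
    split_ifs <;> simp
  · intro A _ hA
    rw [part, if_neg (Ne.symm hA), zero_mul, zero_mul]
  · simp

/-- Averaging over local gates decouples distinct supports. -/
theorem integral_decouple [IsProbabilityMeasure S] (hS : IsOneDesign S) (y : PauliString n → ℝ)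
    (K : Kernel n) :
    ∫ W, ∑ P, ∑ P', rowMul y (amplitude (conj (tensorUnitary W))) P *
        rowMul y (amplitude (conj (tensorUnitary W))) P' * K P P' ∂(Measure.pi fun _ : Fin n => S)
      = ∑ A, ∫ W, ∑ P, ∑ P', rowMul (part A y) (amplitude (conj (tensorUnitary W))) P *
        rowMul (part A y) (amplitude (conj (tensorUnitary W))) P' * K P P'
          ∂(Measure.pi fun _ : Fin n => S) := by
  set ν := Measure.pi fun _ : Fin n => S
  have hi : ∀ (x : PauliString n → ℝ) (P P' : PauliString n), Integrable (fun W =>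
      rowMul x (amplitude (conj (tensorUnitary W))) P *
      rowMul x (amplitude (conj (tensorUnitary W))) P' * K P P') ν := fun x P P' =>
    integrable_of_continuous (((continuous_rowMul_tensorUnitary x P).mul
      (continuous_rowMul_tensorUnitary x P')).mul continuous_const)
  have hi2 : ∀ (P P' : PauliString n), Integrable (fun W => if supp P = supp P' then
      rowMul y (amplitude (conj (tensorUnitary W))) P *
      rowMul y (amplitude (conj (tensorUnitary W))) P' * K P P' else 0) ν := by
    intro P P'
    split_ifs
    · exact hi y P P'
    · exact integrable_zero _ _ _
  rw [← integral_finsetSum _ fun A _ => integrable_finsetSum _ fun P _ =>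
    integrable_finsetSum _ fun P' _ => hi (part A y) P P']
  simp only [rowMul_part, sum_part_mul]
  rw [integral_finsetSum _ fun P _ => integrable_finsetSum _ fun P' _ => hi y P P',
    integral_finsetSum _ fun P _ => integrable_finsetSum _ fun P' _ => hi2 P P']
  refine Finset.sum_congr rfl fun P _ => ?_
  rw [integral_finsetSum _ fun P' _ => hi y P P', integral_finsetSum _ fun P' _ => hi2 P P']
  refine Finset.sum_congr rfl fun P' _ => ?_
  split_ifs with h
  · rfl
  · rw [integral_mul_const, integral_zero]
    have e : ∀ W : Fin n → UMat (Fin 2), rowMul y (amplitude (conj (tensorUnitary W))) P *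
        rowMul y (amplitude (conj (tensorUnitary W))) P' = ∑ T, ∑ T', y T * y T' *
          (amplitude (conj (tensorUnitary W)) T P * amplitude (conj (tensorUnitary W)) T' P') := by
      intro W
      rw [rowMul, rowMul, Finset.sum_mul_sum]
      exact Finset.sum_congr rfl fun T _ => Finset.sum_congr rfl fun T' _ => by ring
    have hc : ∀ T T', Integrable (fun W : Fin n → UMat (Fin 2) => y T * y T' *
        (amplitude (conj (tensorUnitary W)) T P * amplitude (conj (tensorUnitary W)) T' P')) ν :=
      fun T T' => integrable_of_continuous (continuous_const.mul
        (((continuous_conj_amplitude T P).comp continuous_tensorUnitary).mul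
        ((continuous_conj_amplitude T' P').comp continuous_tensorUnitary)))
    simp only [e]
    rw [integral_finsetSum _ fun T _ => integrable_finsetSum _ fun T' _ => hc T T']
    rw [Finset.sum_eq_zero, zero_mul]
    intro T _
    rw [integral_finsetSum _ fun T' _ => hc T T']
    refine Finset.sum_eq_zero fun T' _ => ?_
    rw [integral_const_mul, integral_amplitude_mul_eq_zero hS h, mul_zero]

theorem layerAmp_eq {N : Mat2 →ₗ[ℂ] Mat2} (hN : IsChannel N) (U : UMat (Bits n))
    (P Q : PauliString n) : layerAmp N U P Q
      = ∑ R, amplitude (tensorPow N n) P R * amplitude (conj U) R Q :=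
  (isHermMap_tensorPow hN).amplitude_comp (isHermMap_sandwich _) P Q

theorem circuitLayers_succ {j : ℕ} (ω : Unitaries n (j + 1)) :
    circuitLayers N ω = layerAmp N (ω (Fin.last j).castSucc) ::
      circuitLayers N (L := j) fun i => ω i.castSucc := by
  rw [circuitLayers, layers_succ]
  rfl

theorem continuous_layerAmp (hN : IsChannel N) {X : Type} [TopologicalSpace X]
    {U : X → UMat (Bits n)} (hU : Continuous U) (P Q : PauliString n) :
    Continuous fun a => layerAmp N (U a) P Q := by
  simp only [layerAmp_eq hN]
  exact continuous_finsetSum _ fun R _ =>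
    continuous_const.mul ((continuous_conj_amplitude R Q).comp hU)

theorem continuous_eval {j : ℕ} (i : Fin j) :
    Continuous fun ω : Fin j → UMat (Bits n) => ω i := continuous_apply i

theorem continuous_tail (hN : IsChannel N) (r : PauliString n → ℝ) {j : ℕ} (b : ℕ)
    (P : PauliString n) : Continuous fun ω : Unitaries n j => tail r (circuitLayers N ω) b P := by
  induction j generalizing b P with
  | zero => exact continuous_const
  | succ j ih =>
    simp only [circuitLayers_succ, tail]
    refine continuous_finsetSum _ fun Q _ =>
      (continuous_layerAmp hN (continuous_eval _) P Q).mul ?_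
    exact (ih (b - weight P) Q).comp (continuous_pi fun i => continuous_apply _)

/-- The heart of the error bound, by induction on the number of noisy layers. The outermost unitary
is averaged first, supports decouple, and on support `A` the noise contributes `s ^ |A|` while the
remaining tail has budget `b - |A|`. -/
theorem tail_secondMoment_le [IsProbabilityMeasure S] (hS : IsOneDesign S) (hN : IsChannel N)
    (hs : contractionSq n S N ≤ 1) {ρ : Op n} (hρ : IsState ρ) {j : ℕ}
    (μ : Fin (j + 1) → Measure (UMat (Bits n))) [∀ i, IsProbabilityMeasure (μ i)]
    (hμ : ∀ i, RightInvariant S (μ i)) (b : ℕ) (x : PauliString n → ℝ) :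
    ∫ ω : Unitaries n j, (∑ P, rowMul x (amplitude (conj (ω (Fin.last j)))) P *
        tail (fun P => expval (pauliOp P) ρ) (circuitLayers N ω) b P) ^ 2 ∂Measure.pi μ
      ≤ contractionSq n S N ^ b * ∑ P, x P ^ 2 := by
  set s := contractionSq n S N with hs_def
  have hs0 : 0 ≤ s := contractionSq_nonneg
  set r : PauliString n → ℝ := fun P => expval (pauliOp P) ρ
  induction j generalizing b x with
  | zero =>
    refine integral_last_layer_le (S := S) μ (hμ _) (G := fun _ P => if b = 0 then r P else 0)
      (fun P => continuous_const) (fun y => ?_) x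
    simp only [integral_const, smul_eq_mul, probReal_univ, one_mul, ← sq_sum_eq]
    -- No noisy layer is left. If the budget is exhausted the state is met through the Frobenius
    -- norm; otherwise the path is too light to belong to the tail.
    by_cases hb : b = 0
    · simp only [hb, if_true, pow_zero, one_mul]
      exact integral_expval_sq_le hS hρ y
    · simp only [hb, if_false, mul_zero, Finset.sum_const_zero, ne_eq, OfNat.ofNat_ne_zero,
        not_false_eq_true, zero_pow, integral_zero]
      exact mul_nonneg (pow_nonneg hs0 _) (Finset.sum_nonneg fun P _ => sq_nonneg _)
  | succ j ih =>
    simp only [circuitLayers_succ]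
    refine integral_last_layer_le (S := S) μ (hμ _) (G := fun ω P =>
      tail r (layerAmp N (ω (Fin.last j)) :: circuitLayers N ω) b P) (fun P => ?_) (fun y => ?_) x
    · exact continuous_finsetSum _ fun Q _ =>
        (continuous_layerAmp hN (continuous_eval _) P Q).mul (continuous_tail hN r _ Q)
    rw [integral_decouple hS, ← sum_part_sq y, Finset.mul_sum]
    refine Finset.sum_le_sum fun A _ => ?_
    have step : ∀ W : Fin n → UMat (Fin 2),
        ∑ P, ∑ P', rowMul (part A y) (amplitude (conj (tensorUnitary W))) P *
          rowMul (part A y) (amplitude (conj (tensorUnitary W))) P' *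
          (∫ ω, tail r (layerAmp N (ω (Fin.last j)) :: circuitLayers N ω) b P *
            tail r (layerAmp N (ω (Fin.last j)) :: circuitLayers N ω) b P'
            ∂Measure.pi fun i => μ i.castSucc)
        ≤ s ^ (b - A.card) * ∑ P, rowMul (rowMul (part A y) (amplitude (conj (tensorUnitary W))))
          (amplitude (tensorPow N n)) P ^ 2 := by
      intro W
      rw [sum_mul_integral_mul]
      -- For fixed `W` the induction hypothesis is used with the next circuit unitary as outermost
      -- layer, with the vector already acted on by the noise, and with the budget reduced by `|A|`,
      -- which is the same for all strings of support `A`.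
      · refine le_trans (le_of_eq ?_) (ih (fun i => μ i.castSucc) (fun i => hμ _) (b - A.card) _)
        refine integral_congr_ae (Filter.Eventually.of_forall fun ω => ?_)
        dsimp only
        congr 1
        simp only [tail, rowMul_part]
        set v := rowMul y (amplitude (conj (tensorUnitary W)))
        have e : ∀ P, part A v P * ∑ Q, layerAmp N (ω (Fin.last j)) P Q *
              tail r (circuitLayers N ω) (b - weight P) Q
            = ∑ Q, ∑ R, part A v P * amplitude (tensorPow N n) P R *
              amplitude (conj (ω (Fin.last j))) R Q *
                tail r (circuitLayers N ω) (b - A.card) Q := by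
          intro P
          rw [Finset.mul_sum]
          refine Finset.sum_congr rfl fun Q _ => ?_
          rw [layerAmp_eq hN, Finset.sum_mul, Finset.mul_sum]
          refine Finset.sum_congr rfl fun R _ => ?_
          by_cases h : supp P = A
          · rw [weight, h]; ring
          · rw [part, if_neg h]; ring
        simp only [e]
        rw [Finset.sum_comm]
        refine Finset.sum_congr rfl fun Q _ => ?_
        rw [Finset.sum_comm]
        simp only [rowMul, Finset.sum_mul]
      · intro P
        exact continuous_finsetSum _ fun Q _ =>
          (continuous_layerAmp hN (continuous_eval _) P Q).mul (continuous_tail hN r _ Q)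
    calc _ ≤ ∫ W, s ^ (b - A.card) * ∑ P, rowMul (rowMul (part A y)
            (amplitude (conj (tensorUnitary W)))) (amplitude (tensorPow N n)) P ^ 2
            ∂(Measure.pi fun _ : Fin n => S) := by
          refine integral_mono (integrable_of_continuous (continuous_finsetSum _ fun P _ =>
            continuous_finsetSum _ fun P' _ => ((continuous_rowMul_tensorUnitary _ P).mul
            (continuous_rowMul_tensorUnitary _ P')).mul continuous_const))
            (integrable_of_continuous (continuous_const.mul (continuous_finsetSum _ fun P _ =>
              (continuous_rowMul_rowMul _ _ P).pow 2))) step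
      _ ≤ s ^ (b - A.card) * (s ^ A.card * ∑ P, part A y P ^ 2) := by
          rw [integral_const_mul]
          exact mul_le_mul_of_nonneg_left (integral_noise_sq_le hN A y) (pow_nonneg hs0 _)
      _ ≤ s ^ b * ∑ P, part A y P ^ 2 := by
          rw [← mul_assoc, ← pow_add]
          -- Subtraction is truncated, so `(b - |A|) + |A|` may exceed `b`; here `s ≤ 1` is needed.
          exact mul_le_mul_of_nonneg_right (pow_le_pow_of_le_one hs0 hs (by omega))
            (Finset.sum_nonneg fun P _ => sq_nonneg _)

end SecondMoment

/-! ## The failure probability -/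

section Failure

variable {n L c : ℕ}

/-- Chebyshev's inequality: the failure probability is at most the second moment divided by `ε²
‖O‖²`, hence at most `q ^ k / ε²`. -/
theorem law_failure_le (E : NoisyEnsemble n L c) (hL : 1 ≤ L) {q : ℝ} (hq : q ≤ 1)
    (hE : contractionSq n E.single E.noise ≤ q)
    {ρ : Op n} (hρ : IsState ρ) {O : Op n} (hO : O.IsHermitian) {k : ℕ} {ε δ : ℝ} (hε : 0 < ε)
    (hk : q ^ k ≤ ε ^ 2 * δ) :
    E.law (failure k E.noise O ρ ε) ≤ ENNReal.ofReal δ := by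
  have := E.single_prob
  have := E.layer_prob
  have : IsProbabilityMeasure E.law := by unfold NoisyEnsemble.law; infer_instance
  set r : PauliString n → ℝ := fun P => expval (pauliOp P) ρ
  set x := pauliCoeff O
  set F : Unitaries n L → ℝ := fun ω => ∑ P, rowMul x (amplitude (conj (ω (Fin.last L)))) P *
        tail r (circuitLayers E.noise ω) k P with hF
  have hFc : Continuous F := continuous_finsetSum _ fun P _ =>
    (continuous_rowMul_conj (continuous_eval _) x P).mul (continuous_tail E.noise_channel r k P)
  have hmom : ∫ ω, F ω ^ 2 ∂E.law ≤ (ε ^ 2 * δ) * ∑ P, x P ^ 2 := by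
    refine (tail_secondMoment_le E.single_design E.noise_channel (hE.trans hq) hρ E.layer
      E.layer_unbiased k x).trans (mul_le_mul_of_nonneg_right ?_
      (Finset.sum_nonneg fun P _ => sq_nonneg _))
    exact (pow_le_pow_left₀ contractionSq_nonneg hE k).trans hk
  have hfrob : frobSq O = ∑ P, x P ^ 2 := frobSq_eq_sum hO
  -- The final layer is a product of single-qubit gates only almost surely, so the formula for the
  -- error holds outside a null set.
  have hfin : ∀ᵐ ω ∂E.law, ∃ W : Fin n → UMat (Fin 2), tensorU W = (ω (Fin.last L) : Op n) :=
    (MeasureTheory.Measure.quasiMeasurePreserving_eval (μ := E.layer) (Fin.last L)).ae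
      E.final_product
  have hsub : failure k E.noise O ρ ε ≤ᵐ[E.law] {ω | ε * frob O < |F ω|} := by
    filter_upwards [hfin] with ω hω h
    obtain ⟨W, hW⟩ := hω
    have h : ε * frob O < |truncatedEstimate k E.noise ω O ρ - expval O (evolve E.noise ω ρ)| := h
    rw [estimate_sub_exact E.noise_channel hL hW k hO hρ.1.1, abs_neg] at h
    exact h
  refine (measure_mono_ae hsub).trans ?_
  -- Chebyshev would divide by zero for the zero observable; its error vanishes identically.
  by_cases hO0 : ∑ P, x P ^ 2 = 0
  · have h0 : ∀ ω, F ω = 0 := by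
      have hx : ∀ P, x P = 0 := fun P => by
        have := (Finset.sum_eq_zero_iff_of_nonneg fun P _ => sq_nonneg (x P)).1 hO0 P
          (Finset.mem_univ P)
        simpa using this
      intro ω
      simp [hF, rowMul, hx]
    simp [h0, frob, hfrob, hO0]
  have hpos : 0 < ∑ P, x P ^ 2 :=
    lt_of_le_of_ne (Finset.sum_nonneg fun P _ => sq_nonneg _) (Ne.symm hO0)
  have ha : 0 < ε ^ 2 * ∑ P, x P ^ 2 := mul_pos (pow_pos hε 2) hpos
  have hsub2 : {ω | ε * frob O < |F ω|} ⊆ {ω | ε ^ 2 * ∑ P, x P ^ 2 ≤ F ω ^ 2} := by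
    intro ω hω
    simp only [Set.mem_ofPred_eq] at hω ⊢
    rw [← sq_abs (F ω), ← hfrob]
    have h1 : frobSq O = frob O ^ 2 := by
      rw [frob, Real.sq_sqrt]; rw [hfrob]; exact hpos.le
    rw [h1, ← mul_pow]
    exact pow_le_pow_left₀ (mul_nonneg hε.le (Real.sqrt_nonneg _)) hω.le 2
  refine (measure_mono hsub2).trans ?_
  have hM := mul_meas_ge_le_integral_of_nonneg (μ := E.law) (f := fun ω => F ω ^ 2)
    (Filter.Eventually.of_forall fun ω => sq_nonneg _) (integrable_of_continuous (hFc.pow 2))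
    (ε ^ 2 * ∑ P, x P ^ 2)
  rw [← ENNReal.ofReal_toReal (measure_ne_top E.law _)]
  refine ENNReal.ofReal_le_ofReal ?_
  have h2 := hM.trans hmom
  have h3 : (ε ^ 2 * ∑ P, x P ^ 2) * E.law.real {ω | ε ^ 2 * ∑ P, x P ^ 2 ≤ F ω ^ 2}
      ≤ (ε ^ 2 * ∑ P, x P ^ 2) * δ := h2.trans (le_of_eq (by ring))
  exact le_of_mul_le_mul_left h3 ha

theorem contractionSq_le_of_rate (E : NoisyEnsemble n L c) {q : ℝ} (hq : 0 ≤ q)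
    (h : 1 - q ≤ E.rate) : contractionSq n E.single E.noise ≤ q ^ 2 := by
  rw [NoisyEnsemble.rate] at h
  exact (Real.sqrt_le_left hq).1 (by linarith)

end Failure

/-! ## Propagation of Pauli terms by local instructions -/

section Instructions

variable {n : ℕ}

/-- A linear map on coefficient vectors that acts on `m` qubits by a table. -/
structure Instr (n : ℕ) where
  m : ℕ
  qs : Fin m ↪ Fin n
  tab : Kernel m

/-- A Pauli string with a coefficient and a remaining weight budget. -/
abbrev Term (n : ℕ) := PauliString n × ℝ × ℕ

/-- The labels of `P` on the qubits of the instruction. -/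
def Instr.labels (g : Instr n) (P : PauliString n) : PauliString g.m := fun a => P (g.qs a)

/-- The nonzero terms into which an instruction splits a term. -/
def Instr.step (g : Instr n) (τ : Term n) : List (Term n) :=
  (Finset.univ : Finset (PauliString g.m)).toList.flatMap fun v =>
    if τ.2.1 * g.tab (g.labels τ.1) v ≠ 0 then
      [(Function.extend g.qs v τ.1, τ.2.1 * g.tab (g.labels τ.1) v, τ.2.2)] else []

def run (I : List (Instr n)) (l : List (Term n)) : List (Term n) :=
  I.foldl (fun l g => l.flatMap g.step) l

/-- The action of an instruction on functions of Pauli strings. -/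
def Instr.act (g : Instr n) (h : PauliString n → ℝ) (P : PauliString n) : ℝ :=
  ∑ v, g.tab (g.labels P) v * h (Function.extend g.qs v P)

def actAll (I : List (Instr n)) (h : PauliString n → ℝ) : PauliString n → ℝ :=
  I.foldr Instr.act h

/-- The sum of the values of `h` over a list of terms. -/
def total (h : PauliString n → ℕ → ℝ) (l : List (Term n)) : ℝ :=
  (l.map fun τ => τ.2.1 * h τ.1 τ.2.2).sum

variable {h : PauliString n → ℕ → ℝ}

theorem total_nil : total h [] = 0 := rfl

theorem total_cons (τ : Term n) (l : List (Term n)) :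
    total h (τ :: l) = τ.2.1 * h τ.1 τ.2.2 + total h l := by simp [total]

theorem total_append (l l' : List (Term n)) : total h (l ++ l') = total h l + total h l' := by
  simp [total]

theorem total_flatMap {f : Term n → List (Term n)} {h' : PauliString n → ℕ → ℝ} (l : List (Term n))
    (hf : ∀ τ ∈ l, total h (f τ) = τ.2.1 * h' τ.1 τ.2.2) :
    total h (l.flatMap f) = total h' l := by
  induction l with
  | nil => rfl
  | cons τ l ih =>
    rw [List.flatMap_cons, total_append, total_cons, hf τ (by simp),
      ih fun τ hτ => hf τ (by simp [hτ])]

theorem total_step (g : Instr n) (τ : Term n) :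
    total h (g.step τ) = τ.2.1 * g.act (fun P => h P τ.2.2) τ.1 := by
  have : ∀ l : List (PauliString g.m), total h (l.flatMap fun v =>
      if τ.2.1 * g.tab (g.labels τ.1) v ≠ 0 then
        [(Function.extend g.qs v τ.1, τ.2.1 * g.tab (g.labels τ.1) v, τ.2.2)] else [])
      = (l.map fun v => τ.2.1 * (g.tab (g.labels τ.1) v *
          h (Function.extend g.qs v τ.1) τ.2.2)).sum := by
    intro l
    induction l with
    | nil => rfl
    | cons v l ih =>
      rw [List.flatMap_cons, total_append, ih, List.map_cons, List.sum_cons]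
      congr 1
      split_ifs with h0
      · simp [total, mul_assoc]
      · rw [not_not] at h0
        rw [total_nil, ← mul_assoc, h0, zero_mul]
  rw [Instr.step, this, Finset.sum_map_toList, ← Finset.mul_sum]
  rfl

/-- Duality: pushing terms through instructions and then evaluating `h` equals evaluating the
pulled-back function on the initial terms. Correctness of the list algorithm is thereby reduced to
computing `actAll`. -/
theorem total_run (I : List (Instr n)) (l : List (Term n)) :
    total h (run I l) = total (fun P b => actAll I (fun P => h P b) P) l := by
  induction I generalizing l with
  | nil => rfl
  | cons g I ih =>
    rw [run, List.foldl_cons]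
    refine (ih _).trans ?_
    exact total_flatMap l fun τ _ => total_step g τ

theorem run_append_list (I : List (Instr n)) (l l' : List (Term n)) :
    run I (l ++ l') = run I l ++ run I l' := by
  induction I generalizing l l' with
  | nil => rfl
  | cons g I ih =>
    simp only [run, List.foldl_cons, List.flatMap_append]
    exact ih _ _

theorem run_eq_flatMap (I : List (Instr n)) (l : List (Term n)) :
    run I l = l.flatMap fun τ => run I [τ] := by
  induction l with
  | nil =>
    induction I with
    | nil => rfl
    | cons g I ih => exact ih
  | cons τ l ih => rw [List.flatMap_cons, ← ih, ← run_append_list]; rfl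

/-! ### Counting terms -/

/-- Instructions on at most `c` qubits each, disjoint, and that fix the identity. -/
structure Tame (c : ℕ) (I : List (Instr n)) : Prop where
  arity_le : ∀ g ∈ I, g.m ≤ c
  fixes : ∀ g ∈ I, ∀ v, v ≠ 0 → g.tab 0 v = 0
  disjoint : I.Pairwise fun g g' => ∀ a a', g.qs a ≠ g'.qs a'

theorem Tame.sublist {c : ℕ} {I J : List (Instr n)} (h : Tame c I) (hJ : J.Sublist I) : Tame c J :=
  ⟨fun g hg => h.arity_le g (hJ.subset hg), fun g hg => h.fixes g (hJ.subset hg),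
    h.disjoint.sublist hJ⟩

/-- The number of qubits in the support of `P` on which some instruction acts. -/
def touched (I : List (Instr n)) (P : PauliString n) : ℕ :=
  open Classical in ((supp P).filter fun i => ∃ g ∈ I, ∃ a, g.qs a = i).card

theorem touched_le (I : List (Instr n)) (P : PauliString n) : touched I P ≤ weight P :=
  Finset.card_filter_le _ _

theorem mem_supp {P : PauliString n} {i : Fin n} : i ∈ supp P ↔ P i ≠ 0 := by simp [supp]

theorem mem_step {g : Instr n} {τ τ' : Term n} (h : τ' ∈ g.step τ) :
    ∃ v, τ'.1 = Function.extend g.qs v τ.1 ∧ g.tab (g.labels τ.1) v ≠ 0 ∧ τ'.2.2 = τ.2.2 := by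
  rw [Instr.step, List.mem_flatMap] at h
  obtain ⟨v, -, h⟩ := h
  split_ifs at h with h0
  · rw [List.mem_singleton] at h
    subst h
    exact ⟨v, rfl, right_ne_zero_of_mul h0, rfl⟩
  · simp at h

theorem length_flatMap_le {α β : Type} (l : List α) (f : α → List β) {B : ℕ}
    (hf : ∀ a ∈ l, (f a).length ≤ B) : (l.flatMap f).length ≤ l.length * B := by
  induction l with
  | nil => simp
  | cons a l ih =>
    rw [List.flatMap_cons, List.length_append, List.length_cons, add_mul, one_mul, add_comm]
    exact add_le_add (ih fun a ha => hf a (by simp [ha])) (hf a (by simp))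

theorem length_step_le (g : Instr n) (τ : Term n) : (g.step τ).length ≤ 4 ^ g.m := by
  refine (length_flatMap_le _ _ (B := 1) fun v _ => ?_).trans (by simp)
  split_ifs <;> simp

/-- If the labels seen by the instruction are all the identity, only `v = 0` has a nonzero table
entry. As terms with coefficient zero are dropped, nothing branches. -/
theorem step_eq_of_untouched {g : Instr n} (hg : ∀ v, v ≠ 0 → g.tab 0 v = 0) {τ : Term n}
    (h : g.labels τ.1 = 0) : (g.step τ).length ≤ 1 ∧ ∀ τ' ∈ g.step τ, τ'.1 = τ.1 := by
  constructor
  · rw [Instr.step, h]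
    have : ∀ l : List (PauliString g.m), l.Nodup → (l.flatMap fun v =>
      if τ.2.1 * g.tab 0 v ≠ 0 then
        [(Function.extend g.qs v τ.1, τ.2.1 * g.tab 0 v, τ.2.2)] else []).length
        ≤ if 0 ∈ l then 1 else 0 := by
      intro l hl
      induction l with
      | nil => simp
      | cons v l ih =>
        rw [List.nodup_cons] at hl
        have := ih hl.2
        rw [List.flatMap_cons, List.length_append]
        by_cases hv : v = 0
        · subst hv
          rw [if_neg hl.1] at this
          simp only [List.mem_cons, true_or, if_true]
          have h1 : (if τ.2.1 * g.tab 0 0 ≠ 0 then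
              [(Function.extend g.qs 0 τ.1, τ.2.1 * g.tab 0 0, τ.2.2)] else []).length ≤ 1 := by
            split_ifs <;> simp
          exact add_le_add h1 this
        · have hv' : (0 : PauliString g.m) ≠ v := fun e => hv e.symm
          simp only [hg v hv, mul_zero, ne_eq, not_true_eq_false, if_false, List.length_nil,
            zero_add, List.mem_cons, hv', false_or]
          exact this
    refine (this _ (Finset.nodup_toList _)).trans ?_
    split_ifs <;> simp
  · intro τ' hτ'
    obtain ⟨v, h1, h2, -⟩ := mem_step hτ'
    rw [h] at h2
    have hv : v = 0 := by_contra fun hv => h2 (hg v hv)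
    rw [h1, hv]
    funext i
    by_cases hi : ∃ a, g.qs a = i
    · obtain ⟨a, rfl⟩ := hi
      rw [g.qs.injective.extend_apply]
      exact (congr_fun h a).symm
    · rw [Function.extend_apply' _ _ _ hi]

theorem weight_extend_le {m : ℕ} (q : Fin m ↪ Fin n) (v : PauliString m) (P : PauliString n) :
    weight (Function.extend q v P) ≤ weight P + m := by
  have : supp (Function.extend q v P) ⊆ supp P ∪ Finset.univ.map q := by
    intro i hi
    rw [mem_supp] at hi
    by_cases h : ∃ a, q a = i
    · simp [h]
    · rw [Function.extend_apply' _ _ _ h] at hi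
      simp [mem_supp, hi]
  refine (Finset.card_le_card this).trans ((Finset.card_union_le _ _).trans ?_)
  simp [weight]

/-- An instruction that meets the support creates at most `4 ^ c` terms, adds at most `c` to the
weight, and uses up at least one touched qubit, since later instructions avoid its qubits. An
instruction that misses the support changes no string. -/
theorem run_single_bound {c : ℕ} {I : List (Instr n)} (hI : Tame c I) (τ : Term n) :
    (run I [τ]).length ≤ (4 ^ c) ^ touched I τ.1 ∧
      ∀ τ' ∈ run I [τ], weight τ'.1 ≤ weight τ.1 + c * touched I τ.1 ∧ τ'.2.2 = τ.2.2 := by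
  induction I generalizing τ with
  | nil =>
    refine ⟨by simp [run, touched], fun τ' hτ' => ?_⟩
    rw [run, List.foldl_nil, List.mem_singleton] at hτ'
    subst hτ'
    exact ⟨Nat.le_add_right _ _, rfl⟩
  | cons g I ih =>
    have hI' : Tame c I := hI.sublist (List.sublist_cons_self g I)
    have hrun : run (g :: I) [τ] = (g.step τ).flatMap fun τ' => run I [τ'] := by
      rw [← run_eq_flatMap, run, List.foldl_cons]
      simp [run]
    -- By disjointness the labels changed by `g` are invisible to the remaining instructions.
    have hsame : ∀ τ' ∈ g.step τ, touched I τ'.1 = touched I τ.1 := by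
      intro τ' hτ'
      obtain ⟨v, h1, -, -⟩ := mem_step hτ'
      unfold touched
      congr 1
      ext i
      simp only [Finset.mem_filter, mem_supp, and_congr_left_iff]
      rintro ⟨g', hg', a', rfl⟩
      rw [h1, Function.extend_apply' _ _ _]
      rintro ⟨a, ha⟩
      exact (List.pairwise_cons.1 hI.disjoint).1 g' hg' a a' ha
    have hmono : touched I τ.1 ≤ touched (g :: I) τ.1 := by
      refine Finset.card_le_card fun i hi => ?_
      simp only [Finset.mem_filter] at hi ⊢
      obtain ⟨hi, g', hg', ha⟩ := hi
      exact ⟨hi, g', by simp [hg'], ha⟩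
    rw [hrun]
    by_cases hg : g.labels τ.1 = 0
    · obtain ⟨h1, h2⟩ := step_eq_of_untouched (hI.fixes g (by simp)) hg
      constructor
      · refine (length_flatMap_le _ _ (B := (4 ^ c) ^ touched (g :: I) τ.1)
          fun τ' hτ' => ?_).trans ((Nat.mul_le_mul_right _ h1).trans (by rw [one_mul]))
        exact ((ih hI' τ').1.trans (by rw [hsame τ' hτ'])).trans
          (Nat.pow_le_pow_right (by positivity) hmono)
      · intro τ'' hτ''
        obtain ⟨τ', hτ', hmem⟩ := List.mem_flatMap.1 hτ''
        obtain ⟨-, -, -, h3⟩ := mem_step hτ'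
        obtain ⟨h4, h5⟩ := (ih hI' τ').2 τ'' hmem
        rw [hsame τ' hτ', h2 τ' hτ'] at h4
        exact ⟨h4.trans (Nat.add_le_add_left (Nat.mul_le_mul_left _ hmono) _), h5.trans h3⟩
    · have hlt : touched I τ.1 + 1 ≤ touched (g :: I) τ.1 := by
        obtain ⟨a, ha⟩ := Function.ne_iff.1 hg
        refine Finset.card_lt_card ⟨fun i hi => ?_, fun hsub => ?_⟩
        · simp only [Finset.mem_filter] at hi ⊢
          obtain ⟨hi, g', hg', ha⟩ := hi
          exact ⟨hi, g', by simp [hg'], ha⟩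
        · have : g.qs a ∈ (supp τ.1).filter fun i => ∃ g' ∈ g :: I, ∃ a, g'.qs a = i := by
            simp only [Finset.mem_filter, mem_supp]
            exact ⟨ha, g, by simp, a, rfl⟩
          have := hsub (by convert this)
          simp only [Finset.mem_filter] at this
          obtain ⟨-, g', hg', a', ha'⟩ := this
          exact (List.pairwise_cons.1 hI.disjoint).1 g' hg' a a' ha'.symm
      have hgc := hI.arity_le g (by simp)
      constructor
      · refine (length_flatMap_le _ _ (B := (4 ^ c) ^ touched I τ.1) fun τ' hτ' => ?_).trans ?_
        · exact (ih hI' τ').1.trans (by rw [hsame τ' hτ'])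
        · calc _ ≤ 4 ^ c * (4 ^ c) ^ touched I τ.1 := Nat.mul_le_mul_right _
                ((length_step_le g τ).trans (Nat.pow_le_pow_right (by omega) hgc))
            _ = (4 ^ c) ^ (touched I τ.1 + 1) := by rw [pow_succ, mul_comm]
            _ ≤ _ := Nat.pow_le_pow_right (by positivity) hlt
      · intro τ'' hτ''
        obtain ⟨τ', hτ', hmem⟩ := List.mem_flatMap.1 hτ''
        obtain ⟨v, h1, -, h3⟩ := mem_step hτ'
        obtain ⟨h4, h5⟩ := (ih hI' τ').2 τ'' hmem
        rw [hsame τ' hτ', h1] at h4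
        refine ⟨?_, h5.trans h3⟩
        have h6 := weight_extend_le g.qs v τ.1
        have h7 : c * (touched I τ.1 + 1) ≤ c * touched (g :: I) τ.1 := Nat.mul_le_mul_left _ hlt
        rw [mul_add, mul_one] at h7
        omega

theorem length_run_le {c W : ℕ} {I : List (Instr n)} (hI : Tame c I) {l : List (Term n)}
    (hl : ∀ τ ∈ l, weight τ.1 ≤ W) : (run I l).length ≤ l.length * (4 ^ c) ^ W := by
  rw [run_eq_flatMap]
  exact length_flatMap_le _ _ fun τ hτ => (run_single_bound hI τ).1.trans
    (Nat.pow_le_pow_right (by positivity) ((touched_le I τ.1).trans (hl τ hτ)))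

theorem mem_run {c : ℕ} {I : List (Instr n)} (hI : Tame c I) {l : List (Term n)} {τ' : Term n}
    (h : τ' ∈ run I l) : ∃ τ ∈ l, weight τ'.1 ≤ (c + 1) * weight τ.1 ∧ τ'.2.2 = τ.2.2 := by
  rw [run_eq_flatMap, List.mem_flatMap] at h
  obtain ⟨τ, hτ, h⟩ := h
  obtain ⟨h1, h2⟩ := (run_single_bound hI τ).2 τ' h
  refine ⟨τ, hτ, h1.trans ?_, h2⟩
  have := Nat.mul_le_mul_left c (touched_le I τ.1)
  rw [add_mul, one_mul]
  omega

end Instructions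

/-! ## Instructions for noise, single-qubit gates and layers -/

section Layers

variable {n c : ℕ}

def siteInstr (i : Fin n) (t : Fin 4 → Fin 4 → ℝ) : Instr n :=
  ⟨1, ⟨fun _ => i, fun _ _ _ => Subsingleton.elim _ _⟩, fun p v => t (p 0) (v 0)⟩

/-- One instruction per qubit. -/
def siteInstrs (t : Fin n → Fin 4 → Fin 4 → ℝ) : List (Instr n) :=
  List.ofFn fun i => siteInstr i (t i)

def gateInstr (g : Gate n c) : Instr n :=
  ⟨g.arity, g.qubit, amplitude (sandwich (g.mat : Op g.arity))⟩

/-- The transposed gate, for propagation in the opposite direction. -/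
def gateInstrT (g : Gate n c) : Instr n :=
  ⟨g.arity, g.qubit, fun p v => amplitude (sandwich (g.mat : Op g.arity)) v p⟩

theorem extend_single (i : Fin n) (v : PauliString 1) (P : PauliString n) :
    Function.extend (fun _ : Fin 1 => i) v P = Function.update P i (v 0) := by
  have hinj : Function.Injective fun _ : Fin 1 => i := fun _ _ _ => Subsingleton.elim _ _
  funext j
  by_cases h : j = i
  · subst h
    rw [Function.update_self]
    exact hinj.extend_apply v P 0
  · rw [Function.update_of_ne h, Function.extend_apply']
    rintro ⟨a, ha⟩
    exact h ha.symm

theorem act_siteInstr (i : Fin n) (t : Fin 4 → Fin 4 → ℝ) (h : PauliString n → ℝ)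
    (P : PauliString n) :
    (siteInstr i t).act h P = ∑ v, t (P i) v * h (Function.update P i v) := by
  refine Fintype.sum_equiv (Equiv.funUnique (Fin 1) (Fin 4)) _ _ fun v => ?_
  exact congrArg (fun Q => t (P i) (v 0) * h Q) (extend_single i v P)

theorem actAll_siteInstrs (t : Fin n → Fin 4 → Fin 4 → ℝ) (h : PauliString n → ℝ)
    (P : PauliString n) :
    actAll (siteInstrs t) h P = ∑ Q, (∏ i, t i (P i) (Q i)) * h Q := by
  -- Induction over the qubits already treated; on the others the kernel is still the identity.
  have key : ∀ l : List (Fin n), l.Nodup → ∀ P : PauliString n,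
      actAll (l.map fun i => siteInstr i (t i)) h P
      = ∑ Q, (∏ i, if i ∈ l then t i (P i) (Q i) else if P i = Q i then 1 else 0) * h Q := by
    intro l hl
    induction l with
    | nil =>
      intro P
      have : ∀ Q : PauliString n, (∏ i, if P i = Q i then (1 : ℝ) else 0)
          = if P = Q then 1 else 0 := by
        intro Q
        rw [Finset.prod_ite_zero]
        simp [funext_iff]
      simp [actAll, this]
    | cons i l ih =>
      intro P
      rw [List.nodup_cons] at hl
      have ih := ih hl.2
      rw [List.map_cons, actAll, List.foldr_cons]
      change Instr.act _ (actAll _ h) P = _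
      rw [act_siteInstr]
      simp only [ih, Finset.mul_sum]
      rw [Finset.sum_comm]
      refine Finset.sum_congr rfl fun Q _ => ?_
      simp only [← mul_assoc]
      rw [← Finset.sum_mul]
      congr 1
      have hrest : ∀ v, ∏ j, (if j ∈ l then t j (Function.update P i v j) (Q j) else
            if Function.update P i v j = Q j then 1 else 0)
          = (if v = Q i then 1 else 0) * ∏ j ∈ Finset.univ.erase i,
            if j ∈ i :: l then t j (P j) (Q j) else if P j = Q j then 1 else 0 := by
        intro v
        rw [← Finset.mul_prod_erase _ _ (Finset.mem_univ i), if_neg hl.1, Function.update_self]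
        congr 1
        refine Finset.prod_congr rfl fun j hj => ?_
        have hj : j ≠ i := Finset.ne_of_mem_erase hj
        simp [hj]
      rw [← Finset.mul_prod_erase _ _ (Finset.mem_univ i)]
      simp only [hrest]
      simp
  have := key (List.finRange n) (List.nodup_finRange n) P
  simp only [List.mem_finRange, if_true] at this
  rw [← this, siteInstrs, List.ofFn_eq_map]

theorem tame_siteInstrs {t : Fin n → Fin 4 → Fin 4 → ℝ} (ht : ∀ i v, v ≠ 0 → t i 0 v = 0) :
    Tame 1 (siteInstrs t) := by
  refine ⟨fun g hg => ?_, fun g hg v hv => ?_, ?_⟩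
  · obtain ⟨i, rfl⟩ := (List.mem_ofFn' _ _).1 hg
    exact le_rfl
  · obtain ⟨i, rfl⟩ := (List.mem_ofFn' _ _).1 hg
    refine ht i _ fun h0 => hv ?_
    have : ∀ u : PauliString 1, u 0 = 0 → u = 0 := fun u hu => by
      funext a
      rw [Subsingleton.elim a 0]
      exact hu
    exact this v h0
  · rw [siteInstrs, List.pairwise_ofFn]
    intro i j hij a a'
    exact hij.ne

theorem act_gateInstr (g : Gate n c) (h : PauliString n → ℝ) (P : PauliString n) :
    (gateInstr g).act h P = ∑ Q, amplitude (sandwich g.op) P Q * h Q := by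
  classical
  simp only [Gate.op_eq_embed, amplitude_embed, ite_mul, zero_mul]
  have := sum_ite_agree g.qubit P fun Q => amplitude (sandwich (g.mat : Op g.arity))
    (fun a => P (g.qubit a)) (fun a => Q (g.qubit a)) * h Q
  convert this.symm using 1
  simp only [g.qubit.injective.extend_apply]
  rfl

theorem act_gateInstrT (g : Gate n c) (h : PauliString n → ℝ) (P : PauliString n) :
    (gateInstrT g).act h P = ∑ Q, amplitude (sandwich g.op) Q P * h Q := by
  classical
  have hsymm : ∀ Q : PauliString n, (∀ i, i ∉ Set.range g.qubit → Q i = P i) ↔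
      ∀ i, i ∉ Set.range g.qubit → P i = Q i := fun Q => by simp only [eq_comm]
  simp only [Gate.op_eq_embed, amplitude_embed, ite_mul, zero_mul, hsymm]
  have := sum_ite_agree g.qubit P fun Q => amplitude (sandwich (g.mat : Op g.arity))
    (fun a => Q (g.qubit a)) (fun a => P (g.qubit a)) * h Q
  convert this.symm using 1
  simp only [g.qubit.injective.extend_apply]
  rfl

theorem actAll_gates (gs : List (Gate n c)) (h : PauliString n → ℝ) (P : PauliString n) :
    actAll (gs.map gateInstr) h P
      = ∑ Q, amplitude (sandwich (gs.map Gate.op).prod) P Q * h Q := by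
  induction gs generalizing P with
  | nil => simp [actAll, sandwich_one, amplitude_id]
  | cons g gs ih =>
    rw [List.map_cons, actAll, List.foldr_cons]
    change (gateInstr g).act (actAll _ h) P = _
    rw [act_gateInstr]
    simp only [ih, List.map_cons, List.prod_cons, sandwich_mul,
      (isHermMap_sandwich _).amplitude_comp (isHermMap_sandwich _), Finset.mul_sum, Finset.sum_mul]
    rw [Finset.sum_comm]
    exact Finset.sum_congr rfl fun Q _ => Finset.sum_congr rfl fun R _ => by ring

/-- Transposition reverses the order of a product of matrices, so the gates are traversed backwards.
-/
theorem actAll_gatesT (gs : List (Gate n c)) (h : PauliString n → ℝ) (P : PauliString n) :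
    actAll (gs.reverse.map gateInstrT) h P
      = ∑ Q, amplitude (sandwich (gs.map Gate.op).prod) Q P * h Q := by
  induction gs generalizing h P with
  | nil => simp [actAll, sandwich_one, amplitude_id]
  | cons g gs ih =>
    rw [List.reverse_cons, List.map_append, actAll, List.foldr_append]
    refine (ih _ P).trans ?_
    simp only [List.map_cons, List.map_nil, List.foldr_cons, List.foldr_nil, act_gateInstrT,
      List.prod_cons, sandwich_mul,
      (isHermMap_sandwich _).amplitude_comp (isHermMap_sandwich _), Finset.mul_sum, Finset.sum_mul]
    rw [Finset.sum_comm]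
    exact Finset.sum_congr rfl fun Q _ => Finset.sum_congr rfl fun R _ => by ring

theorem amplitude_conj_zero_left (U : UMat (Bits n)) (Q : PauliString n) :
    amplitude (conj U) 0 Q = if Q = 0 then 1 else 0 := by
  have hU : (U : Op n).conjTranspose * (U : Op n) = 1 := Unitary.coe_star_mul_self U
  have : amplitude (conj U) 0 Q = amplitude id 0 Q := by
    rw [amplitude, amplitude, pauliOp_zero, one_mul, one_mul, conj, Matrix.trace_mul_comm,
      ← mul_assoc, hU, one_mul, id]
  rw [this, amplitude_id]
  simp only [eq_comm]

theorem amplitude_conj_zero_right (U : UMat (Bits n)) (P : PauliString n) :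
    amplitude (conj U) P 0 = if P = 0 then 1 else 0 := by
  have hU : (U : Op n) * (U : Op n).conjTranspose = 1 := Unitary.coe_mul_star_self U
  have : amplitude (conj U) P 0 = amplitude id P 0 := by
    rw [amplitude, amplitude, pauliOp_zero, conj, mul_one, hU, id]
  rw [this, amplitude_id]

theorem tame_gates (ℓ : Layer n c) : Tame c (ℓ.gates.map gateInstr) := by
  refine ⟨fun g hg => ?_, fun g hg v hv => ?_, ?_⟩
  · obtain ⟨g, -, rfl⟩ := List.mem_map.1 hg
    exact g.arity_le
  · obtain ⟨g, -, rfl⟩ := List.mem_map.1 hg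
    exact (amplitude_conj_zero_left g.mat v).trans (if_neg hv)
  · rw [List.pairwise_map]
    exact ℓ.disjoint.imp fun {g g'} h a a' e =>
      Set.disjoint_left.1 h (Set.mem_range_self a) (Set.mem_range.2 ⟨a', e.symm⟩)

theorem tame_gatesT (ℓ : Layer n c) : Tame c (ℓ.gates.reverse.map gateInstrT) := by
  refine ⟨fun g hg => ?_, fun g hg v hv => ?_, ?_⟩
  · obtain ⟨g, -, rfl⟩ := List.mem_map.1 hg
    exact g.arity_le
  · obtain ⟨g, -, rfl⟩ := List.mem_map.1 hg
    exact (amplitude_conj_zero_right g.mat v).trans (if_neg hv)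
  · rw [List.pairwise_map, List.pairwise_reverse]
    exact ℓ.disjoint.imp fun {g g'} h a a' e =>
      Set.disjoint_left.1 h (Set.mem_range_self a') (Set.mem_range.2 ⟨a, e⟩)

/-- Every gate has at least one qubit and the gates do not overlap, so their first qubits are
distinct. -/
theorem length_gates_le (ℓ : Layer n c) : ℓ.gates.length ≤ n := by
  have hnd : (ℓ.gates.map fun g => g.qubit ⟨0, g.arity_pos⟩).Nodup := by
    rw [List.Nodup, List.pairwise_map]
    refine ℓ.disjoint.imp fun {g g'} h e => ?_
    refine Set.disjoint_left.1 h (Set.mem_range_self ⟨0, g.arity_pos⟩) ?_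
    exact Set.mem_range.2 ⟨_, Eq.symm e⟩
  simpa using hnd.length_le_card

end Layers

/-! ## Backward and forward propagation through layers -/

section Propagation

variable {n c : ℕ}

/-- The transition amplitudes of a layer followed by noise with the amplitudes `t`. -/
def layerKernel (t : Fin 4 → Fin 4 → ℝ) (ℓ : Layer n c) : Kernel n := fun P Q =>
  ∑ R, (∏ i, t (P i) (R i)) * amplitude (sandwich ℓ.op) R Q

def backInstrs (t : Fin 4 → Fin 4 → ℝ) (ℓ : Layer n c) : List (Instr n) :=
  siteInstrs (fun _ => t) ++ ℓ.gates.map gateInstr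

def backStep (t : Fin 4 → Fin 4 → ℝ) (ℓ : Layer n c) (τ : Term n) : List (Term n) :=
  if τ.2.2 - weight τ.1 = 0 then [] else
    run (backInstrs t ℓ) [(τ.1, τ.2.1, τ.2.2 - weight τ.1)]

def backTerms (t : Fin 4 → Fin 4 → ℝ) (ls : List (Layer n c)) (l : List (Term n)) :
    List (Term n) :=
  ls.foldl (fun l ℓ => l.flatMap (backStep t ℓ)) l

def fwInstrs (t : Fin 4 → Fin 4 → ℝ) (ℓ : Layer n c) : List (Instr n) :=
  ℓ.gates.reverse.map gateInstrT ++ siteInstrs (fun _ a b => t b a)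

/-- Pays the weight of a term from its budget; terms of weight at most `θ` are dropped. -/
def charge (θ : ℕ) (τ : Term n) : List (Term n) :=
  if θ < weight τ.1 then
    if τ.2.2 - weight τ.1 = 0 then [] else [(τ.1, τ.2.1, τ.2.2 - weight τ.1)]
  else []

def fwStep (θ : ℕ) (t : Fin 4 → Fin 4 → ℝ) (ℓ : Layer n c) (τ : Term n) : List (Term n) :=
  (run (fwInstrs t ℓ) [τ]).flatMap (charge θ)

def fwTerms (θ : ℕ) (t : Fin 4 → Fin 4 → ℝ) (ls : List (Layer n c)) (l : List (Term n)) :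
    List (Term n) :=
  ls.foldl (fun l ℓ => l.flatMap (fwStep θ t ℓ)) l

/-- Sums over the paths from `P` towards the observable, all of weight above `θ`. -/
def fw (θ : ℕ) (h : PauliString n → ℕ → ℝ) : List (Kernel n) → PauliString n → ℕ → ℝ
  | [], P, b => h P b
  | A :: F, P, b => ∑ P', A P' P * if θ < weight P' then fw θ h F P' (b - weight P') else 0

/-! ### Values -/

theorem actAll_append (I J : List (Instr n)) (h : PauliString n → ℝ) :
    actAll (I ++ J) h = actAll I (actAll J h) := by simp [actAll]

theorem actAll_backInstrs (t : Fin 4 → Fin 4 → ℝ) (ℓ : Layer n c) (h : PauliString n → ℝ)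
    (P : PauliString n) : actAll (backInstrs t ℓ) h P = ∑ Q, layerKernel t ℓ P Q * h Q := by
  rw [backInstrs, actAll_append, actAll_siteInstrs]
  simp only [actAll_gates, layerKernel, Finset.mul_sum, Finset.sum_mul]
  rw [Finset.sum_comm]
  exact Finset.sum_congr rfl fun Q _ => Finset.sum_congr rfl fun R _ => by
    rw [mul_assoc, Layer.op]

theorem actAll_fwInstrs (t : Fin 4 → Fin 4 → ℝ) (ℓ : Layer n c) (h : PauliString n → ℝ)
    (P : PauliString n) : actAll (fwInstrs t ℓ) h P = ∑ Q, layerKernel t ℓ Q P * h Q := by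
  rw [fwInstrs, actAll_append, actAll_gatesT]
  simp only [actAll_siteInstrs, layerKernel, Finset.mul_sum, Finset.sum_mul]
  rw [Finset.sum_comm]
  exact Finset.sum_congr rfl fun Q _ => Finset.sum_congr rfl fun R _ => by
    rw [Layer.op]; ring

theorem total_backTerms (t : Fin 4 → Fin 4 → ℝ) (r : PauliString n → ℝ) (ls : List (Layer n c))
    (l : List (Term n)) :
    total (fun P b => if b = 0 then 0 else r P) (backTerms t ls l)
      = total (fun P b => back r (ls.map (layerKernel t)) b P) l := by
  induction ls generalizing l with
  | nil => rfl
  | cons ℓ ls ih =>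
    rw [backTerms, List.foldl_cons]
    refine (ih _).trans (total_flatMap l fun τ _ => ?_)
    rw [List.map_cons, back, backStep]
    split_ifs with h
    · simp [h, back_zero, total_nil]
    · rw [total_run, total_cons, total_nil, add_zero, actAll_backInstrs]

theorem fw_zero {θ : ℕ} {h : PauliString n → ℕ → ℝ} (h0 : ∀ P, h P 0 = 0) (F : List (Kernel n))
    (P : PauliString n) : fw θ h F P 0 = 0 := by
  induction F generalizing P with
  | nil => exact h0 P
  | cons A F ih => simp [fw, ih]

/-- The algorithm drops a term as soon as its budget is exhausted. The condition `h P 0 = 0` makes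
this harmless. -/
theorem total_fwTerms (θ : ℕ) (t : Fin 4 → Fin 4 → ℝ) {h : PauliString n → ℕ → ℝ}
    (h0 : ∀ P, h P 0 = 0) (ls : List (Layer n c)) (l : List (Term n)) :
    total h (fwTerms θ t ls l) = total (fw θ h (ls.map (layerKernel t))) l := by
  induction ls generalizing l with
  | nil => rfl
  | cons ℓ ls ih =>
    rw [fwTerms, List.foldl_cons]
    refine (ih _).trans (total_flatMap l fun τ _ => ?_)
    rw [List.map_cons, fw, fwStep,
      total_flatMap (h' := fun P b => if θ < weight P then
        fw θ h (ls.map (layerKernel t)) P (b - weight P) else 0) _ fun τ' _ => ?_]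
    · rw [total_run, total_cons, total_nil, add_zero, actAll_fwInstrs]
    · rw [charge]
      split_ifs with h1 h2
      · simp [h2, fw_zero h0, total_nil]
      · rw [total_cons, total_nil, add_zero]
      · simp [total_nil]

/-! ### Splitting paths at the last layer of small weight -/

theorem fw_sub (θ : ℕ) (h : PauliString n → ℕ → ℝ) (s : ℕ) (F : List (Kernel n))
    (P : PauliString n) (b : ℕ) : fw θ (fun P b => h P (b - s)) F P b = fw θ h F P (b - s) := by
  induction F generalizing P b with
  | nil => rfl
  | cons A F ih =>
    simp only [fw, ih]
    exact Finset.sum_congr rfl fun Q _ => by rw [Nat.sub_right_comm]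

theorem fw_sum {ι : Type} [Fintype ι] (θ : ℕ) (a : ι → ℝ) (h : ι → PauliString n → ℕ → ℝ)
    (F : List (Kernel n)) (P : PauliString n) (b : ℕ) :
    fw θ (fun P b => ∑ q, a q * h q P b) F P b = ∑ q, a q * fw θ (h q) F P b := by
  induction F generalizing P b with
  | nil => rfl
  | cons A F ih =>
    simp only [fw, ih, Finset.mul_sum]
    rw [Finset.sum_comm]
    refine Finset.sum_congr rfl fun Q _ => ?_
    split_ifs
    · rw [Finset.mul_sum]
      exact Finset.sum_congr rfl fun q _ => by ring
    · simp

/-- Each layer of `F` charges at least `θ + 1`, so this budget is used up. -/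
theorem fw_eq_zero {θ : ℕ} {h : PauliString n → ℕ → ℝ} (h0 : ∀ P, h P 0 = 0) (F : List (Kernel n))
    (P : PauliString n) {b : ℕ} (hb : b ≤ (θ + 1) * F.length) : fw θ h F P b = 0 := by
  induction F generalizing P b with
  | nil =>
    obtain rfl : b = 0 := by simpa using hb
    exact h0 P
  | cons A F ih =>
    refine Finset.sum_eq_zero fun Q _ => ?_
    split_ifs with hQ
    · rw [ih, mul_zero]
      rw [List.length_cons, mul_add, mul_one] at hb
      omega
    · rw [mul_zero]

/-- The paths whose last layer of weight at most `θ` lies between `F` and `As`. -/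
def splitSum (θ : ℕ) (o r : PauliString n → ℝ) (k : ℕ) (F As : List (Kernel n)) : ℝ :=
  ∑ P with weight P ≤ θ, fw θ (fun P' b => o P' * back r As b P) F P k

/-- Walking away from the observable, the current string either is light and gives the summand `i =
0`, or is heavy and its layer joins `F`. The assumption on `k` says that a path with heavy strings
in all layers exceeds the budget. -/
theorem sum_fw_eq_splitSum {θ : ℕ} {o r : PauliString n → ℝ} {k : ℕ} (F As : List (Kernel n))
    (hk : k ≤ (θ + 1) * (F.length + As.length)) :
    ∑ P, fw θ (fun P' b => o P' * back r As b P) F P k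
      = ∑ i ∈ Finset.range As.length,
        splitSum θ o r k ((As.take i).reverse ++ F) (As.drop i) := by
  induction As generalizing F with
  | nil =>
    refine Finset.sum_eq_zero fun P _ => fw_eq_zero (fun P' => ?_) F P (by simpa using hk)
    simp [back]
  | cons A As ih =>
    rw [List.length_cons, Finset.sum_range_succ', ← Finset.sum_filter_add_sum_filter_not _
      (fun P => weight P ≤ θ), add_comm]
    congr 1
    have := ih (A :: F) (by rw [List.length_cons] at hk ⊢; convert hk using 2; omega)
    simp only [List.take_succ_cons, List.reverse_cons, List.append_assoc, List.singleton_append,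
      List.drop_succ_cons]
    rw [← this]
    simp only [fw, Finset.sum_filter, not_le]
    rw [Finset.sum_comm]
    refine Finset.sum_congr rfl fun P _ => ?_
    split_ifs with hP
    · simp only [back, Finset.mul_sum]
      simp only [mul_left_comm (o _)]
      rw [fw_sum θ (fun Q => A P Q) (fun Q P' b => o P' * back r As (b - weight P) Q)]
      refine Finset.sum_congr rfl fun Q _ => ?_
      rw [fw_sub θ (fun P' b => o P' * back r As b Q) (weight P)]
    · simp

theorem sum_back_eq_splitSum {θ : ℕ} {o r : PauliString n → ℝ} {k : ℕ} (As : List (Kernel n))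
    (hk : k ≤ (θ + 1) * As.length) :
    ∑ P, o P * back r As k P
      = ∑ i ∈ Finset.range As.length, splitSum θ o r k (As.take i).reverse (As.drop i) := by
  have := sum_fw_eq_splitSum (o := o) (r := r) [] As (by simpa using hk)
  simpa [fw] using this

/-! ### Counting -/

/-- The noise table of a trace-preserving map. -/
def FixesLeft (t : Fin 4 → Fin 4 → ℝ) : Prop := ∀ v, v ≠ 0 → t 0 v = 0

def FixesRight (t : Fin 4 → Fin 4 → ℝ) : Prop := ∀ v, v ≠ 0 → t v 0 = 0

/-- The factor by which the number of terms may grow per unit of weight. -/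
abbrev growth (c : ℕ) : ℕ := 4 ^ (2 * c + 1)

theorem run_append (I J : List (Instr n)) (l : List (Term n)) :
    run (I ++ J) l = run J (run I l) := by simp [run]

/-- The instructions `I` produce at most `4 ^ (cI w)` terms, whose weight is at most `(cI + 1) w`,
and then `J` multiplies by at most `4 ^ (cJ (cI + 1) w)`. With one noise instruction per qubit and
gates on `c` qubits, in either order, the exponent is `(2c + 1) w`. Prefixes are included because
the machine also holds the intermediate lists. -/
theorem length_run_take_le {cI cJ : ℕ} {I J : List (Instr n)} (hI : Tame cI I) (hJ : Tame cJ J)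
    (τ : Term n) (i : ℕ) :
    (run ((I ++ J).take i) [τ]).length ≤ 4 ^ ((cI + cJ * (cI + 1)) * weight τ.1) := by
  rw [List.take_append, run_append]
  have hI' := hI.sublist (List.take_sublist i I)
  have hJ' := hJ.sublist (List.take_sublist (i - I.length) J)
  have h1 := length_run_le hI' (l := [τ]) (W := weight τ.1) (by simp)
  refine (length_run_le hJ' (W := (cI + 1) * weight τ.1) fun τ' hτ' => ?_).trans ?_
  · obtain ⟨σ, hσ, h, -⟩ := mem_run hI' hτ'
    rw [List.mem_singleton] at hσ
    rwa [hσ] at h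
  · refine (Nat.mul_le_mul_right _ h1).trans (le_of_eq ?_)
    rw [List.length_singleton, one_mul, ← pow_mul, ← pow_mul, ← pow_add]
    congr 1
    ring

theorem length_backInstrs_take_le {t : Fin 4 → Fin 4 → ℝ} (ht : FixesLeft t) (ℓ : Layer n c)
    (τ : Term n) (i : ℕ) :
    (run ((backInstrs t ℓ).take i) [τ]).length ≤ growth c ^ weight τ.1 := by
  rw [backInstrs, growth, ← pow_mul]
  convert length_run_take_le (tame_siteInstrs fun _ => ht) (tame_gates ℓ) τ i using 3
  ring

theorem length_fwInstrs_take_le {t : Fin 4 → Fin 4 → ℝ} (ht : FixesRight t) (ℓ : Layer n c)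
    (τ : Term n) (i : ℕ) :
    (run ((fwInstrs t ℓ).take i) [τ]).length ≤ growth c ^ weight τ.1 := by
  rw [fwInstrs, growth, ← pow_mul]
  convert length_run_take_le (tame_gatesT ℓ)
    (tame_siteInstrs (t := fun _ a b => t b a) fun _ => ht) τ i using 3
  ring

theorem run_budget {I : List (Instr n)} {τ τ' : Term n} (h : τ' ∈ run I [τ]) :
    τ'.2.2 = τ.2.2 := by
  induction I generalizing τ with
  | nil =>
    rw [run, List.foldl_nil, List.mem_singleton] at h
    rw [h]
  | cons g I ih =>
    rw [show run (g :: I) [τ] = run I (g.step τ) by simp [run], run_eq_flatMap,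
      List.mem_flatMap] at h
    obtain ⟨σ, hσ, h⟩ := h
    obtain ⟨-, -, -, hb⟩ := mem_step hσ
    exact (ih h).trans hb

/-- A bound for the number of terms that a list can produce. -/
def potential (f : Term n → ℕ) (l : List (Term n)) : ℕ := (l.map f).sum

theorem potential_flatMap_le {f : Term n → ℕ} {g : Term n → List (Term n)} {l : List (Term n)}
    (h : ∀ τ ∈ l, potential f (g τ) ≤ f τ) : potential f (l.flatMap g) ≤ potential f l := by
  induction l with
  | nil => exact le_rfl
  | cons τ l ih =>
    simp only [potential, List.flatMap_cons, List.map_append, List.sum_append, List.map_cons,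
      List.sum_cons] at *
    exact add_le_add (h τ (by simp)) (ih fun τ hτ => h τ (by simp [hτ]))

theorem length_le_potential {f : Term n → ℕ} {l : List (Term n)} (hf : ∀ τ, 1 ≤ f τ) :
    l.length ≤ potential f l := by
  induction l with
  | nil => exact le_rfl
  | cons τ l ih =>
    simp only [potential, List.map_cons, List.sum_cons, List.length_cons] at *
    have := hf τ
    omega

theorem le_potential {f : Term n → ℕ} {l : List (Term n)} {τ : Term n} (h : τ ∈ l) :
    f τ ≤ potential f l :=
  List.single_le_sum (by simp) _ (List.mem_map.2 ⟨τ, h, rfl⟩)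

theorem potential_le {f : Term n → ℕ} {l : List (Term n)} {B : ℕ} (h : ∀ τ ∈ l, f τ ≤ B) :
    potential f l ≤ l.length * B := by
  have := List.sum_le_card_nsmul (l.map f) B fun x hx => by
    obtain ⟨τ, hτ, rfl⟩ := List.mem_map.1 hx
    exact h τ hτ
  simpa [potential] using this

theorem growth_pos (c b : ℕ) : 1 ≤ growth c ^ b := Nat.one_le_pow _ _ (by positivity)

/-- A term of weight `w` becomes at most `growth c ^ w` terms, and each has lost `w` from its
budget: the two effects cancel. -/
theorem potential_backStep {t : Fin 4 → Fin 4 → ℝ} (ht : FixesLeft t) (ℓ : Layer n c)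
    (τ : Term n) :
    potential (fun τ => growth c ^ τ.2.2) (backStep t ℓ τ) ≤ growth c ^ τ.2.2 := by
  rw [backStep]
  split_ifs with h
  · exact Nat.zero_le _
  · refine (potential_le (B := growth c ^ (τ.2.2 - weight τ.1)) fun τ' hτ' => ?_).trans ?_
    · rw [run_budget hτ']
    · have := length_backInstrs_take_le ht ℓ (τ.1, τ.2.1, τ.2.2 - weight τ.1)
        (backInstrs t ℓ).length
      rw [List.take_length] at this
      refine (Nat.mul_le_mul_right _ this).trans (le_of_eq ?_)
      rw [← pow_add]
      congr 1
      dsimp only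
      omega

theorem potential_backTerms {t : Fin 4 → Fin 4 → ℝ} (ht : FixesLeft t) (ls : List (Layer n c))
    (l : List (Term n)) :
    potential (fun τ => growth c ^ τ.2.2) (backTerms t ls l)
      ≤ potential (fun τ => growth c ^ τ.2.2) l := by
  induction ls generalizing l with
  | nil => exact le_rfl
  | cons ℓ ls ih =>
    rw [backTerms, List.foldl_cons]
    exact (ih _).trans (potential_flatMap_le fun τ _ => potential_backStep ht ℓ τ)

/-- Going forward, a string splits according to its own weight but the resulting string is charged
for its weight. The potential therefore carries the current weight as well: budget plus weight of a
new term is the old budget. -/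
theorem potential_fwStep (θ : ℕ) {t : Fin 4 → Fin 4 → ℝ} (ht : FixesRight t) (ℓ : Layer n c)
    (τ : Term n) :
    potential (fun τ => growth c ^ (τ.2.2 + weight τ.1)) (fwStep θ t ℓ τ)
      ≤ growth c ^ (τ.2.2 + weight τ.1) := by
  rw [fwStep]
  have h1 : ((run (fwInstrs t ℓ) [τ]).flatMap (charge θ)).length ≤ growth c ^ weight τ.1 := by
    have := length_fwInstrs_take_le ht ℓ τ (fwInstrs t ℓ).length
    rw [List.take_length] at this
    refine (length_flatMap_le _ _ (B := 1) fun τ' _ => ?_).trans (by rwa [mul_one])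
    rw [charge]
    split_ifs <;> simp
  refine (potential_le (B := growth c ^ τ.2.2) fun τ' hτ' => ?_).trans
    ((Nat.mul_le_mul_right _ h1).trans (le_of_eq (by rw [← pow_add, add_comm])))
  obtain ⟨σ, hσ, hτ'⟩ := List.mem_flatMap.1 hτ'
  rw [charge] at hτ'
  split_ifs at hτ' with h2 h3
  · simp at hτ'
  · rw [List.mem_singleton] at hτ'
    subst hτ'
    rw [← run_budget hσ]
    exact Nat.pow_le_pow_right (by positivity) (by dsimp only; omega)
  · simp at hτ'

theorem potential_fwTerms (θ : ℕ) {t : Fin 4 → Fin 4 → ℝ} (ht : FixesRight t)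
    (ls : List (Layer n c)) (l : List (Term n)) :
    potential (fun τ => growth c ^ (τ.2.2 + weight τ.1)) (fwTerms θ t ls l)
      ≤ potential (fun τ => growth c ^ (τ.2.2 + weight τ.1)) l := by
  induction ls generalizing l with
  | nil => exact le_rfl
  | cons ℓ ls ih =>
    rw [fwTerms, List.foldl_cons]
    exact (ih _).trans (potential_flatMap_le fun τ _ => potential_fwStep θ ht ℓ τ)

/-! ### Enumeration of Pauli strings of small weight -/

def lowStep (θ : ℕ) (i : Fin n) (P : PauliString n) : List (PauliString n) :=
  P :: if weight P < θ then [Function.update P i 1, Function.update P i 2, Function.update P i 3]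
    else []

def lowPaulis (θ : ℕ) (is : List (Fin n)) : List (PauliString n) :=
  is.foldl (fun l i => l.flatMap (lowStep θ i)) [0]

theorem supp_update {P : PauliString n} {i : Fin n} {v : Fin 4} (hv : v ≠ 0) :
    supp (Function.update P i v) = insert i (supp P) := by
  ext j
  rw [mem_supp, Finset.mem_insert, mem_supp]
  by_cases h : j = i
  · subst h; simpa using hv
  · simp [h]

theorem mem_lowStep {θ : ℕ} {i : Fin n} {P Q : PauliString n} (hP : P i = 0) :
    Q ∈ lowStep θ i P ↔ Function.update Q i 0 = P ∧ (Q i ≠ 0 → weight P < θ) := by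
  have hP0 : Function.update P i 0 = P := by rw [← hP, Function.update_eq_self]
  constructor
  · intro h
    rw [lowStep, List.mem_cons] at h
    rcases h with rfl | h
    · exact ⟨hP0, fun h => absurd hP h⟩
    · split_ifs at h with hw
      · simp only [List.mem_cons, List.not_mem_nil, or_false] at h
        rcases h with rfl | rfl | rfl <;> simp [hw, hP0]
      · simp at h
  · rintro ⟨h, hw⟩
    have hQ : Q = Function.update P i (Q i) := by rw [← h]; simp
    rw [lowStep, List.mem_cons]
    by_cases h0 : Q i = 0
    · left; rw [hQ, h0, hP0]
    · right
      rw [if_pos (hw h0)]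
      have : ∀ v : Fin 4, v ≠ 0 → v = 1 ∨ v = 2 ∨ v = 3 := by decide
      rw [hQ]
      rcases this _ h0 with h | h | h <;> simp [h]

theorem weight_update_zero {P : PauliString n} {i : Fin n} (h : P i ≠ 0) :
    weight P = weight (Function.update P i 0) + 1 := by
  have h1 : P = Function.update (Function.update P i 0) i (P i) := by simp
  have h2 : i ∉ supp (Function.update P i 0) := by simp [mem_supp]
  rw [weight, weight, ← Finset.card_insert_of_notMem h2, ← supp_update h, ← h1]

theorem weight_update_zero_le (P : PauliString n) (i : Fin n) :
    weight (Function.update P i 0) ≤ weight P := by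
  by_cases h : P i = 0
  · rw [← h, Function.update_eq_self]
  · have := weight_update_zero h
    omega

/-- Strings are extended one qubit at a time, and the parent is recovered by erasing the new qubit.
Absence of duplicates is needed for the sum over the list to equal the sum over the set. -/
theorem lowPaulis_spec (θ : ℕ) (is : List (Fin n)) (his : is.Nodup) :
    (lowPaulis θ is).Nodup ∧
      ∀ P, P ∈ lowPaulis θ is ↔ weight P ≤ θ ∧ ∀ i, P i ≠ 0 → i ∈ is := by
  induction is using List.reverseRecOn with
  | nil =>
    refine ⟨List.nodup_singleton _, fun P => ?_⟩
    rw [lowPaulis, List.foldl_nil, List.mem_singleton]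
    constructor
    · rintro rfl
      simp [weight_eq_zero.2 rfl]
    · rintro ⟨-, h⟩
      funext i
      by_contra h0
      simpa using h i h0
  | append_singleton is i ih =>
    rw [List.nodup_append] at his
    have hi : i ∉ is := fun h => his.2.2 i h i (by simp) rfl
    obtain ⟨ih1, ih2⟩ := ih his.1
    have h0 : ∀ P ∈ lowPaulis θ is, P i = 0 := fun P hP => by
      by_contra h
      exact hi (((ih2 P).1 hP).2 i h)
    have hstep : lowPaulis θ (is ++ [i]) = (lowPaulis θ is).flatMap (lowStep θ i) := by
      simp [lowPaulis]
    rw [hstep]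
    constructor
    · rw [List.nodup_flatMap]
      refine ⟨fun P hP => ?_, ih1.imp_of_mem fun {P P'} hP hP' hne => ?_⟩
      · have hinj : ∀ v v' : Fin 4, Function.update P i v = Function.update P i v' → v = v' :=
          fun v v' h => by simpa using congr_fun h i
        have hP0 : P = Function.update P i 0 := by rw [← h0 P hP, Function.update_eq_self]
        rw [lowStep]
        split_ifs
        · conv in P :: _ => rw [hP0]
          simp only [List.nodup_cons, List.mem_cons, List.not_mem_nil, or_false, not_or,
            Function.update_idem]
          have hne : ∀ v v' : Fin 4, v ≠ v' → Function.update P i v ≠ Function.update P i v' :=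
            fun v v' hv h => hv (hinj v v' h)
          refine ⟨⟨hne _ _ ?_, hne _ _ ?_, hne _ _ ?_⟩, ⟨hne _ _ ?_, hne _ _ ?_⟩, hne _ _ ?_, ?_⟩ <;>
            simp
        · simp
      · intro Q hQ hQ'
        exact hne (((mem_lowStep (h0 P hP)).1 hQ).1.symm.trans ((mem_lowStep (h0 P' hP')).1 hQ').1)
    · intro Q
      rw [List.mem_flatMap]
      constructor
      · rintro ⟨P, hP, hQ⟩
        obtain ⟨h1, h2⟩ := (mem_lowStep (h0 P hP)).1 hQ
        obtain ⟨h3, h4⟩ := (ih2 P).1 hP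
        constructor
        · by_cases hQi : Q i = 0
          · rw [← hQi, Function.update_eq_self] at h1
            rwa [h1]
          · rw [weight_update_zero hQi, h1]
            exact h2 hQi
        · intro j hj
          by_cases hji : j = i
          · simp [hji]
          · refine List.mem_append_left _ (h4 j ?_)
            rwa [← h1, Function.update_of_ne hji]
      · rintro ⟨h1, h2⟩
        refine ⟨Function.update Q i 0, (ih2 _).2
          ⟨(weight_update_zero_le Q i).trans h1, fun j hj => ?_⟩,
          (mem_lowStep (by simp)).2 ⟨rfl, fun h => ?_⟩⟩
        · by_cases hji : j = i
          · subst hji; simp at hj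
          · rw [Function.update_of_ne hji] at hj
            have := h2 j hj
            simpa [hji] using this
        · have := weight_update_zero h
          omega

theorem card_low_le (hn : 1 ≤ n) (θ : ℕ) :
    (Finset.univ.filter fun P : PauliString n => weight P ≤ θ).card ≤ (4 * n) ^ θ := by
  classical
  induction θ with
  | zero =>
    rw [pow_zero, Finset.card_le_one]
    simp only [Finset.mem_filter, Nat.le_zero, weight_eq_zero]
    rintro P ⟨-, rfl⟩ Q ⟨-, rfl⟩
    rfl
  | succ θ ih =>
    have hsub : (Finset.univ.filter fun P : PauliString n => weight P ≤ θ + 1) ⊆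
        ((Finset.univ.filter fun P : PauliString n => weight P ≤ θ) ×ˢ
          (Finset.univ : Finset (Fin n × Fin 4))).image fun p =>
            Function.update p.1 p.2.1 p.2.2 := by
      intro P hP
      rw [Finset.mem_filter] at hP
      simp only [Finset.mem_image, Finset.mem_product, Finset.mem_filter, Finset.mem_univ, true_and,
        and_true]
      by_cases h : weight P ≤ θ
      -- A string that is already light enough arises by rewriting a label with its own value; this
      -- needs a qubit.
      · exact ⟨(P, ⟨0, hn⟩, P ⟨0, hn⟩), h, by simp⟩
      · obtain ⟨i, hi⟩ : (supp P).Nonempty := Finset.card_pos.1 (by rw [weight] at h; omega)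
        rw [mem_supp] at hi
        refine ⟨(Function.update P i 0, i, P i), ?_, by simp⟩
        have := weight_update_zero hi
        dsimp only
        omega
    refine (Finset.card_le_card hsub).trans (Finset.card_image_le.trans ?_)
    rw [Finset.card_product, Finset.card_univ, Fintype.card_prod, Fintype.card_fin,
      Fintype.card_fin, pow_succ, mul_comm n 4]
    exact Nat.mul_le_mul_right _ ih

theorem length_lowPaulis_le (hn : 1 ≤ n) (θ : ℕ) {is : List (Fin n)} (his : is.Nodup) :
    (lowPaulis θ is).length ≤ (4 * n) ^ θ := by
  classical
  obtain ⟨h1, h2⟩ := lowPaulis_spec θ is his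
  rw [← List.toFinset_card_of_nodup h1]
  refine (Finset.card_le_card fun P hP => ?_).trans (card_low_le hn θ)
  simpa using ((h2 P).1 (List.mem_toFinset.1 hP)).1

theorem sum_lowPaulis (θ : ℕ) (g : PauliString n → ℝ) :
    ((lowPaulis θ (List.finRange n)).map g).sum = ∑ P with weight P ≤ θ, g P := by
  classical
  obtain ⟨h1, h2⟩ := lowPaulis_spec θ _ (List.nodup_finRange n)
  rw [← List.sum_toFinset _ h1]
  refine Finset.sum_congr ?_ fun _ _ => rfl
  ext P
  simp [h2]

end Propagation

/-! ## Machine arithmetic with matrices of constant size -/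

section Arithmetic

variable {κ : Type} {w : κ → World} {x : κ → Val}

theorem PT.of_isEmpty [IsEmpty κ] {y : κ → Val} : PT w x y := .of_prog .id fun k => isEmptyElim k

theorem PT.finset_sum {ι : Type} (s : Finset ι) {f : κ → ι → ℝ}
    (h : ∀ i ∈ s, PT w x fun k => .real (f k i)) : PT w x fun k => .real (∑ i ∈ s, f k i) := by
  classical
  induction s using Finset.induction_on with
  | empty => simpa using PT.zero
  | insert i s hi ih =>
    simp only [Finset.sum_insert hi]
    exact (h i (by simp)).add (ih fun j hj => h j (by simp [hj]))

theorem PT.neg {r : κ → ℝ} (h : PT w x fun k => .real (r k)) : PT w x fun k => .real (-r k) :=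
  (PT.zero.sub h).congr fun k => by rw [zero_sub]

/-- Case distinction on a value in a finite type that can be tested for equality. -/
theorem PT.cases_fintype {φ : Type} [Finite φ] {v : κ → φ} {y : κ → Val}
    (ht : ∀ j, ∃ r : κ → ℝ, (PT w x fun k => .real (r k)) ∧ ∀ k, 0 < r k ↔ v k = j)
    (h : ∀ j, PT (fun k : {k // v k = j} => w k) (fun k => x k) fun k => y k) : PT w x y := by
  classical
  cases nonempty_fintype φ
  have key : ∀ l : List φ, PT (fun k : {k // v k ∈ l} => w k) (fun k => x k) fun k => y k := by
    intro l
    induction l with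
    | nil =>
      have : IsEmpty {k // v k ∈ ([] : List φ)} := ⟨fun k => by simpa using k.2⟩
      exact .of_isEmpty
    | cons j l ih =>
      obtain ⟨r, hr, hr'⟩ := ht j
      refine .ite (fun k : {k // v k ∈ j :: l} => v k = j) (hr.reindex Subtype.val)
        (fun k => hr' k) ?_ ?_
      · exact (h j).reindex fun k : {k : {k // v k ∈ j :: l} // v k = j} =>
          (⟨k.1.1, k.2⟩ : {k // v k = j})
      · exact ih.reindex fun k : {k : {k // v k ∈ j :: l} // ¬ v k = j} =>
          (⟨k.1.1, (List.mem_cons.1 k.1.2).resolve_left k.2⟩ : {k // v k ∈ l})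
  exact (key Finset.univ.toList).reindex fun k => ⟨k, by simp⟩

/-- Complex numbers computable from `x`. -/
def PTC (w : κ → World) (x : κ → Val) (z : κ → ℂ) : Prop := PT w x fun k => encComplex (z k)

variable {z z' : κ → ℂ}

theorem PTC.re (h : PTC w x z) : PT w x fun k => .real (z k).re := PT.fst h

theorem PTC.im (h : PTC w x z) : PT w x fun k => .real (z k).im := PT.snd h

theorem PTC.zero : PTC w x fun _ => 0 := PT.zero.pair .zero

theorem PTC.one : PTC w x fun _ => 1 := PT.one.pair .zero

theorem PTC.I : PTC w x fun _ => Complex.I :=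
  (PT.zero.pair .one).congr fun k => by simp [encComplex]

theorem PTC.neg (h : PTC w x z) : PTC w x fun k => -z k := h.re.neg.pair h.im.neg

theorem PTC.add (h : PTC w x z) (h' : PTC w x z') : PTC w x fun k => z k + z' k :=
  (h.re.add h'.re).pair (h.im.add h'.im)

theorem PTC.mul (h : PTC w x z) (h' : PTC w x z') : PTC w x fun k => z k * z' k :=
  ((h.re.mul h'.re).sub (h.im.mul h'.im)).pair ((h.re.mul h'.im).add (h.im.mul h'.re))

theorem PTC.star (h : PTC w x z) : PTC w x fun k => star (z k) := h.re.pair h.im.neg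

theorem PTC.sum {ι : Type} (s : Finset ι) {f : κ → ι → ℂ} (h : ∀ i, PTC w x fun k => f k i) :
    PTC w x fun k => ∑ i ∈ s, f k i := by
  classical
  induction s using Finset.induction_on with
  | empty => simpa using PTC.zero
  | insert i s hi ih =>
    simp only [Finset.sum_insert hi]
    exact (h i).add ih

theorem PTC.prod {ι : Type} (s : Finset ι) {f : κ → ι → ℂ} (h : ∀ i, PTC w x fun k => f k i) :
    PTC w x fun k => ∏ i ∈ s, f k i := by
  classical
  induction s using Finset.induction_on with
  | empty => simpa using PTC.one
  | insert i s hi ih =>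
    simp only [Finset.prod_insert hi]
    exact (h i).mul ih

/-- Matrices of constant size whose entries are computable from `x`. -/
def PTM {ι : Type} (w : κ → World) (x : κ → Val) (A : κ → Matrix ι ι ℂ) : Prop :=
  ∀ i j, PTC w x fun k => A k i j

variable {ι : Type} {A A' : κ → Matrix ι ι ℂ}

theorem PTM.conjTranspose (h : PTM w x A) : PTM w x fun k => (A k).conjTranspose :=
  fun i j => (h j i).star

variable [Fintype ι]

theorem PTM.mul (h : PTM w x A) (h' : PTM w x A') : PTM w x fun k => A k * A' k := fun i j => by
  simp only [Matrix.mul_apply]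
  exact .sum _ fun l => (h i l).mul (h' l j)

theorem PTM.trace (h : PTM w x A) : PTC w x fun k => (A k).trace := .sum _ fun i => h i i

theorem PTM.pauliMatrix (a : Fin 4) : PTM w x fun _ => pauliMatrix a := by
  have h0 : PTC w x fun _ => 0 := .zero
  have h1 : PTC w x fun _ => 1 := .one
  have hI : PTC w x fun _ => Complex.I := .I
  intro i j
  fin_cases a <;> fin_cases i <;> fin_cases j <;>
    first
      | exact h0
      | exact h1
      | exact hI
      | exact hI.neg
      | exact h1.neg

theorem PTM.pauliOp {m : ℕ} (P : PauliString m) : PTM w x fun _ => pauliOp P :=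
  fun i j => PTC.prod Finset.univ (f := fun _ a => NoisyPauli.pauliMatrix (P a) (i a) (j a))
    fun a => PTM.pauliMatrix (P a) (i a) (j a)

theorem PT.div_natCast {r : κ → ℝ} (h : PT w x fun k => .real (r k)) (m : ℕ) :
    PT w x fun k => .real (r k / (m : ℝ)) :=
  (h.mul (PT.natCast m).inv).congr fun k => by rw [div_eq_mul_inv]

theorem PTM.amplitude {m : ℕ} {U : κ → Op m} (h : PTM w x U) (P Q : PauliString m) :
    PT w x fun k => .real (amplitude (sandwich (U k)) P Q) :=
  (((PTM.pauliOp P).mul ((h.mul (.pauliOp Q)).mul h.conjTranspose)).trace.re.div_natCast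
    (2 ^ m)).congr fun k => by simp [NoisyPauli.amplitude, sandwich]

theorem PTM.amp1 {U : κ → UMat (Fin 2)} (h : PTM w x fun k => (U k : Mat2)) (a b : Fin 4) :
    PT w x fun k => .real (amp1 (conj1 (U k)) a b) :=
  (((PTM.pauliMatrix a).mul ((h.mul (.pauliMatrix b)).mul h.conjTranspose)).trace.re.div_natCast
    2).congr fun k => by simp [NoisyPauli.amp1, conj1]

theorem PT.table {m : ℕ} {f : κ → Bits m → Val} (h : PT w x fun k => encTable m (f k))
    (b : Bits m) : PT w x fun k => f k b := by
  induction m with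
  | zero =>
    rw [Subsingleton.elim b Fin.elim0]
    exact h
  | succ m ih =>
    have hb : b = Fin.cons (b 0) (Fin.tail b) := (Fin.cons_self_tail b).symm
    rw [hb]
    have h2 : b 0 = 0 ∨ b 0 = 1 := by
      have : ∀ v : Fin 2, v = 0 ∨ v = 1 := by decide
      exact this _
    rcases h2 with h2 | h2 <;> rw [h2]
    · exact ih (f := fun k y => f k (Fin.cons 0 y)) h.fst (Fin.tail b)
    · exact ih (f := fun k y => f k (Fin.cons 1 y)) h.snd (Fin.tail b)

theorem PTM.of_encMatrix {m : ℕ} {U : κ → Op m} (h : PT w x fun k => encMatrix (U k)) :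
    PTM w x U := fun i j =>
  PT.table (f := fun k y => encComplex (U k i y))
    (PT.table (f := fun k i => encTable m fun y => encComplex (U k i y)) h i) j

theorem PT.getElem_ofFn {m : ℕ} {f : κ → Fin m → Val} (i : Fin m)
    (h : PT w x fun k => encList (List.ofFn (f k))) : PT w x fun k => f k i :=
  (h.getElem_const i (by simp)).congr fun k => by simp

theorem PTM.of_encMat2 {U : κ → Mat2} (h : PT w x fun k => encMat2 (U k)) : PTM w x U :=
  fun i j => PT.getElem_ofFn (f := fun k j => encComplex (U k i j)) j
    (PT.getElem_ofFn (f := fun k i => encList (List.ofFn fun j => encComplex (U k i j))) i h)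

theorem PT.noise {N : κ → Mat2 →ₗ[ℂ] Mat2} (h : PT w x fun k => encNoise (N k)) (a b : Fin 4) :
    PT w x fun k => .real (NoisyPauli.amp1 (N k) a b) :=
  PT.getElem_ofFn (f := fun k b => .real (NoisyPauli.amp1 (N k) a b)) b
    (PT.getElem_ofFn (f := fun k a =>
      encList (List.ofFn fun b => .real (NoisyPauli.amp1 (N k) a b))) a h)

end Arithmetic

/-! ## Machine operations on Pauli strings and terms -/

section Terms

variable {κ : Type} {w : κ → World} {x : κ → Val} {n : κ → ℕ}

theorem PT.weight {P : ∀ k, PauliString (n k)} (hn : Poly w n)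
    (hP : PT w x fun k => encPauli (P k)) : PT w x fun k => encNat (weight (P k)) := by
  have := PT.sum (l := fun k => List.finRange (n k)) (e := fun k i => encNat (P k i))
    (g := fun k i => if P k i ≠ 0 then 1 else 0) (by simpa using hn)
    (hP.congr fun k => by rw [encPauli, List.ofFn_eq_map])
    ((PT.ite_of_pt (fun p : Elem fun k => List.finRange (n k) => P p.1 p.2 ≠ 0)
      (r := fun p => ((P p.1 p.2 : ℕ) : ℝ)) PT.id.snd
      (fun p => by rw [Nat.cast_pos, Fin.val_pos_iff, Fin.pos_iff_ne_zero]) .one .zero).congr fun p => by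
        split_ifs <;> rfl)
  refine this.congr fun k => ?_
  rw [encNat, ← List.ofFn_eq_map, List.sum_ofFn, Finset.sum_boole]
  rfl

theorem encPauli_update {n : ℕ} (P : PauliString n) (i : Fin n) (v : Fin 4) :
    encPauli (Function.update P i v)
      = encList (List.ofFn (Function.update (fun j => encNat (P j)) i (encNat v))) := by
  rw [encPauli]
  congr 2
  funext j
  by_cases h : j = i
  · subst h; simp
  · simp [h]

theorem PT.update_pauli {P : ∀ k, PauliString (n k)} {q : ∀ k, Fin (n k)} (hn : Poly w n)
    (hP : PT w x fun k => encPauli (P k)) (hq : PT w x fun k => encNat (q k)) (v : Fin 4) :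
    PT w x fun k => encPauli (Function.update (P k) (q k) v) :=
  (PT.update hn (f := fun k j => encNat (P k j)) hP hq (PT.natCast v)).congr fun _ =>
    (encPauli_update _ _ _).symm

theorem extend_eq_foldr {m n : ℕ} (q : Fin m ↪ Fin n) (v : PauliString m) (P : PauliString n) :
    Function.extend q v P
      = (List.finRange m).foldr (fun a R => Function.update R (q a) (v a)) P := by
  have key : ∀ (l : List (Fin m)) (j : Fin n),
      l.foldr (fun a R => Function.update R (q a) (v a)) P j
        = if ∃ a ∈ l, q a = j then Function.extend q v P j else P j := by
    intro l j
    induction l with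
    | nil => simp
    | cons a l ih =>
      rw [List.foldr_cons]
      by_cases h : j = q a
      · subst h
        simp [q.injective.extend_apply]
      · rw [Function.update_of_ne h, ih]
        simp [Ne.symm h]
  funext j
  rw [key]
  split_ifs with h
  · rfl
  · rw [Function.extend_apply']
    simpa using h

theorem PT.extend {m : ℕ} {P : ∀ k, PauliString (n k)} {q : ∀ k, Fin m ↪ Fin (n k)}
    (hn : Poly w n) (hP : PT w x fun k => encPauli (P k))
    (hq : ∀ a, PT w x fun k => encNat (q k a)) (v : PauliString m) :
    PT w x fun k => encPauli (Function.extend (q k) v (P k)) := by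
  simp only [extend_eq_foldr]
  generalize List.finRange m = l
  induction l with
  | nil => exact hP
  | cons a l ih => exact PT.update_pauli hn ih (hq a) (v a)

def encTerm {n : ℕ} (τ : Term n) : Val :=
  .pair (encPauli τ.1) (.pair (.real τ.2.1) (encNat τ.2.2))

/-- The terms produced by an instruction are computable from `x` and the given term. -/
def PTStep (w : κ → World) (x : κ → Val) (g : ∀ k, Instr (n k)) : Prop :=
  PT (fun p : Σ k, Term (n k) => w p.1) (fun p => .pair (x p.1) (encTerm p.2))
    fun p => encList (((g p.1).step p.2).map encTerm)

/-- For constant `m` there are only `4 ^ m` patterns of labels on the qubits `q`. The program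
branches over them, after which table entries and output labels are at constant positions. -/
theorem PTStep.of_table {m : ℕ} {q : ∀ k, Fin m ↪ Fin (n k)} {tab : κ → Kernel m}
    (hn : Poly w n) (hq : ∀ a, PT w x fun k => encNat (q k a))
    (ht : ∀ p v, PT w x fun k => .real (tab k p v)) :
    PTStep w x fun k => ⟨m, q k, tab k⟩ := by
  have hn' : Poly (fun p : Σ k, Term (n k) => w p.1) fun p => n p.1 := hn.reindex _
  have hx : PT (fun p : Σ k, Term (n k) => w p.1) (fun p => .pair (x p.1) (encTerm p.2))
      fun p => x p.1 := PT.id.fst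
  have hP : PT (fun p : Σ k, Term (n k) => w p.1) (fun p => .pair (x p.1) (encTerm p.2))
      fun p => encPauli p.2.1 := PT.id.snd.fst
  have ha : PT (fun p : Σ k, Term (n k) => w p.1) (fun p => .pair (x p.1) (encTerm p.2))
      fun p => .real p.2.2.1 := PT.id.snd.snd.fst
  have hb : PT (fun p : Σ k, Term (n k) => w p.1) (fun p => .pair (x p.1) (encTerm p.2))
      fun p => encNat p.2.2.2 := PT.id.snd.snd.snd
  have hq' := fun a => (hq a).lift (fun p : Σ k, Term (n k) => p.1) hx
  have ht' := fun p v => (ht p v).lift (fun p : Σ k, Term (n k) => p.1) hx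
  have hlab : ∀ a : Fin m, PT (fun p : Σ k, Term (n k) => w p.1)
      (fun p => .pair (x p.1) (encTerm p.2)) fun p => encNat (p.2.1 (q p.1 a)) := fun a =>
    PT.get (f := fun p i => encNat (p.2.1 i)) hn' hP (hq' a)
  refine PT.cases_fintype (v := fun p : Σ k, Term (n k) => fun a : Fin m => p.2.1 (q p.1 a))
    (fun j => ⟨fun p => 1 - ∑ a, (((p.2.1 (q p.1 a) : ℕ) : ℝ) - ((j a : ℕ) : ℝ)) *
      (((p.2.1 (q p.1 a) : ℕ) : ℝ) - ((j a : ℕ) : ℝ)), ?_, fun p => ?_⟩) fun j => ?_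
  · refine PT.sub .one (.finset_sum _ fun a _ => PT.mul ?_ ?_) <;>
      exact PT.sub (hlab a) (.natCast _)
  · have hsq : ∑ a, (((p.2.1 (q p.1 a) : ℕ) : ℝ) - ((j a : ℕ) : ℝ)) *
        (((p.2.1 (q p.1 a) : ℕ) : ℝ) - ((j a : ℕ) : ℝ))
        = ((∑ a, (((p.2.1 (q p.1 a) : ℕ) : ℤ) - ((j a : ℕ) : ℤ)) *
        (((p.2.1 (q p.1 a) : ℕ) : ℤ) - ((j a : ℕ) : ℤ)) : ℤ) : ℝ) := by push_cast; rfl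
    beta_reduce
    -- The sum of squares is an integer, so being below 1 means that it vanishes, that is, that all
    -- labels agree with `j`.
    rw [hsq, sub_pos, ← Int.cast_one, Int.cast_lt, show (1 : ℤ) = 0 + 1 from rfl, Int.lt_add_one_iff]
    have hnn : ∀ a ∈ Finset.univ, 0 ≤ (((p.2.1 (q p.1 a) : ℕ) : ℤ) - ((j a : ℕ) : ℤ)) *
        (((p.2.1 (q p.1 a) : ℕ) : ℤ) - ((j a : ℕ) : ℤ)) := fun a _ => mul_self_nonneg _
    constructor
    · intro h
      have h0 := (Finset.sum_eq_zero_iff_of_nonneg hnn).1 (le_antisymm h (Finset.sum_nonneg hnn))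
      funext a
      have := mul_self_eq_zero.1 (h0 a (Finset.mem_univ a))
      exact Fin.ext (by omega)
    · intro h
      refine (Finset.sum_eq_zero fun a _ => ?_).le
      rw [← congr_fun h a]
      simp
  · have hcoef : ∀ v, PT (fun p : {p : Σ k, Term (n k) // (fun a => p.2.1 (q p.1 a)) = j} => w p.1.1)
        (fun p => .pair (x p.1.1) (encTerm p.1.2)) fun p => .real (p.1.2.2.1 * tab p.1.1 j v) :=
      fun v => (ha.reindex Subtype.val).mul ((ht' j v).reindex Subtype.val)
    have key : ∀ l : List (PauliString m),
        PT (fun p : {p : Σ k, Term (n k) // (fun a => p.2.1 (q p.1 a)) = j} => w p.1.1)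
          (fun p => .pair (x p.1.1) (encTerm p.1.2)) fun p => encList ((l.flatMap fun v =>
            if p.1.2.2.1 * tab p.1.1 j v ≠ 0 then
              [((Function.extend (q p.1.1) v p.1.2.1, p.1.2.2.1 * tab p.1.1 j v, p.1.2.2.2) :
                Term (n p.1.1))] else []).map encTerm) := by
      intro l
      induction l with
      | nil => exact PT.nil
      | cons v l ih =>
        have hext := PT.extend (hn'.reindex Subtype.val) (hP.reindex Subtype.val)
          (fun a => (hq' a).reindex (Subtype.val : {p : Σ k, Term (n k) //
            (fun a => p.2.1 (q p.1 a)) = j} → _)) v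
        have hterm := hext.pair ((hcoef v).pair (hb.reindex Subtype.val))
        refine (PT.ite_of_pt (fun p => p.1.2.2.1 * tab p.1.1 j v ≠ 0) ((hcoef v).mul (hcoef v))
          (fun p => by rw [← pow_two, sq_pos_iff]) (hterm.pair ih) ih).congr fun p => ?_
        rw [List.flatMap_cons]
        split_ifs <;> rfl
    refine (key (Finset.univ : Finset (PauliString m)).toList).congr fun p => ?_
    obtain ⟨p, rfl⟩ := p
    rfl

/-- Instructions carried out one after the other. -/
theorem PT.run {I : ∀ k, List (Instr (n k))} {l : ∀ k, List (Term (n k))} {el : κ → List Val}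
    (hel : ∀ k, (el k).length = (I k).length) (hI : Poly w fun k => (I k).length) {B : κ → ℕ}
    (hB : Poly w B) (hle : ∀ k i, (run ((I k).take i) (l k)).length ≤ B k)
    (hx : PT w x fun k => encList (el k)) (hl : PT w x fun k => encList ((l k).map encTerm))
    (hstep : PTStep (fun p : Below (fun k => (el k).length) => w p.1.1)
      (fun p => .pair (x p.1.1) (.pair (encNat p.1.2) ((el p.1.1)[p.1.2]'p.2)))
      fun p => (I p.1.1)[p.1.2]'(hel p.1.1 ▸ p.2)) :
    PT w x fun k => encList ((run (I k) (l k)).map encTerm) := by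
  refine (PT.fold (l := el) (st := fun k i => encList ((NoisyPauli.run ((I k).take i) (l k)).map encTerm))
    (by simpa only [hel] using hI) hx (hl.congr fun k => by simp [NoisyPauli.run]) ?_).congr fun k => by
      rw [hel, List.take_length]
  refine (PT.flatMap (l := fun p : Below (fun k => (el k).length) =>
    NoisyPauli.run ((I p.1.1).take p.1.2) (l p.1.1))
    (g := fun p τ => ((I p.1.1)[p.1.2]'(hel p.1.1 ▸ p.2)).step τ) (e := fun _ => encTerm)
    (e' := fun _ => encTerm)
    ((hB.reindex fun p : Below (fun k => (el k).length) => p.1.1).mono fun p => hle _ _)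
    ((hB.reindex fun p : Below (fun k => (el k).length) => p.1.1).mono fun p => ?_)
    PT.id.snd.snd.snd ?_).congr fun p => ?_
  · refine le_trans (le_of_eq ?_) (hle p.1.1 (p.1.2 + 1))
    rw [List.take_succ_eq_append_getElem (hel p.1.1 ▸ p.2)]
    simp [NoisyPauli.run, -List.take_append_getElem]
  · refine PT.comp ?_ (hstep.reindex fun p : Elem fun p : Below (fun k => (el k).length) =>
      NoisyPauli.run ((I p.1.1).take p.1.2) (l p.1.1) => ⟨p.1, p.2.1⟩)
    exact (PT.id.fst.fst.pair (PT.id.fst.snd.fst.pair PT.id.fst.snd.snd.fst)).pair PT.id.snd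
  · rw [List.take_succ_eq_append_getElem (hel p.1.1 ▸ p.2)]
    simp [NoisyPauli.run, -List.take_append_getElem]

end Terms

/-! ## Machine propagation through layers -/

section Nat

variable {κ : Type} {w : κ → World} {x : κ → Val} {a b : κ → ℕ}

theorem PT.length {l : κ → List Val} (hlen : Poly w fun k => (l k).length)
    (hl : PT w x fun k => encList (l k)) : PT w x fun k => encNat (l k).length :=
  (PT.sum (α := fun _ => Val) (l := l) (e := fun _ v => v) (g := fun _ _ => 1) hlen
    (hl.congr fun k => by simp) .one).congr fun k => by simp [encNat]

theorem PT.ite_lt {y z : κ → Val} (ha : PT w x fun k => encNat (a k))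
    (hb : PT w x fun k => encNat (b k)) (hy : PT w x y) (hz : PT w x z) :
    PT w x fun k => if a k < b k then y k else z k :=
  PT.ite_of_pt (fun k => a k < b k) (PT.sub hb ha) (fun k => by rw [sub_pos, Nat.cast_lt]) hy hz

theorem PT.natSub (ha : PT w x fun k => encNat (a k)) (hb : PT w x fun k => encNat (b k)) :
    PT w x fun k => encNat (a k - b k) :=
  (PT.ite_lt hb ha (PT.sub ha hb) .zero).congr fun k => by
    split_ifs with h
    · rw [encNat, Nat.cast_sub h.le]
    · rw [Nat.sub_eq_zero_of_le (not_lt.1 h), encNat, Nat.cast_zero]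

end Nat

/-! ### Elementary instructions on the machine. -/

section Steps

variable {κ : Type} {w : κ → World} {x : κ → Val} {n : κ → ℕ} {c : ℕ}

theorem PTStep.congr {g g' : ∀ k, Instr (n k)} (h : PTStep w x g) (hg : ∀ k, g k = g' k) :
    PTStep w x g' := by
  rwa [← funext hg]

/-- Tables of real numbers computable from `x`. -/
def PTTab (w : κ → World) (x : κ → Val) (t : κ → Fin 4 → Fin 4 → ℝ) : Prop :=
  ∀ a b, PT w x fun k => .real (t k a b)

theorem PTTab.lift {κ' : Type} {t : κ → Fin 4 → Fin 4 → ℝ} (h : PTTab w x t) (σ : κ' → κ)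
    {x' : κ' → Val} (hx : PT (fun k => w (σ k)) x' fun k => x (σ k)) :
    PTTab (fun k => w (σ k)) x' fun k => t (σ k) := fun a b => (h a b).lift σ hx

theorem PTStep.site {i : ∀ k, Fin (n k)} {t : κ → Fin 4 → Fin 4 → ℝ} (hn : Poly w n)
    (hi : PT w x fun k => encNat (i k)) (ht : PTTab w x t) :
    PTStep w x fun k => siteInstr (i k) (t k) :=
  PTStep.of_table (q := fun k => ⟨fun _ => i k, fun _ _ _ => Subsingleton.elim _ _⟩)
    (tab := fun k p v => t k (p 0) (v 0)) hn (fun _ => hi) fun p v => ht (p 0) (v 0)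

/-- Tables computed from the matrix of a gate. -/
def MatrixTable (T : ∀ m, Op m → Kernel m) : Prop :=
  ∀ {κ : Type} {w : κ → World} {x : κ → Val} {m : ℕ} {U : κ → Op m}, PTM w x U →
    ∀ p v, PT w x fun k => .real (T m (U k) p v)

/-- The arity is part of the input but at most `c`, so it is computed from the list of qubits and
one of finitely many programs, each for matrices of a fixed size, is selected. -/
theorem PTStep.gate {T : ∀ m, Op m → Kernel m} (hT : MatrixTable T) {g : ∀ k, Gate (n k) c}
    (hn : Poly w n) (hg : PT w x fun k => encGate (g k)) :
    PTStep w x fun k => ⟨(g k).arity, (g k).qubit, T _ ((g k).mat : Op (g k).arity)⟩ := by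
  have harity : PT w x fun k => encNat (g k).arity := by
    refine (PT.length (l := fun k => List.ofFn fun a => encNat ((g k).qubit a))
      ((Poly.const c).mono fun k => ?_) hg.fst).congr fun k => by simp
    simpa using (g k).arity_le
  refine PT.cases_nat (fun p : Σ k, Term (n k) => (g p.1).arity) c
    (harity.lift (fun p : Σ k, Term (n k) => p.1) PT.id.fst) (fun p => (g p.1).arity_le)
    fun m _ => ?_
  -- The gate is replaced by data whose type mentions the constant `m`, so that the equation for the
  -- arity disappears from all later types.
  have hrep : ∀ k : {k // (g k).arity = m}, ∃ (q : Fin m ↪ Fin (n k)) (U : Op m),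
      (⟨(g k).arity, (g k).qubit, T _ ((g k).mat : Op (g k).arity)⟩ : Instr (n k)) = ⟨m, q, T m U⟩ ∧
      encGate (g k) = .pair (encList (List.ofFn fun a => encNat (q a))) (encMatrix U) := by
    rintro ⟨k, rfl⟩
    exact ⟨(g k).qubit, ((g k).mat : Op (g k).arity), rfl, rfl⟩
  choose q U h1 h2 using hrep
  have hg' : PT (fun k : {k // (g k).arity = m} => w k) (fun k => x k) fun k =>
      .pair (encList (List.ofFn fun a => encNat (q k a))) (encMatrix (U k)) :=
    (hg.reindex Subtype.val).congr h2
  have key : PTStep (fun k : {k // (g k).arity = m} => w k) (fun k => x k) fun k =>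
      ⟨m, q k, T m (U k)⟩ :=
    .of_table (hn.reindex _) (fun a => PT.getElem_ofFn (f := fun k a => encNat (q k a)) a hg'.fst)
      (hT (.of_encMatrix hg'.snd))
  exact (key.congr fun k => (h1 k).symm).reindex
    fun p : {p : Σ k, Term (n k) // (g p.1).arity = m} =>
      (⟨⟨p.1.1, p.2⟩, p.1.2⟩ : Σ k : {k // (g k).arity = m}, Term (n k))

theorem matrixTable_amplitude : MatrixTable fun _ U => amplitude (sandwich U) :=
  fun h p v => h.amplitude p v

theorem matrixTable_amplitudeT : MatrixTable fun _ U p v => amplitude (sandwich U) v p :=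
  fun h p v => h.amplitude v p

theorem PT.runGates {T : ∀ m, Op m → Kernel m} (hT : MatrixTable T) {ins : ∀ {n}, Gate n c → Instr n}
    (hins : ∀ {n} (g : Gate n c), ins g = ⟨g.arity, g.qubit, T _ (g.mat : Op g.arity)⟩)
    {gs : ∀ k, List (Gate (n k) c)} {l : ∀ k, List (Term (n k))} (hn : Poly w n)
    (hgs : Poly w fun k => (gs k).length) {B : κ → ℕ} (hB : Poly w B)
    (hle : ∀ k i, (NoisyPauli.run (((gs k).map ins).take i) (l k)).length ≤ B k)
    (hx : PT w x fun k => encList ((gs k).map encGate))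
    (hl : PT w x fun k => encList ((l k).map encTerm)) :
    PT w x fun k => encList ((NoisyPauli.run ((gs k).map ins) (l k)).map encTerm) := by
  refine PT.run (el := fun k => (gs k).map encGate) (fun k => by simp) (by simpa using hgs) hB hle hx
    hl ?_
  refine (PTStep.gate hT (hn.reindex _)
    (g := fun p : Below (fun k => ((gs k).map encGate).length) =>
      (gs p.1.1)[p.1.2]'(by simpa using p.2)) ?_).congr fun p => ?_
  · exact PT.id.snd.snd.congr fun p => by simp
  · simp [hins]

theorem PT.runSites {t : ∀ k, Fin (n k) → Fin 4 → Fin 4 → ℝ} {l : ∀ k, List (Term (n k))}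
    {f : ∀ k, Fin (n k) → Val} (hn : Poly w n) {B : κ → ℕ} (hB : Poly w B)
    (hle : ∀ k i, (NoisyPauli.run ((siteInstrs (t k)).take i) (l k)).length ≤ B k)
    (hx : PT w x fun k => encList (List.ofFn (f k)))
    (hl : PT w x fun k => encList ((l k).map encTerm))
    (ht : PTTab (fun p : Σ k, Fin (n k) => w p.1) (fun p => .pair (x p.1) (f p.1 p.2))
      fun p => t p.1 p.2) :
    PT w x fun k => encList ((NoisyPauli.run (siteInstrs (t k)) (l k)).map encTerm) := by
  refine PT.run (el := fun k => List.ofFn (f k)) (fun k => by simp [siteInstrs])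
    (by simpa [siteInstrs] using hn) hB hle hx hl ?_
  refine (PTStep.site (hn.reindex _)
    (i := fun p : Below (fun k => (List.ofFn (f k)).length) => ⟨p.1.2, by simpa using p.2⟩)
    (t := fun p => t p.1.1 ⟨p.1.2, by simpa using p.2⟩) PT.id.snd.fst ?_).congr fun p => ?_
  · refine ht.lift (fun p : Below (fun k => (List.ofFn (f k)).length) =>
      (⟨p.1.1, ⟨p.1.2, by simpa using p.2⟩⟩ : Σ k, Fin (n k))) ?_
    exact (PT.id.fst.pair PT.id.snd.snd).congr fun p => by simp
  · simp [siteInstrs]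

end Steps

/-! ### Backward and forward propagation steps on the machine. -/

section Layers

variable {κ : Type} {w : κ → World} {x : κ → Val} {n : κ → ℕ} {c : ℕ}
  {t : κ → Fin 4 → Fin 4 → ℝ}

theorem exists_take_append {n : ℕ} (I J : List (Instr n)) (i : ℕ) :
    ∃ j, I.take i = (I ++ J).take j :=
  ⟨min i I.length, by rw [List.take_append_of_le_length (min_le_right _ _), ← List.take_eq_take_min]⟩

theorem length_run_of_append {n : ℕ} {I J : List (Instr n)} {l : List (Term n)} {B : ℕ}
    (h : ∀ i, (run ((I ++ J).take i) l).length ≤ B) :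
    (∀ i, (run (I.take i) l).length ≤ B) ∧ ∀ i, (run (J.take i) (run I l)).length ≤ B := by
  refine ⟨fun i => ?_, fun i => ?_⟩
  · obtain ⟨j, hj⟩ := exists_take_append I J i
    rw [hj]
    exact h j
  · have := h (I.length + i)
    rwa [List.take_length_add_append, run_append] at this

theorem PT.runNoise {τ : ∀ k, Term (n k)} {l : ∀ k, List (Term (n k))} (hn : Poly w n)
    (ht : PTTab w x t) (hτ : PT w x fun k => encTerm (τ k)) {B : κ → ℕ} (hB : Poly w B)
    (hle : ∀ k i, (NoisyPauli.run ((siteInstrs fun _ => t k).take i) (l k)).length ≤ B k)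
    (hl : PT w x fun k => encList ((l k).map encTerm)) :
    PT w x fun k => encList ((NoisyPauli.run (siteInstrs fun _ => t k) (l k)).map encTerm) :=
  PT.runSites (f := fun k i => encNat ((τ k).1 i)) hn hB hle hτ.fst hl
    (ht.lift (fun p : Σ k, Fin (n k) => p.1) PT.id.fst)

theorem PT.singleton {α : κ → Type} {e : ∀ k, α k → Val} {a : ∀ k, α k}
    (h : PT w x fun k => e k (a k)) : PT w x fun k => encList ([a k].map (e k)) :=
  h.pair .nil

theorem PT.runBack {ℓ : ∀ k, Layer (n k) c} {τ : ∀ k, Term (n k)} (hn : Poly w n)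
    (ht : PTTab w x t) (hfix : ∀ k, FixesLeft (t k)) (hℓ : PT w x fun k => encLayer (ℓ k))
    (hτ : PT w x fun k => encTerm (τ k)) (hB : Poly w fun k => growth c ^ NoisyPauli.weight (τ k).1) :
    PT w x fun k => encList ((NoisyPauli.run (backInstrs (t k) (ℓ k)) [τ k]).map encTerm) := by
  have hle := fun k => length_run_of_append (I := siteInstrs fun _ => t k)
    (length_backInstrs_take_le (hfix k) (ℓ k) (τ k))
  have h1 := PT.runNoise hn ht hτ hB (fun k => (hle k).1) (PT.singleton hτ)
  refine (PT.runGates (T := fun _ U => amplitude (sandwich U)) matrixTable_amplitude (ins := gateInstr) (fun _ => rfl)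
    (gs := fun k => (ℓ k).gates) hn (hn.mono fun k => length_gates_le _) hB (fun k => (hle k).2)
    hℓ h1).congr fun k => ?_
  rw [backInstrs, run_append]

theorem PT.runFw {ℓ : ∀ k, Layer (n k) c} {τ : ∀ k, Term (n k)} (hn : Poly w n)
    (ht : PTTab w x t) (hfix : ∀ k, FixesRight (t k)) (hℓ : PT w x fun k => encLayer (ℓ k))
    (hτ : PT w x fun k => encTerm (τ k)) (hB : Poly w fun k => growth c ^ NoisyPauli.weight (τ k).1) :
    PT w x fun k => encList ((NoisyPauli.run (fwInstrs (t k) (ℓ k)) [τ k]).map encTerm) := by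
  have hle := fun k => length_run_of_append (I := (ℓ k).gates.reverse.map gateInstrT)
    (length_fwInstrs_take_le (hfix k) (ℓ k) (τ k))
  have hlen : Poly w fun k => (ℓ k).gates.length := hn.mono fun k => length_gates_le _
  have hrev : PT w x fun k => encList ((ℓ k).gates.reverse.map encGate) :=
    (PT.reverse (by simpa using hlen) hℓ).congr fun k => by rw [List.map_reverse]
  have h1 := PT.runGates (T := fun _ U p v => amplitude (sandwich U) v p) matrixTable_amplitudeT
    (ins := gateInstrT) (fun _ => rfl)
    (gs := fun k => (ℓ k).gates.reverse) hn (by simpa using hlen) hB (fun k => (hle k).1) hrev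
    (PT.singleton hτ)
  refine (PT.runNoise (t := fun k a b => t k b a) hn (fun a b => ht b a) hτ hB
    (fun k => (hle k).2) h1).congr fun k => ?_
  rw [fwInstrs, run_append]

theorem PT.term {P : ∀ k, PauliString (n k)} {a : κ → ℝ} {b : κ → ℕ}
    (hP : PT w x fun k => encPauli (P k)) (ha : PT w x fun k => .real (a k))
    (hb : PT w x fun k => encNat (b k)) : PT w x fun k => encTerm (P k, a k, b k) :=
  hP.pair (ha.pair hb)

theorem PT.backStep {ℓ : ∀ k, Layer (n k) c} {τ : ∀ k, Term (n k)} (hn : Poly w n)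
    (ht : PTTab w x t) (hfix : ∀ k, FixesLeft (t k)) (hℓ : PT w x fun k => encLayer (ℓ k))
    (hτ : PT w x fun k => encTerm (τ k)) (hB : Poly w fun k => growth c ^ (τ k).2.2) :
    PT w x fun k => encList ((NoisyPauli.backStep (t k) (ℓ k) (τ k)).map encTerm) := by
  have hP : PT w x fun k => encPauli (τ k).1 := hτ.fst
  have hw := PT.weight hn hP
  have hb : PT w x fun k => encNat (τ k).2.2 := hτ.snd.snd
  have hbw := hb.natSub hw
  refine PT.ite (fun k => 0 < (τ k).2.2 - NoisyPauli.weight (τ k).1) hbw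
    (fun k => Nat.cast_pos) ?_ ?_
  · refine (PT.runBack (hn.reindex Subtype.val) (fun a b => (ht a b).reindex Subtype.val)
      (fun k => hfix k) (hℓ.reindex Subtype.val) ((hP.term hτ.snd.fst hbw).reindex Subtype.val) ?_).congr fun k => ?_
    -- A positive remaining budget means that the weight is below the budget, so the expansion of
    -- this string is covered by `growth c` to the budget. Heavier strings are never expanded.
    · refine (hB.reindex _).mono fun k => Nat.pow_le_pow_right (by positivity) ?_
      have := k.2
      dsimp only
      omega
    · rw [NoisyPauli.backStep, if_neg k.2.ne']
  · refine PT.nil.congr fun k => ?_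
    rw [NoisyPauli.backStep, if_pos (by have := k.2; omega)]
    rfl

theorem PT.backTerms {ls : ∀ k, List (Layer (n k) c)} {l : ∀ k, List (Term (n k))} (hn : Poly w n)
    (ht : PTTab w x t) (hfix : ∀ k, FixesLeft (t k)) (hlen : Poly w fun k => (ls k).length)
    (hls : PT w x fun k => encList ((ls k).map encLayer))
    (hl : PT w x fun k => encList ((l k).map encTerm))
    (hB : Poly w fun k => potential (fun τ => growth c ^ τ.2.2) (l k)) :
    PT w x fun k => encList ((NoisyPauli.backTerms (t k) (ls k) (l k)).map encTerm) := by
  refine (PT.fold (l := fun k => (ls k).map encLayer)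
    (st := fun k i => encList ((NoisyPauli.backTerms (t k) ((ls k).take i) (l k)).map encTerm))
    (by simpa using hlen) hls (hl.congr fun k => by simp [NoisyPauli.backTerms]) ?_).congr
      fun k => by rw [List.length_map, List.take_length]
  let lay : ∀ p : Below (fun k => ((ls k).map encLayer).length), Layer (n p.1.1) c :=
    fun p => (ls p.1.1)[p.1.2]'(by simpa using p.2)
  have hsucc : ∀ p : Below (fun k => ((ls k).map encLayer).length),
      NoisyPauli.backTerms (t p.1.1) ((ls p.1.1).take (p.1.2 + 1)) (l p.1.1)
        = (NoisyPauli.backTerms (t p.1.1) ((ls p.1.1).take p.1.2) (l p.1.1)).flatMap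
          (NoisyPauli.backStep (t p.1.1) (lay p)) := fun p => by
    rw [List.take_succ_eq_append_getElem (by simpa using p.2)]
    simp [NoisyPauli.backTerms, -List.take_append_getElem, lay]
  have hBi := hB.reindex fun p : Below (fun k => ((ls k).map encLayer).length) => p.1.1
  refine (PT.flatMap (l := fun p : Below (fun k => ((ls k).map encLayer).length) =>
      NoisyPauli.backTerms (t p.1.1) ((ls p.1.1).take p.1.2) (l p.1.1))
    (g := fun p => NoisyPauli.backStep (t p.1.1) (lay p)) (e := fun _ => encTerm)
    (e' := fun _ => encTerm) (hBi.mono fun p => ?_) (hBi.mono fun p => ?_)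
    PT.id.snd.snd.snd ?_).congr fun p => by rw [hsucc]
  · exact (length_le_potential fun τ => growth_pos c τ.2.2).trans
      (potential_backTerms (hfix _) _ _)
  · rw [← hsucc]
    exact (length_le_potential fun τ => growth_pos c τ.2.2).trans
      (potential_backTerms (hfix _) _ _)
  · refine PT.backStep (hn.reindex _) (ht.lift (fun p : Elem fun p : Below (fun k =>
        ((ls k).map encLayer).length) => NoisyPauli.backTerms (t p.1.1) ((ls p.1.1).take p.1.2)
          (l p.1.1) => p.1.1.1) PT.id.fst.fst) (fun p => hfix _) ?_ PT.id.snd ?_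
    · exact PT.id.fst.snd.snd.fst.congr fun p => by simp [lay]
    · refine (hBi.reindex Sigma.fst).mono fun p => ?_
      exact (le_potential (f := fun τ : Term _ => growth c ^ τ.2.2) p.2.2).trans
        (potential_backTerms (hfix _) _ _)

theorem PT.charge {θ : κ → ℕ} {τ : ∀ k, Term (n k)} (hn : Poly w n)
    (hθ : PT w x fun k => encNat (θ k)) (hτ : PT w x fun k => encTerm (τ k)) :
    PT w x fun k => encList ((NoisyPauli.charge (θ k) (τ k)).map encTerm) := by
  have hP : PT w x fun k => encPauli (τ k).1 := hτ.fst
  have hw := PT.weight hn hP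
  have hb : PT w x fun k => encNat (τ k).2.2 := hτ.snd.snd
  refine (PT.ite_lt hθ hw (PT.ite_lt hw hb (PT.singleton (e := fun _ => encTerm)
    (hP.term hτ.snd.fst (hb.natSub hw))) .nil) .nil).congr fun k => ?_
  rw [NoisyPauli.charge]
  by_cases h1 : θ k < NoisyPauli.weight (τ k).1
  · by_cases h2 : NoisyPauli.weight (τ k).1 < (τ k).2.2
    · rw [if_pos h1, if_pos h1, if_pos h2, if_neg (by omega)]
    · rw [if_pos h1, if_pos h1, if_neg h2, if_pos (by omega)]
      rfl
  · rw [if_neg h1, if_neg h1]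
    rfl

theorem PT.fwStep {θ : κ → ℕ} {ℓ : ∀ k, Layer (n k) c} {τ : ∀ k, Term (n k)} (hn : Poly w n)
    (hθ : PT w x fun k => encNat (θ k))
    (ht : PTTab w x t) (hfix : ∀ k, FixesRight (t k)) (hℓ : PT w x fun k => encLayer (ℓ k))
    (hτ : PT w x fun k => encTerm (τ k))
    (hB : Poly w fun k => growth c ^ NoisyPauli.weight (τ k).1) :
    PT w x fun k => encList ((NoisyPauli.fwStep (θ k) (t k) (ℓ k) (τ k)).map encTerm) := by
  have hlen : ∀ k, (NoisyPauli.run (fwInstrs (t k) (ℓ k)) [τ k]).length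
      ≤ growth c ^ NoisyPauli.weight (τ k).1 := fun k => by
    have := length_fwInstrs_take_le (hfix k) (ℓ k) (τ k) (fwInstrs (t k) (ℓ k)).length
    rwa [List.take_length] at this
  refine PT.flatMap (e := fun _ => encTerm) (e' := fun _ => encTerm) (hB.mono hlen)
    (hB.mono fun k => (length_flatMap_le _ _ (B := 1) fun τ' _ => ?_).trans
      ((mul_one _).trans_le (hlen k))) (PT.runFw hn ht hfix hℓ hτ hB)
    (PT.charge (hn.reindex _) (hθ.lift Sigma.fst PT.id.fst) PT.id.snd)
  rw [NoisyPauli.charge]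
  split_ifs <;> simp

theorem PT.fwTerms {θ : κ → ℕ} {ls : ∀ k, List (Layer (n k) c)} {l : ∀ k, List (Term (n k))}
    (hn : Poly w n) (hθ : PT w x fun k => encNat (θ k))
    (ht : PTTab w x t) (hfix : ∀ k, FixesRight (t k)) (hlen : Poly w fun k => (ls k).length)
    (hls : PT w x fun k => encList ((ls k).map encLayer))
    (hl : PT w x fun k => encList ((l k).map encTerm))
    (hB : Poly w fun k => potential (fun τ => growth c ^ (τ.2.2 + NoisyPauli.weight τ.1)) (l k)) :
    PT w x fun k => encList ((NoisyPauli.fwTerms (θ k) (t k) (ls k) (l k)).map encTerm) := by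
  refine (PT.fold (l := fun k => (ls k).map encLayer)
    (st := fun k i => encList ((NoisyPauli.fwTerms (θ k) (t k) ((ls k).take i) (l k)).map encTerm))
    (by simpa using hlen) hls (hl.congr fun k => by simp [NoisyPauli.fwTerms]) ?_).congr
      fun k => by rw [List.length_map, List.take_length]
  let lay : ∀ p : Below (fun k => ((ls k).map encLayer).length), Layer (n p.1.1) c :=
    fun p => (ls p.1.1)[p.1.2]'(by simpa using p.2)
  have hsucc : ∀ p : Below (fun k => ((ls k).map encLayer).length),
      NoisyPauli.fwTerms (θ p.1.1) (t p.1.1) ((ls p.1.1).take (p.1.2 + 1)) (l p.1.1)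
        = (NoisyPauli.fwTerms (θ p.1.1) (t p.1.1) ((ls p.1.1).take p.1.2) (l p.1.1)).flatMap
          (NoisyPauli.fwStep (θ p.1.1) (t p.1.1) (lay p)) := fun p => by
    rw [List.take_succ_eq_append_getElem (by simpa using p.2)]
    simp [NoisyPauli.fwTerms, -List.take_append_getElem, lay]
  have hBi := hB.reindex fun p : Below (fun k => ((ls k).map encLayer).length) => p.1.1
  refine (PT.flatMap (l := fun p : Below (fun k => ((ls k).map encLayer).length) =>
      NoisyPauli.fwTerms (θ p.1.1) (t p.1.1) ((ls p.1.1).take p.1.2) (l p.1.1))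
    (g := fun p => NoisyPauli.fwStep (θ p.1.1) (t p.1.1) (lay p)) (e := fun _ => encTerm)
    (e' := fun _ => encTerm) (hBi.mono fun p => ?_) (hBi.mono fun p => ?_)
    PT.id.snd.snd.snd ?_).congr fun p => by rw [hsucc]
  · exact (length_le_potential fun τ => growth_pos c _).trans
      (potential_fwTerms _ (hfix _) _ _)
  · rw [← hsucc]
    exact (length_le_potential fun τ => growth_pos c _).trans
      (potential_fwTerms _ (hfix _) _ _)
  · refine PT.fwStep (hn.reindex _) (hθ.lift (fun p : Elem fun p : Below (fun k =>
        ((ls k).map encLayer).length) => NoisyPauli.fwTerms (θ p.1.1) (t p.1.1)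
          ((ls p.1.1).take p.1.2) (l p.1.1) => p.1.1.1) PT.id.fst.fst)
      (ht.lift _ PT.id.fst.fst) (fun p => hfix _) ?_ PT.id.snd ?_
    · exact PT.id.fst.snd.snd.fst.congr fun p => by simp [lay]
    · refine (hBi.reindex Sigma.fst).mono fun p => ?_
      refine le_trans ?_ ((le_potential
        (f := fun τ : Term _ => growth c ^ (τ.2.2 + NoisyPauli.weight τ.1)) p.2.2).trans
        (potential_fwTerms _ (hfix _) _ _))
      exact Nat.pow_le_pow_right (by positivity) (Nat.le_add_left _ _)

theorem PT.lowPaulis {θ : κ → ℕ} {f : ∀ k, Fin (n k) → Val} (hn1 : ∀ k, 1 ≤ n k) (hn : Poly w n)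
    (hB : Poly w fun k => (4 * n k) ^ θ k) (hθ : PT w x fun k => encNat (θ k))
    (hf : PT w x fun k => encList (List.ofFn (f k))) :
    PT w x fun k => encList ((NoisyPauli.lowPaulis (θ k) (List.finRange (n k))).map encPauli) := by
  have hlen : ∀ k i, (NoisyPauli.lowPaulis (θ k) ((List.finRange (n k)).take i)).length
      ≤ (4 * n k) ^ θ k := fun k i =>
    length_lowPaulis_le (hn1 k) _ ((List.nodup_finRange _).sublist (List.take_sublist _ _))
  refine (PT.fold (l := fun k => List.ofFn (f k)) (st := fun k i => encList
    ((NoisyPauli.lowPaulis (θ k) ((List.finRange (n k)).take i)).map encPauli))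
    (by simpa using hn) hf ?_ ?_).congr fun k => by simp [List.take_of_length_le]
  · have h0 : PT w x fun k => encPauli (0 : PauliString (n k)) := by
      have := PT.map (α := fun k => Fin (n k)) (β := fun _ => ℕ) (l := fun k => List.finRange (n k))
        (e := f) (e' := fun _ => encNat) (g := fun _ _ => 0)
        (by simpa using hn) (hf.congr fun k => by rw [List.ofFn_eq_map])
        (PT.zero.congr fun _ => by simp [encNat])
      exact this.congr fun k => by simp [encPauli, List.ofFn_eq_map]
    exact (PT.singleton (e := fun _ => encPauli) h0).congr fun k => by simp [NoisyPauli.lowPaulis]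
  · let ix : ∀ p : Below (fun k => (List.ofFn (f k)).length), Fin (n p.1.1) :=
      fun p => ⟨p.1.2, by simpa using p.2⟩
    have hsucc : ∀ p : Below (fun k => (List.ofFn (f k)).length),
        NoisyPauli.lowPaulis (θ p.1.1) ((List.finRange (n p.1.1)).take (p.1.2 + 1))
          = (NoisyPauli.lowPaulis (θ p.1.1) ((List.finRange (n p.1.1)).take p.1.2)).flatMap
            (lowStep (θ p.1.1) (ix p)) := fun p => by
      rw [List.take_succ_eq_append_getElem (by simpa using p.2)]
      simp [NoisyPauli.lowPaulis, -List.take_append_getElem, ix]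
    have hBi := hB.reindex fun p : Below (fun k => (List.ofFn (f k)).length) => p.1.1
    refine (PT.flatMap (l := fun p : Below (fun k => (List.ofFn (f k)).length) =>
        NoisyPauli.lowPaulis (θ p.1.1) ((List.finRange (n p.1.1)).take p.1.2))
      (g := fun p => lowStep (θ p.1.1) (ix p)) (e := fun _ => encPauli)
      (e' := fun _ => encPauli) (hBi.mono fun p => hlen _ _) (hBi.mono fun p => ?_)
      PT.id.snd.snd.snd ?_).congr fun p => by rw [hsucc]
    · rw [← hsucc]
      exact hlen _ _
    · let κ' := Elem fun p : Below (fun k => (List.ofFn (f k)).length) =>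
        NoisyPauli.lowPaulis (θ p.1.1) ((List.finRange (n p.1.1)).take p.1.2)
      have hn' : Poly (fun p : κ' => w p.1.1.1) fun p => n p.1.1.1 := hn.reindex _
      have hP : PT (fun p : κ' => w p.1.1.1) (fun p => .pair (.pair (x p.1.1.1)
          (.pair (encNat p.1.1.2) (.pair ((List.ofFn (f p.1.1.1))[p.1.1.2]'p.1.2) (encList
            ((NoisyPauli.lowPaulis (θ p.1.1.1) ((List.finRange (n p.1.1.1)).take p.1.1.2)).map
              encPauli))))) (encPauli p.2.1)) fun p => encPauli p.2.1 := PT.id.snd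
      have hu := fun v => PT.update_pauli (q := fun p : κ' => ix p.1) hn' hP PT.id.fst.snd.fst v
      refine (PT.pair hP (PT.ite_lt (PT.weight hn' hP)
        (hθ.lift (fun p : κ' => p.1.1.1) PT.id.fst.fst)
        (PT.cons (hu 1) (PT.cons (hu 2) (PT.singleton (e := fun _ => encPauli) (hu 3))))
        (PT.nil (x := _)))).congr fun p => ?_
      rw [lowStep]
      split_ifs <;> rfl

end Layers

/-! ## The two estimators -/

section Values

variable {n L c : ℕ}

/-- The estimate for a list of terms at the end of the circuit. -/
def backSum (r : PauliString n → ℝ) (t : Fin 4 → Fin 4 → ℝ) (ls : List (Layer n c))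
    (l : List (Term n)) : ℝ :=
  total (fun P b => if b = 0 then 0 else r P) (backTerms t ls l)

/-- The contribution of one Pauli term of the observable. -/
def termValue (r : PauliString n → ℝ) (t : Fin 4 → Fin 4 → ℝ) (W : Fin n → UMat (Fin 2))
    (ls : List (Layer n c)) (k : ℕ) (p : PauliString n × ℝ) : ℝ :=
  if weight p.1 < k then
    backSum r t ls (run (siteInstrs fun i => amp1 (conj1 (W i))) [(p.1, p.2, k)])
  else 0

/-- The Pauli coefficients of `V† O V` for `V = W₁ ⊗ ⋯ ⊗ Wₙ`. -/
def obsSum (o : PauliString n → ℝ) (W : Fin n → UMat (Fin 2)) (P : PauliString n) : ℝ :=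
  total (fun Q _ => o Q) (run (siteInstrs fun i a b => amp1 (conj1 (W i)) b a) [(P, 1, 0)])

/-- The contribution of the paths through `P` between the layers `F` and `ls`, all of whose
weights towards the observable are above `θ`. -/
def throughValue (o r : PauliString n → ℝ) (t : Fin 4 → Fin 4 → ℝ) (W : Fin n → UMat (Fin 2))
    (θ k : ℕ) (F ls : List (Layer n c)) (P : PauliString n) : ℝ :=
  total (fun P' b => obsSum o W P' * backSum r t ls [(P, 1, b)]) (fwTerms θ t F [(P, 1, k)])

def splitValue (o r : PauliString n → ℝ) (t : Fin 4 → Fin 4 → ℝ) (W : Fin n → UMat (Fin 2))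
    (θ k : ℕ) (ls : List (Layer n c)) (i : ℕ) : ℝ :=
  ((lowPaulis θ (List.finRange n)).map
    (throughValue o r t W θ k (ls.take i).reverse (ls.drop i))).sum

theorem backSum_eq (r : PauliString n → ℝ) (t : Fin 4 → Fin 4 → ℝ) (ls : List (Layer n c))
    (l : List (Term n)) :
    backSum r t ls l = total (fun P b => back r (ls.map (layerKernel t)) b P) l :=
  total_backTerms t r ls l

theorem total_singleton (h : PauliString n → ℕ → ℝ) (P : PauliString n) (a : ℝ) (b : ℕ) :
    total h [(P, a, b)] = a * h P b := by rw [total_cons, total_nil, add_zero]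

theorem termValue_eq (r : PauliString n → ℝ) (t : Fin 4 → Fin 4 → ℝ) (W : Fin n → UMat (Fin 2))
    {ls : List (Layer n c)} (hls : ls ≠ []) (k : ℕ) (p : PauliString n × ℝ) :
    termValue r t W ls k p = p.2 * ∑ P, amplitude (sandwich (tensorU W)) p.1 P *
      back r (ls.map (layerKernel t)) k P := by
  rw [termValue]
  split_ifs with h
  · rw [backSum_eq, total_run, total_singleton, actAll_siteInstrs]
    simp only [amplitude_tensorU]
  -- The final gates keep the support, so a term of weight at least `k` exhausts its budget in the
  -- first layer. At least one layer must be present for this charge. Rejecting such terms at once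
  -- avoids an exponential expansion by the final gates.
  · rw [Finset.sum_eq_zero fun P _ => ?_, mul_zero]
    obtain ⟨ℓ, ls, rfl⟩ := List.exists_cons_of_ne_nil hls
    by_cases hs : supp p.1 = supp P
    · have hw : k - weight P = 0 := by rw [weight, hs] at h; rw [weight]; omega
      simp [back, hw, back_zero]
    · rw [amplitude_tensorU_eq_zero W hs, zero_mul]

theorem obsSum_eq (o : PauliString n → ℝ) (W : Fin n → UMat (Fin 2)) (P : PauliString n) :
    obsSum o W P = ∑ Q, o Q * amplitude (sandwich (tensorU W)) Q P := by
  rw [obsSum, total_run, total_singleton, actAll_siteInstrs, one_mul]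
  simp only [amplitude_tensorU]
  exact Finset.sum_congr rfl fun Q _ => mul_comm _ _

theorem splitValue_eq (o r : PauliString n → ℝ) (t : Fin 4 → Fin 4 → ℝ) (W : Fin n → UMat (Fin 2))
    (θ k : ℕ) (ls : List (Layer n c)) (i : ℕ) :
    splitValue o r t W θ k ls i = splitSum θ (obsSum o W) r k
      ((ls.map (layerKernel t)).take i).reverse ((ls.map (layerKernel t)).drop i) := by
  rw [splitValue, sum_lowPaulis, splitSum]
  refine Finset.sum_congr rfl fun P _ => ?_
  rw [throughValue]
  simp only [backSum_eq, total_singleton, one_mul]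
  rw [total_fwTerms θ t (fun P' => by rw [back_zero, mul_zero]), total_singleton, one_mul]
  simp only [List.map_reverse, List.map_take, List.map_drop]

variable {N : Mat2 →ₗ[ℂ] Mat2} {ω : Unitaries n L} {d : CircuitDesc n L c}

/-- The layers of a description in the order of the Heisenberg evolution. -/
def CircuitDesc.layers (d : CircuitDesc n L c) : List (Layer n c) := (List.ofFn d.layer).reverse

theorem circuitLayers_eq (hN : IsChannel N) (hd : d.Describes ω) :
    circuitLayers N ω = d.layers.map (layerKernel (amp1 N)) := by
  rw [circuitLayers, CircuitDesc.layers, List.map_reverse, List.map_ofFn]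
  congr 2
  funext j P Q
  rw [layerAmp_eq hN, Function.comp_apply, layerKernel, hd.1 j]
  refine Finset.sum_congr rfl fun R _ => ?_
  rw [amplitude_tensorPow hN]
  rfl

theorem finalCoeff_eq (hd : d.Describes ω) (O : Op n) (P : PauliString n) :
    finalCoeff ω O P = obsSum (pauliCoeff O) d.final P := by
  rw [obsSum_eq, finalCoeff, hd.2]
  rfl

theorem fixesLeft_amp1 (hN : IsChannel N) : FixesLeft (amp1 N) := fun v hv => by
  rw [amp1_zero_left hN.trace_apply, if_neg hv]

theorem fixesRight_amp1 (hN : IsUnital N) : FixesRight (amp1 N) := fun v hv => by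
  rw [amp1_zero_right hN, if_neg hv]

theorem layerKernel_zero (hN : IsChannel N) (hd : d.Describes ω) {A : Kernel n}
    (hA : A ∈ d.layers.map (layerKernel (amp1 N))) (Q : PauliString n) :
    A 0 Q = if Q = 0 then 1 else 0 := by
  rw [← circuitLayers_eq hN hd, circuitLayers, List.mem_reverse, List.mem_ofFn'] at hA
  obtain ⟨j, rfl⟩ := hA
  dsimp only
  rw [layerAmp_eq hN, Finset.sum_eq_single (0 : PauliString n)]
  · rw [amplitude_conj_zero_left, amplitude_tensorPow hN]
    simp [amp1_zero_left hN.trace_apply]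
  · intro R _ hR
    obtain ⟨i, hi⟩ := Function.ne_iff.1 hR
    rw [amplitude_tensorPow hN, Finset.prod_eq_zero (Finset.mem_univ i), zero_mul]
    rw [Pi.zero_apply, amp1_zero_left hN.trace_apply, if_neg (show ¬ R i = 0 from hi)]
  · simp

theorem expval_pauliOp_zero {ρ : Op n} (hρ : IsState ρ) : expval (pauliOp 0) ρ = 1 := by
  rw [expval, pauliOp_zero, one_mul, hρ.2, Complex.one_re]

/-- Restricts the circuit to its last `k` layers; this is what removes the depth from the running
time. -/
theorem truncatedEstimate_eq_back (hN : IsChannel N) (hL : 1 ≤ L) (hd : d.Describes ω) {ρ : Op n}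
    (hρ : IsState ρ) (O : Op n) (k : ℕ) :
    truncatedEstimate k N ω O ρ = ∑ P, obsSum (pauliCoeff O) d.final P *
      back (fun P => expval (pauliOp P) ρ) ((d.layers.take k).map (layerKernel (amp1 N))) k P := by
  rw [truncatedEstimate_eq hN hL hd.2, circuitLayers_eq hN hd]
  refine Finset.sum_congr rfl fun P _ => ?_
  rw [finalCoeff_eq hd, List.map_take,
    back_take (fun A hA => layerKernel_zero hN hd hA) (expval_pauliOp_zero hρ) le_rfl]

theorem layers_take_ne_nil (hL : 1 ≤ L) (d : CircuitDesc n L c) {k : ℕ} (hk : 1 ≤ k) :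
    d.layers.take k ≠ [] := by
  rw [← List.length_pos_iff, CircuitDesc.layers]
  simp
  omega

theorem pauliCoeff_sumOfTerms {M : ℕ} (T : Fin M → PauliString n × ℝ) (Q : PauliString n) :
    pauliCoeff (sumOfTerms T) Q = ∑ m, if (T m).1 = Q then (T m).2 else 0 := by
  have h2 : (2 : ℂ) ^ n = ((2 ^ n : ℝ) : ℂ) := by push_cast; rfl
  rw [pauliCoeff, sumOfTerms, Finset.sum_mul, Matrix.trace_sum, Complex.re_sum, Finset.sum_div]
  refine Finset.sum_congr rfl fun m _ => ?_
  rw [smul_mul_assoc, Matrix.trace_smul, trace_pauliOp_mul, smul_eq_mul, Complex.re_ofReal_mul]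
  split_ifs
  · rw [h2, Complex.ofReal_re, mul_div_cancel_right₀ _ (by positivity)]
  · simp

theorem truncatedEstimate_eq_sum_termValue (hN : IsChannel N) (hL : 1 ≤ L) (hd : d.Describes ω)
    {ρ : Op n} (hρ : IsState ρ) {M : ℕ} (T : Fin M → PauliString n × ℝ) {k : ℕ} (hk : 1 ≤ k) :
    truncatedEstimate k N ω (sumOfTerms T) ρ = ∑ m, termValue (fun P => expval (pauliOp P) ρ)
      (amp1 N) d.final (d.layers.take k) k (T m) := by
  rw [truncatedEstimate_eq_back hN hL hd hρ]
  simp only [termValue_eq _ _ _ (layers_take_ne_nil hL d hk), obsSum_eq, pauliCoeff_sumOfTerms,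
    Finset.sum_mul, Finset.mul_sum, ite_mul, zero_mul]
  have : ∀ P : PauliString n, (∑ Q, ∑ m, if (T m).1 = Q then
      (T m).2 * amplitude (sandwich (tensorU d.final)) Q P * back (fun P => expval (pauliOp P) ρ)
        ((d.layers.take k).map (layerKernel (amp1 N))) k P else 0)
      = ∑ m, (T m).2 * (amplitude (sandwich (tensorU d.final)) (T m).1 P *
        back (fun P => expval (pauliOp P) ρ)
        ((d.layers.take k).map (layerKernel (amp1 N))) k P) := fun P => by
    rw [Finset.sum_comm]
    refine Finset.sum_congr rfl fun m _ => ?_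
    rw [Finset.sum_ite_eq, if_pos (Finset.mem_univ _), mul_assoc]
  rw [Finset.sum_congr rfl fun P _ => this P, Finset.sum_comm]

theorem truncatedEstimate_eq_sum_splitValue (hN : IsChannel N) (hL : 1 ≤ L) (hd : d.Describes ω)
    {ρ : Op n} (hρ : IsState ρ) (O : Op n) {k θ : ℕ} (hθ : k ≤ (θ + 1) * (d.layers.take k).length) :
    truncatedEstimate k N ω O ρ = ∑ i ∈ Finset.range (d.layers.take k).length,
      splitValue (pauliCoeff O) (fun P => expval (pauliOp P) ρ) (amp1 N) d.final θ k
        (d.layers.take k) i := by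
  rw [truncatedEstimate_eq_back hN hL hd hρ, sum_back_eq_splitSum (θ := θ) _ (by simpa using hθ),
    List.length_map]
  exact Finset.sum_congr rfl fun i _ => (splitValue_eq _ _ _ _ _ _ _ _).symm

end Values

/-! ## The estimators on the machine -/

section Machine

variable {κ : Type} {w : κ → World} {x : κ → Val} {n : κ → ℕ} {c : ℕ}
  {t : κ → Fin 4 → Fin 4 → ℝ} {W : ∀ k, Fin (n k) → UMat (Fin 2)}

theorem PT.total {l : ∀ k, List (Term (n k))} {h : ∀ k, PauliString (n k) → ℕ → ℝ}
    (hlen : Poly w fun k => (l k).length) (hl : PT w x fun k => encList ((l k).map encTerm))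
    (hh : PT (fun p : Elem l => w p.1) (fun p => .pair (x p.1) (encTerm p.2.1))
      fun p => .real (h p.1 p.2.1.1 p.2.1.2.2)) :
    PT w x fun k => .real (NoisyPauli.total (h k) (l k)) :=
  PT.sum (e := fun _ => encTerm) hlen hl (PT.mul PT.id.snd.snd.fst hh)

theorem PT.backSum {r : ∀ k, PauliString (n k) → ℝ} {ls : ∀ k, List (Layer (n k) c)}
    {l : ∀ k, List (Term (n k))} (hS : ∀ k P, (w k).S (encPauli P) (r k P)) (hn : Poly w n)
    (ht : PTTab w x t) (hfix : ∀ k, FixesLeft (t k)) (hlen : Poly w fun k => (ls k).length)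
    (hls : PT w x fun k => encList ((ls k).map encLayer))
    (hl : PT w x fun k => encList ((l k).map encTerm))
    (hB : Poly w fun k => potential (fun τ => growth c ^ τ.2.2) (l k)) :
    PT w x fun k => .real (NoisyPauli.backSum (r k) (t k) (ls k) (l k)) := by
  refine PT.total (hB.mono fun k => (length_le_potential fun τ => growth_pos c τ.2.2).trans
    (potential_backTerms (hfix k) _ _)) (PT.backTerms hn ht hfix hlen hls hl hB) ?_
  have hq : PT (fun p : Elem fun k => NoisyPauli.backTerms (t k) (ls k) (l k) => w p.1)
      (fun p => .pair (x p.1) (encTerm p.2.1)) fun p => .real (r p.1 p.2.1.1) :=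
    PT.queryState PT.id.snd.fst fun p => hS _ _
  refine (PT.ite_of_pt (fun p : Elem fun k => NoisyPauli.backTerms (t k) (ls k) (l k) =>
    0 < p.2.1.2.2) PT.id.snd.snd.snd (fun p => Nat.cast_pos) hq
    .zero).congr fun p => ?_
  by_cases h : p.2.1.2.2 = 0
  · simp [h]
  · rw [if_pos (Nat.pos_of_ne_zero h), if_neg h]

theorem fixes_conj1_left (U : UMat (Fin 2)) : FixesLeft (amp1 (conj1 U)) := fun v hv => by
  rw [amp1_zero_left (trace_conj1 U), if_neg hv]

theorem fixes_conj1_right (U : UMat (Fin 2)) : FixesRight (amp1 (conj1 U)) := fun v hv => by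
  rw [amp1_zero_right (conj1_one U), if_neg hv]

theorem length_sites_take_le {n : ℕ} (c : ℕ) {t : Fin n → Fin 4 → Fin 4 → ℝ}
    (ht : ∀ i, FixesLeft (t i)) (τ : Term n) (i : ℕ) :
    (run ((siteInstrs t).take i) [τ]).length ≤ growth c ^ weight τ.1 := by
  have h := length_run_le ((tame_siteInstrs ht).sublist (List.take_sublist i _)) (l := [τ])
    (W := weight τ.1) (by simp)
  rw [List.length_singleton, one_mul] at h
  exact h.trans (Nat.pow_le_pow_left (Nat.pow_le_pow_right (by norm_num) (by omega)) _)

theorem PTTab.final :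
    PTTab (fun p : Σ k, Fin (n k) => w p.1) (fun p => .pair (x p.1) (encMat2 (W p.1 p.2 : Mat2)))
      fun p => amp1 (conj1 (W p.1 p.2)) :=
  fun a b => PTM.amp1 (.of_encMat2 PT.id.snd) a b

theorem PT.termValue {r : ∀ k, PauliString (n k) → ℝ} {ls : ∀ k, List (Layer (n k) c)}
    {b : κ → ℕ} {p : ∀ k, PauliString (n k) × ℝ}
    (hS : ∀ k P, (w k).S (encPauli P) (r k P)) (hn : Poly w n)
    (ht : PTTab w x t) (hfix : ∀ k, FixesLeft (t k)) (hlen : Poly w fun k => (ls k).length)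
    (hls : PT w x fun k => encList ((ls k).map encLayer))
    (hW : PT w x fun k => encList (List.ofFn fun i => encMat2 (W k i : Mat2)))
    (hb : PT w x fun k => encNat (b k)) (hB : Poly w fun k => growth c ^ b k)
    (hp : PT w x fun k => .pair (encPauli (p k).1) (.real (p k).2)) :
    PT w x fun k => .real (NoisyPauli.termValue (r k) (t k) (W k) (ls k) (b k) (p k)) := by
  have hw := PT.weight hn hp.fst
  refine PT.ite (fun k => NoisyPauli.weight (p k).1 < b k) (PT.sub hb hw)
    (fun k => by rw [sub_pos, Nat.cast_lt]) ?_ ?_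
  · let κ' := {k // NoisyPauli.weight (p k).1 < b k}
    have hB' := hB.reindex (Subtype.val : κ' → κ)
    have hn' := hn.reindex (Subtype.val : κ' → κ)
    have hτ := (PT.term hp.fst hp.snd hb).reindex (Subtype.val : κ' → κ)
    have hle : ∀ (k : κ') (i : ℕ), (NoisyPauli.run ((siteInstrs fun i => amp1 (conj1 (W k i))).take i)
        [((p k).1, (p k).2, b k)]).length ≤ growth c ^ b k := fun k i =>
      (length_sites_take_le c (fun i => fixes_conj1_left _) _ i).trans
        (Nat.pow_le_pow_right (by positivity) k.2.le)
    have hrun := PT.runSites (f := fun (k : κ') i => encMat2 (W k i : Mat2)) hn' hB' hle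
      (hW.reindex Subtype.val) (PT.singleton (e := fun _ => encTerm) hτ)
      (PTTab.final (w := fun k : κ' => w k) (x := fun k : κ' => x k) (W := fun k : κ' => W k))
    refine (PT.backSum (w := fun k : κ' => w k) (x := fun k : κ' => x k) (fun k => hS k) hn' (fun i j => (ht i j).reindex Subtype.val)
      (fun k => hfix k) (hlen.reindex Subtype.val) (hls.reindex Subtype.val) hrun
      ((hB'.mul hB').mono fun k => ?_)).congr fun k => ?_
    -- The final gates produce at most `growth c ^ b` terms, all with the full budget `b`, hence the
    -- square of `growth c ^ b` as initial potential.
    · refine (potential_le (B := growth c ^ b k) fun τ hτ => ?_).trans (Nat.mul_le_mul_right _ ?_)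
      · rw [run_budget hτ]
      · have := hle k (siteInstrs fun i => amp1 (conj1 (W k i))).length
        rwa [List.take_length] at this
    · rw [NoisyPauli.termValue, if_pos k.2]
  · exact PT.zero.congr fun k => by rw [NoisyPauli.termValue, if_neg k.2]

theorem PT.obsSum {o : ∀ k, PauliString (n k) → ℝ} {P : ∀ k, PauliString (n k)}
    (hO : ∀ k P, (w k).B (encPauli P) (o k P)) (hn : Poly w n)
    (hW : PT w x fun k => encList (List.ofFn fun i => encMat2 (W k i : Mat2)))
    (hB : Poly w fun k => growth c ^ NoisyPauli.weight (P k)) (hP : PT w x fun k => encPauli (P k)) :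
    PT w x fun k => .real (NoisyPauli.obsSum (o k) (W k) (P k)) := by
  have hle : ∀ k i, (NoisyPauli.run ((siteInstrs fun i a b => amp1 (conj1 (W k i)) b a).take i)
      [((P k), 1, 0)]).length ≤ growth c ^ NoisyPauli.weight (P k) := fun k i =>
    length_sites_take_le c (t := fun i a b => amp1 (conj1 (W k i)) b a)
      (fun i => fixes_conj1_right _) _ i
  have hrun := PT.runSites (f := fun k i => encMat2 (W k i : Mat2)) hn hB hle hW
    (PT.singleton (e := fun _ => encTerm) (hP.term .one (PT.natCast 0)))
    (fun a b => PTTab.final b a)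
  refine PT.total (hB.mono fun k => ?_) hrun (PT.queryObs PT.id.snd.fst fun p => hO _ _)
  have := hle k (siteInstrs fun i a b => amp1 (conj1 (W k i)) b a).length
  rwa [List.take_length] at this

/-- The starting string has weight at most its budget `b`, so the forward potential starts below
`growth c ^ (2 b)`. The same bound covers the weight seen by the observable query and the budget
left for the backward sum. -/
theorem PT.throughValue {o r : ∀ k, PauliString (n k) → ℝ} {F ls : ∀ k, List (Layer (n k) c)}
    {θ b : κ → ℕ} {P : ∀ k, PauliString (n k)}
    (hO : ∀ k P, (w k).B (encPauli P) (o k P)) (hS : ∀ k P, (w k).S (encPauli P) (r k P))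
    (hn : Poly w n) (hθ : PT w x fun k => encNat (θ k))
    (ht : PTTab w x t) (hfix : ∀ k, FixesLeft (t k)) (hfix' : ∀ k, FixesRight (t k))
    (hFlen : Poly w fun k => (F k).length) (hlen : Poly w fun k => (ls k).length)
    (hF : PT w x fun k => encList ((F k).map encLayer))
    (hls : PT w x fun k => encList ((ls k).map encLayer))
    (hW : PT w x fun k => encList (List.ofFn fun i => encMat2 (W k i : Mat2)))
    (hb : PT w x fun k => encNat (b k)) (hB : Poly w fun k => growth c ^ b k)
    (hP : PT w x fun k => encPauli (P k)) (hPb : ∀ k, NoisyPauli.weight (P k) ≤ b k) :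
    PT w x fun k => .real (NoisyPauli.throughValue (o k) (r k) (t k) (W k) (θ k) (b k) (F k) (ls k)
      (P k)) := by
  have hpot : ∀ k, potential (fun τ => growth c ^ (τ.2.2 + NoisyPauli.weight τ.1))
      [(P k, 1, b k)] ≤ growth c ^ b k * growth c ^ b k := fun k => by
    rw [← pow_add]
    simpa [potential] using Nat.pow_le_pow_right (by positivity) (Nat.add_le_add_left (hPb k) _)
  have hBB := hB.mul hB
  have hmem : ∀ k, ∀ τ ∈ NoisyPauli.fwTerms (θ k) (t k) (F k) [(P k, 1, b k)],
      growth c ^ (τ.2.2 + NoisyPauli.weight τ.1) ≤ growth c ^ b k * growth c ^ b k := fun k τ hτ =>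
    (le_potential (f := fun τ => growth c ^ (τ.2.2 + NoisyPauli.weight τ.1)) hτ).trans
      ((potential_fwTerms _ (hfix' k) _ _).trans (hpot k))
  refine PT.total (hBB.mono fun k => (length_le_potential fun τ => growth_pos c _).trans
    ((potential_fwTerms _ (hfix' k) _ _).trans (hpot k)))
    (PT.fwTerms hn hθ ht hfix' hFlen hF (PT.singleton (e := fun _ => encTerm) (hP.term .one hb))
      (hBB.mono hpot)) ?_
  let κ' := Elem fun k => NoisyPauli.fwTerms (θ k) (t k) (F k) [(P k, 1, b k)]
  have hx : PT (fun p : κ' => w p.1) (fun p => .pair (x p.1) (encTerm p.2.1)) fun p => x p.1 :=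
    PT.id.fst
  have hBB' := hBB.reindex fun p : κ' => p.1
  have hW' := hW.lift (fun p : κ' => p.1) hx
  refine PT.mul (PT.obsSum (c := c) (fun p => hO p.1) (hn.reindex _) hW' (hBB'.mono fun p => ?_)
    PT.id.snd.fst) (PT.backSum (fun p => hS p.1) (hn.reindex _) (ht.lift _ hx) (fun p => hfix _)
    (hlen.reindex _) (hls.lift (fun p : κ' => p.1) hx)
    (PT.singleton (e := fun _ => encTerm) ((hP.lift (fun p : κ' => p.1) hx).term .one
      PT.id.snd.snd.snd)) (hBB'.mono fun p => ?_))
  · exact (Nat.pow_le_pow_right (by positivity) (Nat.le_add_left _ _)).trans (hmem p.1 _ p.2.2)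
  · refine le_trans ?_ (hmem p.1 _ p.2.2)
    simpa [potential] using Nat.pow_le_pow_right (by positivity) (Nat.le_add_right _ _)

/-- The loop over the split positions keeps the layers passed so far and those to come. The former,
accumulated at the head, are already in the reversed order needed for propagation towards the
observable. -/
theorem PT.splitValues {o r : ∀ k, PauliString (n k) → ℝ} {ls : ∀ k, List (Layer (n k) c)}
    {θ b : κ → ℕ} (hn1 : ∀ k, 1 ≤ n k) (hlow : Poly w fun k => (4 * n k) ^ θ k)
    (hO : ∀ k P, (w k).B (encPauli P) (o k P)) (hS : ∀ k P, (w k).S (encPauli P) (r k P))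
    (hn : Poly w n) (hθ : PT w x fun k => encNat (θ k))
    (ht : PTTab w x t) (hfix : ∀ k, FixesLeft (t k)) (hfix' : ∀ k, FixesRight (t k))
    (hlen : Poly w fun k => (ls k).length)
    (hls : PT w x fun k => encList ((ls k).map encLayer))
    (hW : PT w x fun k => encList (List.ofFn fun i => encMat2 (W k i : Mat2)))
    (hb : PT w x fun k => encNat (b k)) (hB : Poly w fun k => growth c ^ b k)
    (hθb : ∀ k, θ k ≤ b k) :
    PT w x fun k => .real (∑ i ∈ Finset.range (ls k).length,
      splitValue (o k) (r k) (t k) (W k) (θ k) (b k) (ls k) i) := by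
  have hfold := PT.fold (l := fun k => (ls k).map encLayer) (st := fun k i =>
    .pair (encList (((ls k).take i).reverse.map encLayer)) (.pair (encList (((ls k).drop i).map encLayer))
      (.real (∑ j ∈ Finset.range i, splitValue (o k) (r k) (t k) (W k) (θ k) (b k) (ls k) j))))
    (by simpa using hlen) hls (x := x)
    ((PT.nil.pair (hls.pair .zero)).congr fun k => by simp [encList]) ?_
  · exact hfold.snd.snd.congr fun k => by simp
  let κ' := Below fun k => ((ls k).map encLayer).length
  let x' : κ' → Val := fun p => .pair (x p.1.1) (.pair (encNat p.1.2)
    (.pair (((ls p.1.1).map encLayer)[p.1.2]'p.2)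
      (.pair (encList (((ls p.1.1).take p.1.2).reverse.map encLayer))
        (.pair (encList (((ls p.1.1).drop p.1.2).map encLayer))
      (.real (∑ j ∈ Finset.range p.1.2,
        splitValue (o p.1.1) (r p.1.1) (t p.1.1) (W p.1.1) (θ p.1.1) (b p.1.1) (ls p.1.1) j))))))
  have hall : PT (fun p : κ' => w p.1.1) x' x' := PT.id
  have hlt : ∀ p : κ', p.1.2 < (ls p.1.1).length := fun p => by simpa using p.2
  have hdrop : ∀ p : κ', (ls p.1.1).drop p.1.2
      = (ls p.1.1)[p.1.2]'(hlt p) :: (ls p.1.1).drop (p.1.2 + 1) := fun p =>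
    List.drop_eq_getElem_cons (hlt p)
  have hrest : PT (fun p : κ' => w p.1.1) x' fun p =>
      encList (((ls p.1.1).drop p.1.2).map encLayer) := hall.snd.snd.snd.snd.fst
  have hsplit : PT (fun p : κ' => w p.1.1) x' fun p => .real
      (splitValue (o p.1.1) (r p.1.1) (t p.1.1) (W p.1.1) (θ p.1.1) (b p.1.1) (ls p.1.1) p.1.2) := by
    have hx : PT (fun p : κ' => w p.1.1) x' fun p => x p.1.1 := hall.fst
    refine PT.sum (e := fun _ => encPauli) ((hlow.reindex fun p : κ' => p.1.1).mono fun p =>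
      length_lowPaulis_le (hn1 _) _ (List.nodup_finRange _))
      ((PT.lowPaulis hn1 hn hlow hθ hW).lift (fun p : κ' => p.1.1) hx) ?_
    let κ'' := Elem fun p : κ' => NoisyPauli.lowPaulis (θ p.1.1) (List.finRange (n p.1.1))
    have hx' : PT (fun p : κ'' => w p.1.1.1) (fun p => .pair (x' p.1) (encPauli p.2.1))
        fun p => x p.1.1.1 := PT.id.fst.fst
    refine PT.throughValue (fun p => hO _) (fun p => hS _) (hn.reindex _)
      (hθ.lift (fun p : κ'' => p.1.1.1) hx') (ht.lift _ hx') (fun p => hfix _) (fun p => hfix' _)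
      ((hlen.reindex fun p : κ'' => p.1.1.1).mono fun p => by simp)
      ((hlen.reindex fun p : κ'' => p.1.1.1).mono fun p => by simp)
      PT.id.fst.snd.snd.snd.fst PT.id.fst.snd.snd.snd.snd.fst
      (hW.lift (fun p : κ'' => p.1.1.1) hx') (hb.lift (fun p : κ'' => p.1.1.1) hx')
      (hB.reindex _) PT.id.snd fun p => ?_
    exact (((lowPaulis_spec _ _ (List.nodup_finRange _)).2 _).1 p.2.2).1.trans (hθb _)
  refine (PT.pair ?_ (PT.pair (hrest.congr fun p => by rw [hdrop p, List.map_cons, encList]).snd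
    (PT.add hall.snd.snd.snd.snd.snd hsplit))).congr (y := fun p => .pair
      (encList (((ls p.1.1).take (p.1.2 + 1)).reverse.map encLayer)) _) fun p => ?_
  · refine (PT.cons (l := fun p => ((ls p.1.1).take p.1.2).reverse.map encLayer)
      hall.snd.snd.fst hall.snd.snd.snd.fst).congr fun p => ?_
    rw [List.take_succ_eq_append_getElem (hlt p)]
    simp [-List.take_append_getElem]
  · rw [Finset.sum_range_succ]

end Machine

/-! ## Reading the input and choosing the parameters -/

/-- The least exponent for which a power of `q` is at most `y`. -/
def firstBelow (q y : ℝ) : ℕ := sInf {i | q ^ i ≤ y}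

theorem pow_firstBelow_le {q y : ℝ} (hq1 : q < 1) (hy : 0 < y) :
    q ^ firstBelow q y ≤ y := by
  obtain ⟨i, hi⟩ := exists_pow_lt_of_lt_one hy hq1
  exact Nat.sInf_mem (s := {i | q ^ i ≤ y}) ⟨i, hi.le⟩

theorem lt_pow_of_lt_firstBelow {q y : ℝ} {i : ℕ} (hi : i < firstBelow q y) : y < q ^ i :=
  not_le.1 (Nat.notMem_of_lt_sInf hi)

/-! ### Search loops: least exponent, integer quotient, prefix of a list. -/

section Machine

variable {κ : Type} {w : κ → World} {x : κ → Val}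

/-- Successive powers of `q` are compared with the target; the number of passes is the answer, so no
logarithm has to be computed. -/
theorem PT.firstBelow {q : ℝ} (hq1 : q < 1) (hqx : ∀ {κ : Type} {w : κ → World}
    {x : κ → Val}, PT w x fun _ => .real q) {y : κ → ℝ} (hy : ∀ k, 0 < y k)
    (hpoly : Poly w fun k => NoisyPauli.firstBelow q (y k)) (hx : PT w x fun k => .real (y k)) :
    PT w x fun k => encNat (NoisyPauli.firstBelow q (y k)) := by
  have hw := PT.while (w := w) (len := fun k => NoisyPauli.firstBelow q (y k))
    (st := fun k i => .pair (.real (y k)) (.pair (.real (q ^ i)) (encNat i)))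
    (r := fun k i => q ^ i - y k) hpoly (PT.sub PT.id.snd.fst PT.id.fst) (fun k i hi => ?_)
    (PT.id.fst.pair (((PT.id.snd.fst.mul hqx).congr fun p => by rw [pow_succ]).pair
      ((PT.id.snd.snd.add .one).congr fun p => by simp [encNat])))
  · refine (PT.comp ?_ hw).snd.snd
    exact hx.pair ((PT.one.pair .zero).congr fun k => by simp [encNat])
  · rw [sub_pos]
    constructor
    · intro h
      refine lt_of_le_of_ne hi fun e => ?_
      rw [e] at h
      exact absurd h (not_lt.2 (pow_firstBelow_le hq1 (hy k)))
    · exact lt_pow_of_lt_firstBelow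

/-- Division by counting: the loop continues while `(i + 1) b ≤ a`, written as positivity of `a + 1
- (i + 1) b` for integers. -/
theorem PT.natDiv {a b : κ → ℕ} (hb0 : ∀ k, 0 < b k) (hpoly : Poly w fun k => a k / b k)
    (ha : PT w x fun k => encNat (a k)) (hb : PT w x fun k => encNat (b k)) :
    PT w x fun k => encNat (a k / b k) := by
  have hw := PT.while (w := w) (len := fun k => a k / b k)
    (st := fun k i => .pair (encNat (a k)) (.pair (encNat (b k)) (encNat i)))
    (r := fun k i => (a k : ℝ) + 1 - (i + 1) * b k) hpoly
    (PT.sub (PT.add PT.id.fst .one) (PT.mul (PT.add PT.id.snd.snd .one) PT.id.snd.fst))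
    (fun k i _ => ?_)
    (PT.id.fst.pair (PT.id.snd.fst.pair ((PT.id.snd.snd.add .one).congr fun p => by simp [encNat])))
  · refine (PT.comp ?_ hw).snd.snd
    exact ha.pair (hb.pair (PT.zero.congr fun k => by simp [encNat]))
  · rw [sub_pos, ← Nat.succ_le_iff, Nat.le_div_iff_mul_le (hb0 k), ← Nat.lt_succ_iff]
    exact_mod_cast Iff.rfl

theorem PT.take {l : κ → List Val} {m : κ → ℕ} (hpoly : Poly w m)
    (hl : PT w x fun k => encList (l k)) (hm : PT w x fun k => encNat (m k)) :
    PT w x fun k => encList ((l k).take (m k)) := by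
  have hlen : Poly w fun k => min (m k) (l k).length := hpoly.mono fun k => min_le_left _ _
  have hw := PT.while (w := w) (len := fun k => min (m k) (l k).length)
    (st := fun k i => .pair (encNat (m k)) (.pair (encNat i) (.pair (encList ((l k).drop i))
      (encList ((l k).take i).reverse))))
    (r := fun k i => if i < m k then if i < (l k).length then 1 else 0 else 0) hlen
    ?_ (fun k i _ => ?_) ?_
  · have h0 : PT w x fun k => .pair (encNat (m k)) (.pair (encNat 0) (.pair (encList ((l k).drop 0))
      (encList ((l k).take 0).reverse))) :=
      (hm.pair (PT.zero.pair (hl.pair .nil))).congr fun k => by simp [encNat, encList]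
    refine ((h0.comp hw).snd.snd.snd.reverse (hlen.mono fun k => by simp)).congr fun k => ?_
    rw [List.reverse_reverse, ← List.take_eq_take_min]
  · refine (PT.ite_lt PT.id.snd.fst PT.id.fst ?_ .zero).congr (y := fun p : Below (fun k => min (m k) (l k).length + 1) =>
      if p.1.2 < m p.1.1 then
      .real (if p.1.2 < (l p.1.1).length then 1 else 0) else .real 0) fun p => by split_ifs <;> rfl
    refine (PT.id.snd.snd.fst).comp (.of_prog .isPair fun p => ?_)
    dsimp only
    split_ifs with h
    · rw [encList_drop h]; exact .isPair_pair _ _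
    · rw [List.drop_eq_nil_of_le (by omega)]; exact .isPair_nil
  · rw [lt_min_iff]
    split_ifs <;> simp_all
  · have hlt : ∀ p : Below fun k => min (m k) (l k).length, p.1.2 < (l p.1.1).length := fun p =>
      (lt_min_iff.1 p.2).2
    have hall := PT.id (w := fun p : Below (fun k => min (m k) (l k).length) => w p.1.1)
      (x := fun p => .pair (encNat (m p.1.1)) (.pair (encNat p.1.2)
        (.pair (encList ((l p.1.1).drop p.1.2)) (encList ((l p.1.1).take p.1.2).reverse))))
    have hd := hall.snd.snd.fst.congr fun p => encList_drop (hlt p)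
    refine hall.fst.pair (PT.pair ?_ (hd.snd.pair ?_))
    · exact (hall.snd.fst.add .one).congr fun p => by simp [encNat]
    · refine (hd.fst.cons hall.snd.snd.snd).congr fun p => ?_
      rw [List.take_succ_eq_append_getElem (hlt p)]
      simp [-List.take_append_getElem]

end Machine

/-- The data of the input that do not concern the observable, and the state. -/
structure Setting (c : ℕ) where
  n : ℕ
  L : ℕ
  n_pos : 1 ≤ n
  L_pos : 1 ≤ L
  noise : Mat2 →ₗ[ℂ] Mat2
  channel : IsChannel noise
  desc : CircuitDesc n L c
  ρ : Op n
  ε : ℝ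
  δ : ℝ
  ε_pos : 0 < ε
  δ_pos : 0 < δ

namespace Setting

variable {c : ℕ}

def input (s : Setting c) : Val := encInput s.noise s.desc s.ε s.δ

/-- The added 1 keeps the cutoff positive, so that at least one layer is read and the threshold is
not a division by zero. -/
def cutoff (q ε δ : ℝ) : ℕ := firstBelow q (ε ^ 2 * δ) + 1

/-- The layers that the estimate with cutoff `k` depends on. -/
def layers (s : Setting c) (k : ℕ) : List (Layer s.n c) := s.desc.layers.take k

theorem length_layers (s : Setting c) (k : ℕ) : (s.layers k).length = min k s.L := by
  simp [layers, CircuitDesc.layers]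

/-- The weight up to which all Pauli strings are enumerated. -/
def threshold (s : Setting c) (k : ℕ) : ℕ := (k - 1) / (s.layers k).length

theorem threshold_le (s : Setting c) (k : ℕ) : s.threshold k ≤ k :=
  (Nat.div_le_self _ _).trans (Nat.sub_le _ _)

/-- The pigeonhole count: if every layer carried weight above the threshold, the path weight would
reach `k`. -/
theorem le_threshold_mul (s : Setting c) {k : ℕ} (hk : 1 ≤ k) :
    k ≤ (s.threshold k + 1) * (s.layers k).length := by
  have hpos : 0 < (s.layers k).length := by
    rw [length_layers]
    have := s.L_pos
    omega
  have := (Nat.div_lt_iff_lt_mul hpos).1 (Nat.lt_add_one ((k - 1) / (s.layers k).length))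
  rw [threshold]
  omega

variable {κ : Type} {w : κ → World} {x : κ → Val} {s : κ → Setting c}

theorem pt_noise (hx : PT w x fun k => (s k).input) : PTTab w x fun k => amp1 (s k).noise :=
  PT.noise hx.snd.snd.snd.snd.fst

theorem pt_final (hx : PT w x fun k => (s k).input) :
    PT w x fun k => encList (List.ofFn fun i => encMat2 ((s k).desc.final i : Mat2)) :=
  hx.snd.snd.snd.snd.snd.fst.fst

theorem pt_cutoff {q : ℝ} (hq1 : q < 1) (hqx : ∀ {κ : Type} {w : κ → World}
    {x : κ → Val}, PT w x fun _ => .real q)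
    (hpoly : Poly w fun k => cutoff q (s k).ε (s k).δ) (hx : PT w x fun k => (s k).input) :
    PT w x fun k => encNat (cutoff q (s k).ε (s k).δ) := by
  have hε : PT w x fun k => .real (s k).ε := hx.snd.snd.fst
  have hδ : PT w x fun k => .real (s k).δ := hx.snd.snd.snd.fst
  refine (PT.add (PT.firstBelow hq1 hqx (y := fun k => (s k).ε ^ 2 * (s k).δ)
    (fun k => by have := (s k).ε_pos; have := (s k).δ_pos; positivity)
    (hpoly.mono fun k => Nat.le_succ _)
    (((hε.mul hε).mul hδ).congr fun k => by rw [pow_two])) .one).congr fun k => ?_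
  simp [encNat, cutoff]

theorem pt_layers {m : κ → ℕ} (hpoly : Poly w m) (hx : PT w x fun k => (s k).input)
    (hm : PT w x fun k => encNat (m k)) :
    PT w x fun k => encList (((s k).layers (m k)).map encLayer) := by
  have hl : PT w x fun k => encList ((s k).desc.layers.map encLayer) :=
    hx.snd.snd.snd.snd.snd.fst.snd.congr fun k => by
      rw [CircuitDesc.layers, List.map_reverse, List.map_ofFn]; rfl
  exact (PT.take hpoly hl hm).congr fun k => by rw [layers, List.map_take]

end Setting

/-! ## The two algorithms -/

/-- Computability of a constant, whatever the input. -/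
def Constant (q : ℝ) : Prop :=
  ∀ {κ : Type} {w : κ → World} {x : κ → Val}, PT w x fun _ => .real q

section Bounds

theorem growth_pow_eq (c k : ℕ) : growth c ^ k = (2 ^ k) ^ (2 * (2 * c + 1)) := by
  rw [growth, show 4 = 2 ^ 2 from rfl, ← pow_mul, ← pow_mul, ← pow_mul]
  congr 1
  ring

variable {κ : Type} {w : κ → World}

theorem Poly.of_two_pow {m : κ → ℕ} (h : Poly w fun k => 2 ^ m k) :
    Poly w m ∧ ∀ c, Poly w fun k => growth c ^ m k :=
  ⟨h.mono fun _ => Nat.lt_two_pow_self.le, fun c => (h.pow _).mono fun _ => (growth_pow_eq c _).le⟩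

/-- Choose `s` with `q ^ s < 1/2`. The exponent `j` just before the first success satisfies `q ^ j >
ε² δ ≥ X⁻³`, whence `2 ^ j ≤ X ^ (3 s)`; the factor 4 covers the last exponent and the added 1. -/
theorem two_pow_cutoff_le {q : ℝ} (hq : 0 < q) (hq1 : q < 1) : ∃ s : ℕ, ∀ {X ε δ : ℝ}, 0 < ε → 0 < δ →
    1 ≤ X → 1 / ε ≤ X → 1 / δ ≤ X → (2 : ℝ) ^ Setting.cutoff q ε δ ≤ 4 * X ^ s := by
  obtain ⟨s, hs⟩ := exists_pow_lt_of_lt_one (show (0 : ℝ) < 1 / 2 by norm_num) hq1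
  refine ⟨3 * s, fun {X ε δ} hε hδ hX hεX hδX => ?_⟩
  rw [Setting.cutoff]
  rcases Nat.eq_zero_or_pos (firstBelow q (ε ^ 2 * δ)) with h0 | h0
  · rw [h0]
    have := one_le_pow₀ hX (n := 3 * s)
    norm_num
    linarith
  · obtain ⟨j, hj⟩ : ∃ j, firstBelow q (ε ^ 2 * δ) = j + 1 := ⟨_, (Nat.sub_add_cancel h0).symm⟩
    have h1 : ε ^ 2 * δ < q ^ j := lt_pow_of_lt_firstBelow (by omega)
    have hX0 : 0 < X := by linarith
    have h2 : 1 ≤ X ^ 3 * (ε ^ 2 * δ) := by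
      have a1 : 1 ≤ X * ε := by rwa [div_le_iff₀ hε] at hεX
      have a2 : 1 ≤ X * δ := by rwa [div_le_iff₀ hδ] at hδX
      calc (1 : ℝ) ≤ (X * ε) * (X * ε) * (X * δ) :=
            one_le_mul_of_one_le_of_one_le (one_le_mul_of_one_le_of_one_le a1 a1) a2
        _ = _ := by ring
    have h3 : 1 ≤ X ^ 3 * q ^ j := h2.trans (by gcongr)
    have h4 : (1 : ℝ) ≤ X ^ (3 * s) * (1 / 2) ^ j := by
      calc (1 : ℝ) ≤ (X ^ 3 * q ^ j) ^ s := one_le_pow₀ h3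
        _ = X ^ (3 * s) * (q ^ s) ^ j := by rw [mul_pow, ← pow_mul, ← pow_mul, ← pow_mul, mul_comm j]
        _ ≤ _ := by gcongr
    rw [hj, pow_succ, pow_succ]
    have h5 : (2 : ℝ) ^ j ≤ X ^ (3 * s) := by
      have := mul_le_mul_of_nonneg_right h4 (show (0 : ℝ) ≤ 2 ^ j by positivity)
      rwa [one_mul, mul_assoc, ← mul_pow, one_div, inv_mul_cancel₀ (by norm_num), one_pow,
        mul_one] at this
    linarith

end Bounds

/-! ### The algorithm for observables given as lists of terms. -/

section Terms

/-- An input with an observable given as a list of terms. -/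
structure TermsInput (c : ℕ) extends Setting c where
  M : ℕ
  T : Fin M → PauliString n × ℝ

variable {c : ℕ} {q : ℝ}

abbrev TermsInput.cutoff (q : ℝ) (s : TermsInput c) : ℕ := Setting.cutoff q s.ε s.δ

/-- Neither `L` nor `M` enters the size: at most `k` layers are read, and the dependence on `M` is
kept as a separate linear factor. -/
def TermsInput.world (q : ℝ) (s : TermsInput c) : World :=
  ⟨stateOracle s.ρ, noOracle, s.n + 2 ^ s.cutoff q⟩

def TermsInput.value (q : ℝ) (s : TermsInput c) (m : Fin s.M) : ℝ :=
  termValue (fun P => expval (pauliOp P) s.ρ) (amp1 s.noise) s.desc.final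
    (s.layers (s.cutoff q)) (s.cutoff q) (s.T m)

/-- Cutoff and relevant layers are computed once; the loop over the terms then costs `M + 1` times a
polynomial that is independent of `M`. -/
theorem computes_terms (hq1 : q < 1) (hqx : Constant q) :
    ∃ a b : ℕ, Computes (fun s : TermsInput c => s.world q)
      (fun s => .pair (encTerms s.T) s.input) (fun s => .real (∑ m, s.value q m))
      fun s => ((s.world q).size + 2) ^ a + (s.M + 1) * ((s.world q).size + 2) ^ b + 1 := by
  let κ := TermsInput c
  let w : κ → World := fun s => s.world q
  have hn : Poly w fun s => s.n := Poly.size.mono fun s => Nat.le_add_right _ _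
  have h2 : Poly w fun s => 2 ^ s.cutoff q := Poly.size.mono fun s => Nat.le_add_left _ _
  obtain ⟨hk, hgrow⟩ := h2.of_two_pow
  let x : κ → Val := fun s => .pair (.pair (encNat (s.cutoff q))
    (encList ((s.layers (s.cutoff q)).map encLayer))) s.input
  have hin : PT w (fun s => .pair (encTerms s.T) s.input) fun s => s.input := PT.id.snd
  have hcut := Setting.pt_cutoff (s := fun s : κ => s.toSetting) hq1 hqx hk hin
  have hlay := Setting.pt_layers (s := fun s : κ => s.toSetting) hk hin hcut
  have hpre : PT w (fun s => .pair (encTerms s.T) s.input) fun s => .pair (x s) (.pair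
      (encList (List.ofFn fun m => .pair (encPauli (s.T m).1) (.real (s.T m).2)))
        (.real ((List.ofFn (s.value q)).take 0).sum)) :=
    ((hcut.pair hlay).pair hin).pair (PT.id.fst.pair (PT.zero.congr fun s => by simp))
  obtain ⟨a, hpre⟩ := hpre.computes_pow
  obtain ⟨b, hfold⟩ := PT.fold_computes (w := w) (x := x)
    (l := fun s => List.ofFn fun m => .pair (encPauli (s.T m).1) (.real (s.T m).2))
    (st := fun s i => .real ((List.ofFn (s.value q)).take i).sum) (by
      let κ' := Below fun s : κ => (List.ofFn fun m =>
        Val.pair (encPauli (s.T m).1) (.real (s.T m).2)).length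
      have hall := PT.id (w := fun p : κ' => w p.1.1) (x := fun p : κ' => .pair (x p.1.1)
        (.pair (encNat p.1.2) (.pair ((List.ofFn fun m => .pair (encPauli (p.1.1.T m).1)
          (.real (p.1.1.T m).2))[p.1.2]'p.2) (.real ((List.ofFn (p.1.1.value q)).take p.1.2).sum))))
      have hM : ∀ p : κ', p.1.2 < p.1.1.M := fun p => by simpa using p.2
      have hval := PT.termValue (w := fun p : κ' => w p.1.1) (r := fun p P => expval (pauliOp P) p.1.1.ρ)
        (t := fun p => amp1 p.1.1.noise) (W := fun p => p.1.1.desc.final)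
        (ls := fun p => p.1.1.layers (p.1.1.cutoff q)) (b := fun p => p.1.1.cutoff q)
        (p := fun p => p.1.1.T ⟨p.1.2, hM p⟩) (fun p P => ⟨P, rfl, rfl⟩) (hn.reindex _)
        (Setting.pt_noise (s := fun p : κ' => p.1.1.toSetting) hall.fst.snd)
        (fun p => fixesLeft_amp1 p.1.1.channel)
        ((hk.reindex _).mono fun p => by rw [Setting.length_layers]; exact min_le_left _ _)
        hall.fst.fst.snd
        (Setting.pt_final (s := fun p : κ' => p.1.1.toSetting) hall.fst.snd)
        hall.fst.fst.fst ((hgrow c).reindex _)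
        (hall.snd.snd.fst.congr fun p => by simp)
      refine (PT.add hall.snd.snd.snd hval).congr fun p => ?_
      rw [List.take_succ_eq_append_getElem (by simpa using hM p)]
      simp [-List.take_append_getElem, TermsInput.value])
  have h := hpre.comp hfold
  simp only [List.length_ofFn, Nat.succ_eq_add_one] at h
  refine ⟨a, b, ?_⟩
  convert h using 3 with s
  rw [List.take_of_length_le (by simp), List.sum_ofFn]

end Terms

/-! ### The algorithm for observables given by an oracle. -/

section Observable

/-- An input with unital noise and an observable given by an oracle. -/
structure ObsInput (c : ℕ) extends Setting c where
  unital : IsUnital noise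
  O : Op n

variable {c : ℕ} {q : ℝ}

abbrev ObsInput.cutoff (q : ℝ) (s : ObsInput c) : ℕ := Setting.cutoff q s.ε s.δ

abbrev ObsInput.low (q : ℝ) (s : ObsInput c) : ℕ := s.threshold (s.cutoff q)

/-- The last summand bounds the number of light strings to be enumerated. It becomes polynomial in
`n` only through the assumption on the depth, in `ObsInput.time_le`. -/
def ObsInput.world (q : ℝ) (s : ObsInput c) : World :=
  ⟨stateOracle s.ρ, obsOracle s.O, s.n + 2 ^ s.cutoff q + (4 * s.n) ^ s.low q⟩

def ObsInput.value (q : ℝ) (s : ObsInput c) : ℝ :=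
  ∑ i ∈ Finset.range (s.layers (s.cutoff q)).length,
    splitValue (pauliCoeff s.O) (fun P => expval (pauliOp P) s.ρ) (amp1 s.noise) s.desc.final
      (s.low q) (s.cutoff q) (s.layers (s.cutoff q)) i

theorem pt_obs (hq1 : q < 1) (hqx : Constant q) :
    PT (fun s : ObsInput c => s.world q) (fun s => s.input) fun s => .real (s.value q) := by
  let κ := ObsInput c
  let w : κ → World := fun s => s.world q
  have hn : Poly w fun s => s.n :=
    Poly.size.mono fun s => (Nat.le_add_right _ _).trans (Nat.le_add_right _ _)
  have h2 : Poly w fun s => 2 ^ s.cutoff q :=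
    Poly.size.mono fun s => (Nat.le_add_left _ _).trans (Nat.le_add_right _ _)
  have hlow : Poly w fun s => (4 * s.n) ^ s.low q := Poly.size.mono fun s => Nat.le_add_left _ _
  obtain ⟨hk, hgrow⟩ := h2.of_two_pow
  have hin : PT w (fun s => s.input) fun s => s.input := PT.id
  have hcut := Setting.pt_cutoff (s := fun s : κ => s.toSetting) hq1 hqx hk hin
  have hlay := Setting.pt_layers (s := fun s : κ => s.toSetting) hk hin hcut
  have hlen : Poly w fun s => (s.layers (s.cutoff q)).length :=
    hk.mono fun s => by rw [Setting.length_layers]; exact min_le_left _ _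
  have hL := PT.length (by simpa using hlen) hlay
  have hθ : PT w (fun s => s.input) fun s => encNat (s.low q) := by
    refine PT.natDiv (fun s => ?_) (hk.mono fun s => s.threshold_le _)
      ((hcut.natSub (PT.natCast 1)).congr fun s => rfl) (hL.congr fun s => by rw [List.length_map])
    rw [Setting.length_layers]
    have := s.L_pos
    have : 1 ≤ s.cutoff q := Nat.le_add_left _ _
    omega
  exact PT.splitValues (n := fun s : κ => s.n) (c := c) (fun s => s.n_pos) hlow
    (fun s P => ⟨P, rfl, rfl⟩) (fun s P => ⟨P, rfl, rfl⟩) hn hθ (Setting.pt_noise hin)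
    (fun s => fixesLeft_amp1 s.channel) (fun s => fixesRight_amp1 s.unital) hlen hlay
    (Setting.pt_final hin) hcut (hgrow c) fun s => s.threshold_le _

end Observable

/-! ### Choice of the contraction rate and numerical bounds on the running time. -/

section Parameters

/-- The program knows only the constants 0 and 1, so the rate is taken rational, of the form `1 -
1/(m + 2)`; the 2 keeps it positive. -/
theorem exists_contraction {p₀ : ℝ} (hp₀ : 0 < p₀) : ∃ q : ℝ, 0 < q ∧ q < 1 ∧ 1 - q ≤ p₀ ∧
    Constant q := by
  obtain ⟨m, hm⟩ := exists_nat_one_div_lt hp₀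
  refine ⟨1 - ((m + 2 : ℕ) : ℝ)⁻¹, ?_, ?_, ?_, fun {κ w x} => PT.one.sub (PT.natCast _).inv⟩
  · rw [sub_pos]
    exact inv_lt_one_of_one_lt₀ (by push_cast; linarith [Nat.cast_nonneg (α := ℝ) m])
  · exact sub_lt_self _ (by positivity)
  · rw [sub_sub_cancel]
    refine le_trans ?_ hm.le
    rw [one_div]
    exact inv_anti₀ (by positivity) (by push_cast; linarith)

variable {n L c : ℕ} {q : ℝ}

theorem law_failure_cutoff_le (hq : 0 < q) (hq1 : q < 1) {p₀ : ℝ} (hp : 1 - q ≤ p₀)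
    (E : NoisyEnsemble n L c) (hE : p₀ ≤ E.rate) (hL : 1 ≤ L) {ρ O : Op n} (hρ : IsState ρ)
    (hO : O.IsHermitian) {ε δ : ℝ} (hε : 0 < ε) (hδ : 0 < δ) :
    E.law (failure (Setting.cutoff q ε δ) E.noise O ρ ε) ≤ ENNReal.ofReal δ := by
  refine law_failure_le E hL hq1.le ((contractionSq_le_of_rate E hq.le (hp.trans hE)).trans ?_)
    hρ hO hε ?_
  -- The rate assumption yields `q²`, and `q² ≤ q` is enough.
  · nlinarith
  · refine le_trans ?_ (pow_firstBelow_le hq1 (y := ε ^ 2 * δ) (by positivity))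
    exact pow_le_pow_of_le_one hq.le hq1.le (Nat.le_succ _)

theorem isHermitian_sumOfTerms {M : ℕ} (T : Fin M → PauliString n × ℝ) :
    (sumOfTerms T).IsHermitian := by
  simp [Matrix.IsHermitian, sumOfTerms, Matrix.conjTranspose_sum, conjTranspose_pauliOp]

theorem TermsInput.time_le (hq : 0 < q) (hq1 : q < 1) (a b : ℕ) : ∃ K r : ℕ, ∀ s : TermsInput c,
    1 ≤ s.M → (((s.world q).size + 2) ^ a + (s.M + 1) * ((s.world q).size + 2) ^ b + 1 : ℕ)
      ≤ (s.M : ℝ) * (K * (s.n + 1 / s.ε + 1 / s.δ) ^ r) := by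
  obtain ⟨e, he⟩ := two_pow_cutoff_le hq hq1
  -- The size plus 2 is at most `n + 4 X ^ e + 2 ≤ 7 X ^ (e + 1)`. Since `M ≥ 1`, the three
  -- contributions to the time are at most `1 + 2 + 1 = 4` times `M Z ^ (a + b)`.
  refine ⟨4 * 7 ^ (a + b), (e + 1) * (a + b), fun s hM => ?_⟩
  set X : ℝ := s.n + 1 / s.ε + 1 / s.δ with hX
  have hε : 0 < 1 / s.ε := one_div_pos.2 s.ε_pos
  have hδ : 0 < 1 / s.δ := one_div_pos.2 s.δ_pos
  have hn : (1 : ℝ) ≤ s.n := by exact_mod_cast s.n_pos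
  have hX1 : 1 ≤ X := by linarith
  have h2 : (2 : ℝ) ^ s.cutoff q ≤ 4 * X ^ e :=
    he s.ε_pos s.δ_pos hX1 (by linarith) (by linarith)
  have hsize : (((s.world q).size + 2 : ℕ) : ℝ) ≤ 7 * X ^ (e + 1) := by
    have h3 : X ^ e ≤ X ^ (e + 1) := pow_le_pow_right₀ hX1 (Nat.le_succ _)
    have h4 : X ≤ X ^ (e + 1) := le_self_pow₀ hX1 (Nat.succ_ne_zero _)
    rw [TermsInput.world]
    push_cast
    linarith
  set Z : ℝ := (((s.world q).size + 2 : ℕ) : ℝ) with hZ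
  have hZ1 : 1 ≤ Z := by rw [hZ]; exact_mod_cast Nat.le_add_left _ _
  have hM' : (1 : ℝ) ≤ s.M := by exact_mod_cast hM
  have hZa : Z ^ a ≤ Z ^ (a + b) := pow_le_pow_right₀ hZ1 (Nat.le_add_right _ _)
  have hZb : Z ^ b ≤ Z ^ (a + b) := pow_le_pow_right₀ hZ1 (Nat.le_add_left _ _)
  have hZ0 : 1 ≤ Z ^ (a + b) := one_le_pow₀ hZ1
  calc _ = Z ^ a + (s.M + 1) * Z ^ b + 1 := by rw [hZ]; push_cast; ring
    _ ≤ s.M * (4 * Z ^ (a + b)) := by nlinarith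
    _ ≤ s.M * (4 * (7 * X ^ (e + 1)) ^ (a + b)) := by gcongr
    _ = _ := by push_cast; rw [mul_pow, ← pow_mul]; ring

theorem ObsInput.time_le (hq : 0 < q) (hq1 : q < 1) (m : ℕ) {a κ b : ℝ} (ha : 0 < a)
    (hκ : 0 < κ) : ∃ K r : ℕ, ∀ s : ObsInput c, a * Real.log s.n ≤ s.L →
      κ * (s.n : ℝ) ^ (-b) ≤ s.ε → κ * (s.n : ℝ) ^ (-b) ≤ s.δ →
      (((s.world q).size + 2) ^ m : ℕ) ≤ K * (s.n : ℝ) ^ r := by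
  obtain ⟨e, he⟩ := two_pow_cutoff_le hq hq1
  obtain ⟨β, hβ⟩ := exists_nat_ge b
  have hC : 1 ≤ 1 + 2 / κ := by linarith [div_pos two_pos hκ]
  set D : ℝ := 4 * (1 + 2 / κ) ^ e with hD
  have hD1 : 1 ≤ D := by linarith [one_le_pow₀ hC (n := e)]
  set f : ℕ := (β + 1) * e with hf
  -- From `2 ^ k ≤ D n ^ f` one gets `k log 2 ≤ log D + f log n ≤ L (log D + f/a)`, using `L ≥ 1`
  -- and `L ≥ a log n`. Thus `Θ` bounds `k / L`.
  obtain ⟨Θ, hΘ⟩ := exists_nat_ge ((Real.log D + f / a) / Real.log 2)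
  obtain ⟨K, hK⟩ := exists_nat_ge ((3 + D + 4 ^ Θ) ^ m)
  refine ⟨K, (1 + f + Θ) * m, fun s hL hε hδ => ?_⟩
  have hn : (1 : ℝ) ≤ s.n := by exact_mod_cast s.n_pos
  have hn0 : (0 : ℝ) < s.n := by linarith
  have hinv : ∀ {y : ℝ}, κ * (s.n : ℝ) ^ (-b) ≤ y → 1 / y ≤ 1 / κ * (s.n : ℝ) ^ β := by
    intro y hy
    calc 1 / y ≤ 1 / (κ * (s.n : ℝ) ^ (-b)) := one_div_le_one_div_of_le (by positivity) hy
      _ = 1 / κ * (s.n : ℝ) ^ b := by rw [Real.rpow_neg hn0.le]; field_simp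
      _ ≤ 1 / κ * (s.n : ℝ) ^ (β : ℝ) := by
        gcongr
      _ = _ := by rw [Real.rpow_natCast]
  have h2 : (2 : ℝ) ^ s.cutoff q ≤ D * (s.n : ℝ) ^ f := by
    have h1 : (s.n : ℝ) ^ β ≤ (s.n : ℝ) ^ (β + 1) := pow_le_pow_right₀ hn (Nat.le_succ _)
    have h3 : (1 : ℝ) ≤ (s.n : ℝ) ^ (β + 1) := one_le_pow₀ hn
    have h4 : 1 / κ * (s.n : ℝ) ^ β ≤ (1 + 2 / κ) * (s.n : ℝ) ^ (β + 1) := by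
      refine mul_le_mul ?_ h1 (by positivity) (by positivity)
      have : 2 / κ = 1 / κ + 1 / κ := by ring
      linarith [one_div_pos.2 hκ]
    have := he (X := (1 + 2 / κ) * (s.n : ℝ) ^ (β + 1)) s.ε_pos s.δ_pos
      (one_le_mul_of_one_le_of_one_le hC h3) ((hinv hε).trans h4) ((hinv hδ).trans h4)
    rwa [mul_pow, ← pow_mul, ← mul_assoc] at this
  have hlow : s.low q ≤ Θ := by
    have hk1 : 1 ≤ s.cutoff q := Nat.le_add_left _ _
    rw [ObsInput.low, Setting.threshold, Setting.length_layers]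
    -- If the circuit has at least `k` layers, the threshold is `(k - 1) / k = 0` and only the
    -- identity string is enumerated.
    rcases le_total (s.cutoff q) s.L with hkL | hkL
    · rw [min_eq_left hkL, Nat.div_eq_of_lt (by omega)]
      exact Nat.zero_le _
    · rw [min_eq_right hkL]
      refine Nat.div_le_of_le_mul ?_
      have hL1 : (1 : ℝ) ≤ s.L := by exact_mod_cast s.L_pos
      have hlog2 : 0 < Real.log 2 := Real.log_pos one_lt_two
      have h3 : s.cutoff q * Real.log 2 ≤ Real.log D + f * Real.log s.n := by
        have := Real.log_le_log (by positivity) h2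
        rwa [Real.log_pow, Real.log_mul (by positivity) (by positivity), Real.log_pow] at this
      have h4 : Real.log D ≤ s.L * Real.log D := le_mul_of_one_le_left (Real.log_nonneg hD1) hL1
      have h5 : f * Real.log s.n ≤ s.L * (f / a) := by
        have : f * Real.log s.n = f / a * (a * Real.log s.n) := by field_simp
        rw [this, mul_comm (s.L : ℝ)]
        gcongr
      have h6 : (s.cutoff q : ℝ) ≤ s.L * Θ := by
        calc (s.cutoff q : ℝ) ≤ s.L * (Real.log D + f / a) / Real.log 2 := by
              rw [le_div_iff₀ hlog2]
              linarith
          _ = s.L * ((Real.log D + f / a) / Real.log 2) := mul_div_assoc _ _ _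
          _ ≤ _ := by gcongr
      have h7 : s.cutoff q ≤ s.L * Θ := by exact_mod_cast h6
      omega
  have hsize : (((s.world q).size + 2 : ℕ) : ℝ) ≤ (3 + D + 4 ^ Θ) * (s.n : ℝ) ^ (1 + f + Θ) := by
    have h1 : (s.n : ℝ) ≤ (s.n : ℝ) ^ (1 + f + Θ) := le_self_pow₀ hn (by omega)
    have h3 : (s.n : ℝ) ^ f ≤ (s.n : ℝ) ^ (1 + f + Θ) := pow_le_pow_right₀ hn (by omega)
    have h4 : (s.n : ℝ) ^ Θ ≤ (s.n : ℝ) ^ (1 + f + Θ) := pow_le_pow_right₀ hn (by omega)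
    have h5 : (4 * (s.n : ℝ)) ^ s.low q ≤ 4 ^ Θ * (s.n : ℝ) ^ Θ := by
      rw [← mul_pow]
      exact pow_le_pow_right₀ (by linarith) hlow
    have h6 : D * (s.n : ℝ) ^ f ≤ D * (s.n : ℝ) ^ (1 + f + Θ) := by gcongr
    have h7 : (4 : ℝ) ^ Θ * (s.n : ℝ) ^ Θ ≤ 4 ^ Θ * (s.n : ℝ) ^ (1 + f + Θ) := by gcongr
    rw [ObsInput.world]
    push_cast
    linarith
  calc ((((s.world q).size + 2) ^ m : ℕ) : ℝ) = (((s.world q).size + 2 : ℕ) : ℝ) ^ m := by push_cast; rfl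
    _ ≤ ((3 + D + 4 ^ Θ) * (s.n : ℝ) ^ (1 + f + Θ)) ^ m := by gcongr
    _ = (3 + D + 4 ^ Θ) ^ m * (s.n : ℝ) ^ ((1 + f + Θ) * m) := by rw [mul_pow, ← pow_mul]
    _ ≤ _ := by gcongr

end Parameters

end NoisyPauli

end

theorem mainTheorem1 (c : ℕ) (p₀ : ℝ) (hp₀ : 0 < p₀) :
    (∃ (prog : NoisyPauli.Prog) (cutoff : ℝ → ℝ → ℕ) (K r : ℕ),
      ∀ (n L M : ℕ), 1 ≤ n → 1 ≤ L → 1 ≤ M →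
      ∀ (E : NoisyPauli.NoisyEnsemble n L c), p₀ ≤ E.rate →
      ∀ (ρ : NoisyPauli.Op n), NoisyPauli.IsState ρ →
      ∀ (T : Fin M → NoisyPauli.PauliString n × ℝ) (ε δ : ℝ), 0 < ε → 0 < δ →
        (∀ (ω : NoisyPauli.Unitaries n L) (d : NoisyPauli.CircuitDesc n L c), d.Describes ω →
          ∃ t : ℕ, (t : ℝ) ≤ M * (K * (n + 1 / ε + 1 / δ) ^ r) ∧
            NoisyPauli.Runs (NoisyPauli.stateOracle ρ) NoisyPauli.noOracle prog
              (.pair (NoisyPauli.encTerms T) (NoisyPauli.encInput E.noise d ε δ))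
              (.real (NoisyPauli.truncatedEstimate (cutoff ε δ) E.noise ω
                (NoisyPauli.sumOfTerms T) ρ)) t) ∧
        E.law (NoisyPauli.failure (cutoff ε δ) E.noise (NoisyPauli.sumOfTerms T) ρ ε)
          ≤ ENNReal.ofReal δ) ∧
    (∃ (prog : NoisyPauli.Prog) (cutoff : ℝ → ℝ → ℕ),
      ∀ (a κ b : ℝ), 0 < a → 0 < κ → 0 < b → ∃ (K r : ℕ),
      ∀ (n L : ℕ), 1 ≤ n → 1 ≤ L → a * Real.log n ≤ L →
      ∀ (E : NoisyPauli.NoisyEnsemble n L c), p₀ ≤ E.rate → NoisyPauli.IsUnital E.noise →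
      ∀ (ρ : NoisyPauli.Op n), NoisyPauli.IsState ρ →
      ∀ (O : NoisyPauli.Op n), O.IsHermitian →
      ∀ (ε δ : ℝ), κ * (n : ℝ) ^ (-b) ≤ ε → κ * (n : ℝ) ^ (-b) ≤ δ →
        (∀ (ω : NoisyPauli.Unitaries n L) (d : NoisyPauli.CircuitDesc n L c), d.Describes ω →
          ∃ t : ℕ, (t : ℝ) ≤ K * (n : ℝ) ^ r ∧
            NoisyPauli.Runs (NoisyPauli.stateOracle ρ) (NoisyPauli.obsOracle O) prog
              (NoisyPauli.encInput E.noise d ε δ)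
              (.real (NoisyPauli.truncatedEstimate (cutoff ε δ) E.noise ω O ρ)) t) ∧
        E.law (NoisyPauli.failure (cutoff ε δ) E.noise O ρ ε) ≤ ENNReal.ofReal δ) := by
  obtain ⟨q, hq, hq1, hqp, hqx⟩ := NoisyPauli.exists_contraction hp₀
  constructor
  · obtain ⟨a, b, prog, hprog⟩ := NoisyPauli.computes_terms (c := c) hq1 hqx
    obtain ⟨K, r, hK⟩ := NoisyPauli.TermsInput.time_le (c := c) hq hq1 a b
    refine ⟨prog, NoisyPauli.Setting.cutoff q, K, r, ?_⟩
    intro n L M hn hL hM E hE ρ hρ T ε δ hε hδ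
    refine ⟨fun ω d hd => ?_, NoisyPauli.law_failure_cutoff_le hq hq1 hqp E hE hL hρ
      (NoisyPauli.isHermitian_sumOfTerms T) hε hδ⟩
    obtain ⟨t, ht, hrun⟩ := hprog
      ⟨⟨n, L, hn, hL, E.noise, E.noise_channel, d, ρ, ε, δ, hε, hδ⟩, M, T⟩
    refine ⟨t, (Nat.cast_le.2 ht).trans (hK _ hM), ?_⟩
    rw [NoisyPauli.truncatedEstimate_eq_sum_termValue E.noise_channel hL hd hρ T
      (k := NoisyPauli.Setting.cutoff q ε δ) (Nat.le_add_left _ _)]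
    exact hrun
  -- The program and the cutoff are fixed before `a`, `κ` and `b`; these constants affect only the
  -- numerical bound on the size.
  · obtain ⟨m, prog, hprog⟩ := (NoisyPauli.pt_obs (c := c) hq1 hqx).computes_pow
    refine ⟨prog, NoisyPauli.Setting.cutoff q, ?_⟩
    intro a κ b ha hκ hb
    obtain ⟨K, r, hK⟩ := NoisyPauli.ObsInput.time_le (c := c) hq hq1 m ha hκ
    refine ⟨K, r, ?_⟩
    intro n L hn hL hlog E hE hU ρ hρ O hO ε δ hε hδ
    have hpos : 0 < κ * (n : ℝ) ^ (-b) := mul_pos hκ (Real.rpow_pos_of_pos (by exact_mod_cast hn) _)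
    have hε0 := hpos.trans_le hε
    have hδ0 := hpos.trans_le hδ
    refine ⟨fun ω d hd => ?_, NoisyPauli.law_failure_cutoff_le hq hq1 hqp E hE hL hρ hO hε0 hδ0⟩
    let s : NoisyPauli.ObsInput c :=
      ⟨⟨n, L, hn, hL, E.noise, E.noise_channel, d, ρ, ε, δ, hε0, hδ0⟩, hU, O⟩
    obtain ⟨t, ht, hrun⟩ := hprog s
    refine ⟨t, (Nat.cast_le.2 ht).trans (hK s hlog hε hδ), ?_⟩
    rw [NoisyPauli.truncatedEstimate_eq_sum_splitValue E.noise_channel hL hd hρ O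
      (s.le_threshold_mul (k := NoisyPauli.Setting.cutoff q ε δ) (Nat.le_add_left _ _))]
    exact hrun
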